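/- Let $n,d\ge 0$ be integers and let $B^H_1,\dots,B^H_d$ be independent fractional Brownian motions with Hurst parameter $H\in(0,1)$ on a probability space, with almost surely continuous paths. Let $U_1,\dots,U_d:\mathbb R^n\to\mathbb R^n$ be differentiable vector fields with derivative matrices $W_\gamma=(\partial_jU^i_\gamma)_{i,j}$ such that, for all $\gamma,i,j$ and all $x,y\in\mathbb R^n$, $$|U^i_\gamma(x)|\le M_\gamma,\qquad |U^i_\gamma(x)-U^i_\gamma(y)|\le M^{(1)}_\gamma\|x-y\|_2,\qquad |W^i_{\gamma,j}(x)-W^i_{\gamma,j}(y)|\le M^{(2)}_\gamma\|x-y\|_2 .$$ Let $\alpha=1-H+\delta$ and $\beta=H-\varepsilon$ with $0<\varepsilon<\delta$ and $1-H<\alpha<1/2$, and let $T>0$. Write $\|f\|_{\beta,T}=\sup_{0\le s<t\le T}|f(t)-f(s)|/(t-s)^\beta$. Let $\Phi$ be the flow on $[0,T]$ driven by these processes: almost surely, for every $x\in\mathbb R^n$, the path $t\mapsto\Phi_t(x)$ is $(1-\alpha)$-Hölder on $[0,T]$ and $$\Phi_t(x)=x+\sum_{\gamma=1}^d\int_0^tU_\gamma(\Phi_s(x))\,dB^H_\gamma(s),\qquad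 t\in[0,T].$$ Here the integrals are pathwise generalized Stieltjes integrals, $\int_a^bf\,dg=(-1)^\alpha\int_a^bD^\alpha_{a+}f(x)\,D^{1-\alpha}_{b-}g_{b-}(x)\,dx$, where $D^\alpha_{a+}$ and $D^{1-\alpha}_{b-}$ are the Weyl fractional derivatives and $g_{b-}=g-g(b-)$. Then almost surely $\|B^H_\gamma\|_{\beta,T}<\infty$ for all $\gamma$, and $\Phi_r$ is differentiable on $\mathbb R^n$ for every $r\in[0,T]$. Moreover there are a constant $c>0$ and a nonnegative random variable $C_T$ such that almost surely, for all $x,v\in\mathbb R^n$, the pushed forward vectors $v_r=D\Phi_r(x)v$ satisfy $$\sup_{r\in[0,T]}\|v_r\|_2\;\le\;\sup_{r\in[0,T]}\|v_r\|_1\;\le\;c\,\|v\|_1\,2^{C_T\,T}.$$ The random variable is of the form $C_T=F\big(\|B^H_1\|_{\beta,T},\dots,\|B^H_d\|_{\beta,T}\big)$ with $F$ a measurable function. The random variables $\|B^H_\gamma\|_{\beta,T}$ and $C_T$ are integrable, and $$E\big[C_T^{\beta}\big]\;\le\;\big(E[C_T]\big)^{\beta}\;\le\;C\,E\big[\|B^H_\gamma\|_{\beta,T}\big]\qquad(\gamma=1,\dots,d),$$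 the expectation on the right being the same for every $\gamma$. If $d=1$, there is a constant $C_1\ge 0$ such that almost surely, for all $x,v\in\mathbb R^n$, $$\sup_{r\in[0,T]}\|v_r\|_2\;\le\;c\,\|v\|_1\,2^{C_1\,T\,\|B^H\|_{\beta,T}^{1/\beta}} .$$ The constants $c,C,C_1$ and the function $F$ depend only on $\alpha$, $\beta$, $n$, $d$ and $(M_\gamma,M^{(1)}_\gamma,M^{(2)}_\gamma)_{1\le\gamma\le d}$. -/

import Mathlib

open MeasureTheory ProbabilityTheory Set
open scoped NNReal ENNReal

noncomputable section

/-- The left-sided Weyl (Riemann-Liouville) derivative of order `α` of `f`, based at `a`, at the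
point `x > a`, in its Marchaud form. -/
def weylLeft (α a : ℝ) (f : ℝ → ℝ) (x : ℝ) : ℝ :=
  (Real.Gamma (1 - α))⁻¹ *
    (f x / (x - a) ^ α + α * ∫ y in a..x, (f x - f y) / (x - y) ^ (1 + α))

/-- The right-sided Weyl derivative of order `α` of `f`, based at `b`, at the point `x < b`, in its
Marchaud form and without the usual phase factor `(-1) ^ α = exp (i π α)`. -/
def weylRight (α b : ℝ) (f : ℝ → ℝ) (x : ℝ) : ℝ :=
  (Real.Gamma (1 - α))⁻¹ *
    (f x / (b - x) ^ α + α * ∫ y in x..b, (f x - f y) / (y - x) ^ (1 + α))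

/-- The generalized Stieltjes integral of `f` with respect to `g` over `[a, b]`,
`(-1) ^ α ∫ D^α_{a+} f · D^{1-α}_{b-} g_{b-}` with `g_{b-} = g - g(b-)`.  The phase factor
`(-1) ^ (1 - α)` contained in `D^{1-α}_{b-}` and the leading `(-1) ^ α` multiply to `-1`, so that
the integral is real. -/
def genStieltjes (α a b : ℝ) (f g : ℝ → ℝ) : ℝ :=
  -∫ x in a..b, weylLeft α a f x * weylRight (1 - α) b (fun y => g y - Function.leftLim g b) x

/-- `f` is `lam`-Hölder continuous on `[0, T]`. -/
def IsHolderPath {E : Type*} [PseudoEMetricSpace E] (lam T : ℝ) (f : ℝ → E) : Prop :=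
  MemHolder lam.toNNReal ((Icc 0 T).domRestrict f)

/-- The `lam`-Hölder seminorm of `f` on `[0, T]`, that is, the least upper bound of
`dist (f t) (f s) / |t - s| ^ lam` for `0 ≤ s < t ≤ T` (to be used for `IsHolderPath lam T f`). -/
def pathHolderNorm {E : Type*} [PseudoEMetricSpace E] (lam T : ℝ) (f : ℝ → E) : ℝ :=
  (nnHolderNorm lam.toNNReal ((Icc 0 T).domRestrict f) : ℝ)

/-- Fractional Brownian motion with Hurst parameter `H`, in a version with (almost surely)
continuous paths.  Only the times `t ≥ 0` matter. -/
structure IsFractionalBrownianMotion {Ω : Type*} [MeasurableSpace Ω] (H : ℝ) (B : ℝ → Ω → ℝ)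
    (μ : Measure Ω) : Prop where
  gaussian : IsGaussianProcess (fun (t : ℝ≥0) (ω : Ω) => B t ω) μ
  mean_zero : ∀ t, 0 ≤ t → ∫ ω, B t ω ∂μ = 0
  covariance_eq : ∀ s t, 0 ≤ s → 0 ≤ t →
    cov[B s, B t; μ] = (s ^ (2 * H) + t ^ (2 * H) - |t - s| ^ (2 * H)) / 2
  continuous_paths : ∀ᵐ ω ∂μ, ContinuousOn (fun t => B t ω) (Ici 0)

/-- The entry `(i, j)` of the matrix of spatial derivatives of the vector field `U` at `x`. -/
def spatialDeriv {n : ℕ} (U : EuclideanSpace ℝ (Fin n) → EuclideanSpace ℝ (Fin n))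
    (x : EuclideanSpace ℝ (Fin n)) (i j : Fin n) : ℝ :=
  (fderiv ℝ U x (EuclideanSpace.single j 1)) i

/-- The regularity assumptions on one vector field: it is differentiable, its components are
bounded by `M` and are Lipschitz with constant `M₁`, and the entries of its derivative are
Lipschitz with constant `M₂`. -/
structure FieldBounds {n : ℕ} (U : EuclideanSpace ℝ (Fin n) → EuclideanSpace ℝ (Fin n))
    (M M₁ M₂ : ℝ) : Prop where
  differentiable : Differentiable ℝ U
  bounded : ∀ i x, |U x i| ≤ M
  lipschitz : ∀ i x y, |U x i - U y i| ≤ M₁ * ‖x - y‖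
  lipschitz_deriv : ∀ i j x y, |spatialDeriv U x i j - spatialDeriv U y i j| ≤ M₂ * ‖x - y‖

/-- `Φ` is (one realisation of) the flow on `[0, T]` driven by the paths `b k` along the vector
fields `U k`: for every starting point `x` the path `t ↦ Φ t x` is `(1 - α)`-Hölder on `[0, T]` and
`Φ t x = x + ∑ k, ∫₀ᵗ U k (Φ s x) d(b k)(s)`, componentwise, for all `t ∈ [0, T]`. -/
structure IsFlowDrivenBy {n d : ℕ} (α T : ℝ)
    (U : Fin d → EuclideanSpace ℝ (Fin n) → EuclideanSpace ℝ (Fin n)) (b : Fin d → ℝ → ℝ)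
    (Φ : ℝ → EuclideanSpace ℝ (Fin n) → EuclideanSpace ℝ (Fin n)) : Prop where
  holder : ∀ x, IsHolderPath (1 - α) T (fun t => Φ t x)
  solves : ∀ x, ∀ t ∈ Icc 0 T, ∀ i,
    Φ t x i = x i + ∑ k, genStieltjes α 0 t (fun s => U k (Φ s x) i) (b k)

/-- The push-forward at time `r` of the vector `v`, tangent at `x`, under the flow `Φ`. -/
def pushForward {n : ℕ} (Φ : ℝ → EuclideanSpace ℝ (Fin n) → EuclideanSpace ℝ (Fin n))
    (x v : EuclideanSpace ℝ (Fin n)) (r : ℝ) : EuclideanSpace ℝ (Fin n) :=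
  fderiv ℝ (Φ r) x v

/-- The `l₁` norm of a vector (the norm of `EuclideanSpace` is the `l₂` norm). -/
def l1Norm {n : ℕ} (v : EuclideanSpace ℝ (Fin n)) : ℝ := ∑ i, |v i|

end

/-! Apart from the moment estimate the argument is pathwise. For an integrand Hölder of order `lam >
α` and a driver Hölder of order `β > 1 - α`, the generalized Stieltjes integral is a Young integral:
its increment over [s, t] differs from f(s)(g(t) - g(s)) by a multiple of (t - s)^(lam + β), where
lam + β > 1 and the constant is linear in the product of the Hölder constants
(`isYoung_genStieltjes`). For C¹ functions the definition collapses to ∫ f g' by Fubini and B(1-α,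
α) = Γ(1-α)Γ(α) (`genStieltjes_of_hasDerivAt`), and Young's inequality gives a remainder that sees
only Hölder constants. Steklov averages preserve those constants, so the estimate survives the
passage to Hölder functions.

The flow thus solves a Young equation, and one a priori estimate carries the analysis
(`IsYoung.holderBound_of_linearGrowth`, `IsYoung.growth_of_linearGrowth`). Suppose the integrands
are controlled linearly by X up to an inhomogeneity δ, and the drivers have Hölder constant G. On an
interval of length Δ with GΔ^β ≤ κ small, X has Hölder constant at most (‖X a‖ + δ)Δ^(-lam), and ‖X‖
+ δ at most doubles; hence it grows at most by 2^(1 + t/Δ) up to time t. This is applied three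
times. A solution minus its value at the left endpoint gets a local Hölder bound that does not
depend on the solution. A difference of two solutions gives Lipschitz dependence on the starting
point. A second difference, with δ = ρ^(1+η), shows that h ↦ Φ_t(x+h) - Φ_t(x) is additive up to a
superlinear error, which forces differentiability (`exists_hasFDerivAt_zero_of_almost_additive`). No
equation for the derivative is needed: ‖DΦ‖ is at most the Lipschitz constant of Φ. The choice Δ =
(κ/G)^(1/β), with G the sum of the Hölder norms of the drivers, yields C_T = κ^(-1/β) G^(1/β).

For the moments, the Hölder seminorm is an increasing limit of sup norms of centered Gaussian
vectors. Fernique's theorem, whose constants do not depend on the dimension, bounds its second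
moment by the square of its first. Since 1/β < 2, Jensen's inequality reduces (E C_T)^β to second
moments. Means and covariances determine the Gaussian laws, so the first moment is the same for all
drivers. -/

/-- `f` is `lam`-Hölder on `[a, b]` with constant `A`. -/
def HolderBound {E : Type*} [NormedAddCommGroup E] (a b lam A : ℝ) (f : ℝ → E) : Prop :=
  ∀ s t, a ≤ s → s ≤ t → t ≤ b → ‖f t - f s‖ ≤ A * (t - s) ^ lam

/-! ### Hölder bounds on intervals -/

section HolderBound

variable {E : Type*} [NormedAddCommGroup E]

theorem HolderBound.mono {a b a' b' lam A : ℝ} {f : ℝ → E} (h : HolderBound a b lam A f)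
    (ha : a ≤ a') (hb : b' ≤ b) : HolderBound a' b' lam A f :=
  fun s t h1 h2 h3 => h s t (ha.trans h1) h2 (h3.trans hb)

theorem HolderBound.mono_const {a b lam A A' : ℝ} {f : ℝ → E} (h : HolderBound a b lam A f)
    (hA : A ≤ A') : HolderBound a b lam A' f := fun s t h1 h2 h3 =>
  (h s t h1 h2 h3).trans (mul_le_mul_of_nonneg_right hA (Real.rpow_nonneg (by linarith) _))

/-- A Hölder function is Hölder for every smaller exponent. -/
theorem HolderBound.of_exponent_le {a b lam lam' A : ℝ} {f : ℝ → E} (hA : 0 ≤ A)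
    (h : HolderBound a b lam A f) (h' : lam' ≤ lam) (hlam' : 0 < lam') :
    HolderBound a b lam' (A * (b - a) ^ (lam - lam')) f := by
  intro s t h1 h2 h3
  refine (h s t h1 h2 h3).trans ?_
  rw [mul_assoc]
  refine mul_le_mul_of_nonneg_left ?_ hA
  rcases eq_or_lt_of_le h2 with rfl | hst
  · simp only [sub_self]
    rw [Real.zero_rpow (by linarith), Real.zero_rpow hlam'.ne', mul_zero]
  · calc (t - s) ^ lam = (t - s) ^ (lam - lam') * (t - s) ^ lam' := by
          rw [← Real.rpow_add (by linarith)]; congr 1; ring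
      _ ≤ (b - a) ^ (lam - lam') * (t - s) ^ lam' := by
          refine mul_le_mul_of_nonneg_right ?_ (Real.rpow_nonneg (by linarith) _)
          exact Real.rpow_le_rpow (by linarith) (by linarith) (by linarith)

theorem HolderBound.dist_le_of_mem {a b lam A : ℝ} {f : ℝ → E} (h : HolderBound a b lam A f)
    {s t : ℝ} (hs : s ∈ Icc a b) (ht : t ∈ Icc a b) : ‖f t - f s‖ ≤ A * |t - s| ^ lam := by
  rcases le_total s t with hst | hst
  · rw [abs_of_nonneg (by linarith)]
    exact h s t hs.1 hst ht.2
  · rw [norm_sub_rev, abs_sub_comm, abs_of_nonneg (by linarith)]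
    exact h t s ht.1 hst hs.2

theorem HolderBound.sub_const {a b lam A : ℝ} {X : ℝ → E} (h : HolderBound a b lam A X) (c : E) :
    HolderBound a b lam A (fun t => X t - c) := by
  intro s t h1 h2 h3
  simpa using h s t h1 h2 h3

theorem HolderBound.sub {a b lam A B : ℝ} {X Y : ℝ → E} (h : HolderBound a b lam A X)
    (h' : HolderBound a b lam B Y) : HolderBound a b lam (A + B) (fun t => X t - Y t) := by
  intro s t h1 h2 h3
  rw [add_mul, sub_sub_sub_comm]
  exact (norm_sub_le _ _).trans (add_le_add (h s t h1 h2 h3) (h' s t h1 h2 h3))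

theorem HolderBound.add {a b lam A B : ℝ} {X Y : ℝ → E} (h : HolderBound a b lam A X)
    (h' : HolderBound a b lam B Y) : HolderBound a b lam (A + B) (fun t => X t + Y t) := by
  intro s t h1 h2 h3
  rw [add_mul, add_sub_add_comm]
  exact (norm_add_le _ _).trans (add_le_add (h s t h1 h2 h3) (h' s t h1 h2 h3))

end HolderBound

/-! ### Young integrals and Young's inequality -/

/-- Two-parameter functions that are additive up to a midpoint defect of order `ν > 1` and are of
order `μ > 1` satisfy the bound given by the defect. -/
theorem norm_le_of_midpoint_defect {E : Type*} [NormedAddCommGroup E] {a b : ℝ}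
    {R : ℝ → ℝ → E} {C D μ ν : ℝ} (hμ : 1 < μ) (hν : 1 < ν) (hD : 0 ≤ D)
    (hR : ∀ s t, a ≤ s → s ≤ t → t ≤ b → ‖R s t‖ ≤ C * (t - s) ^ μ)
    (hdef : ∀ s t, a ≤ s → s ≤ t → t ≤ b →
      ‖R s t - R s ((s + t) / 2) - R ((s + t) / 2) t‖ ≤ D * (t - s) ^ ν) :
    ∀ s t, a ≤ s → s ≤ t → t ≤ b → ‖R s t‖ ≤ D / (1 - 2 ^ (1 - ν)) * (t - s) ^ ν := by
  have hr1 : (2 : ℝ) ^ (1 - ν) < 1 := Real.rpow_lt_one_of_one_lt_of_neg (by norm_num) (by linarith)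
  have hq1 : (2 : ℝ) ^ (1 - μ) < 1 := Real.rpow_lt_one_of_one_lt_of_neg (by norm_num) (by linarith)
  have hq0 : (0 : ℝ) < 2 ^ (1 - μ) := by positivity
  have key : ∀ (p h : ℝ), 0 ≤ h → 2 * (h / 2) ^ p = 2 ^ (1 - p) * h ^ p := by
    intro p h hh
    rw [Real.div_rpow hh (by norm_num), Real.rpow_sub (by norm_num), Real.rpow_one]
    field_simp
  -- After n bisections the a priori bound of order μ contributes only a factor 2^((1-μ)n), which
  -- tends to 0 because μ > 1. The constant C therefore drops out of the conclusion.
  have main : ∀ n : ℕ, ∀ s t, a ≤ s → s ≤ t → t ≤ b →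
      ‖R s t‖ ≤ D / (1 - 2 ^ (1 - ν)) * (t - s) ^ ν
        + C * (t - s) ^ μ * ((2 : ℝ) ^ (1 - μ)) ^ n := by
    intro n
    induction n with
    | zero =>
      intro s t h1 h2 h3
      have := hR s t h1 h2 h3
      have h4 : 0 ≤ D / (1 - 2 ^ (1 - ν)) * (t - s) ^ ν :=
        mul_nonneg (div_nonneg hD (by linarith)) (Real.rpow_nonneg (by linarith) _)
      simp only [pow_zero, mul_one]
      linarith
    | succ n ih =>
      intro s t h1 h2 h3
      have e1 := ih s ((s + t) / 2) h1 (by linarith) (by linarith)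
      have e2 := ih ((s + t) / 2) t (by linarith) (by linarith) h3
      have e3 := hdef s t h1 h2 h3
      have hm1 : (s + t) / 2 - s = (t - s) / 2 := by ring
      have hm2 : t - (s + t) / 2 = (t - s) / 2 := by ring
      rw [hm1] at e1
      rw [hm2] at e2
      have tri : ‖R s t‖ ≤ ‖R s t - R s ((s + t) / 2) - R ((s + t) / 2) t‖
          + ‖R s ((s + t) / 2)‖ + ‖R ((s + t) / 2) t‖ := by
        calc ‖R s t‖ = ‖(R s t - R s ((s + t) / 2) - R ((s + t) / 2) t)
              + R s ((s + t) / 2) + R ((s + t) / 2) t‖ := by congr 1; abel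
          _ ≤ _ := norm_add₃_le
      have k1 := key ν (t - s) (by linarith)
      have k2 := key μ (t - s) (by linarith)
      have hne : (1 : ℝ) - 2 ^ (1 - ν) ≠ 0 := by linarith
      -- D / (1 - r) with r = 2^(1-ν) is the fixed point of k ↦ D + r k: one defect plus the
      -- contributions of the two halves.
      have hK : D = D / (1 - 2 ^ (1 - ν)) - D / (1 - 2 ^ (1 - ν)) * 2 ^ (1 - ν) := by
        field_simp
      have expand : 2 * (D / (1 - 2 ^ (1 - ν)) * ((t - s) / 2) ^ ν
          + C * ((t - s) / 2) ^ μ * ((2 : ℝ) ^ (1 - μ)) ^ n)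
          = D / (1 - 2 ^ (1 - ν)) * 2 ^ (1 - ν) * (t - s) ^ ν
            + C * (t - s) ^ μ * ((2 : ℝ) ^ (1 - μ)) ^ (n + 1) := by
        rw [pow_succ]
        linear_combination (D / (1 - 2 ^ (1 - ν))) * k1 + C * ((2 : ℝ) ^ (1 - μ)) ^ n * k2
      have hD' : D * (t - s) ^ ν = D / (1 - 2 ^ (1 - ν)) * (t - s) ^ ν
          - D / (1 - 2 ^ (1 - ν)) * 2 ^ (1 - ν) * (t - s) ^ ν := by
        linear_combination (t - s) ^ ν * hK
      linarith
  intro s t h1 h2 h3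
  have lim : Filter.Tendsto (fun n : ℕ => D / (1 - 2 ^ (1 - ν)) * (t - s) ^ ν
        + C * (t - s) ^ μ * ((2 : ℝ) ^ (1 - μ)) ^ n) Filter.atTop
      (nhds (D / (1 - 2 ^ (1 - ν)) * (t - s) ^ ν + C * (t - s) ^ μ * 0)) :=
    ((tendsto_pow_atTop_nhds_zero_of_lt_one hq0.le hq1).const_mul _).const_add _
  rw [mul_zero, add_zero] at lim
  exact ge_of_tendsto' lim fun n => main n s t h1 h2 h3

/-- `Z` is a Young integral of `f` against `g` on `[a, b]`: its increments are given by left point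
Riemann sums up to an error of order `μ`. -/
def IsYoung {E ι : Type*} [NormedAddCommGroup E] [NormedSpace ℝ E] [Fintype ι]
    (a b C μ : ℝ) (Z : ℝ → E) (f : ι → ℝ → E) (g : ι → ℝ → ℝ) : Prop :=
  ∀ s t, a ≤ s → s ≤ t → t ≤ b →
    ‖Z t - Z s - ∑ k, (g k t - g k s) • f k s‖ ≤ C * (t - s) ^ μ

/-- The constant in Young's inequality. -/
noncomputable def youngConst (ν : ℝ) : ℝ := 1 / (1 - 2 ^ (1 - ν))

theorem youngConst_nonneg {ν : ℝ} (hν : 1 < ν) : 0 ≤ youngConst ν := by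
  have hr1 : (2 : ℝ) ^ (1 - ν) < 1 := Real.rpow_lt_one_of_one_lt_of_neg (by norm_num) (by linarith)
  exact div_nonneg zero_le_one (by linarith)

section Young

variable {E ι : Type*} [NormedAddCommGroup E] [NormedSpace ℝ E] [Fintype ι]

/-- Young's inequality. -/
theorem IsYoung.young_inequality {a b C μ : ℝ} {Z : ℝ → E} {f : ι → ℝ → E} {g : ι → ℝ → ℝ}
    (hμ : 1 < μ) (h : IsYoung a b C μ Z f g) {lam β A G : ℝ} (hν : 1 < lam + β)
    (hA : 0 ≤ A) (hG : 0 ≤ G)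
    (hlam : 0 < lam) (hβ : 0 < β)
    (hf : ∀ k, HolderBound a b lam A (f k)) (hg : ∀ k, HolderBound a b β G (g k)) :
    IsYoung a b (youngConst (lam + β) * (Fintype.card ι * (A * G))) (lam + β) Z f g := by
  intro s t h1 h2 h3
  have := norm_le_of_midpoint_defect (a := a) (b := b)
    (R := fun s t => Z t - Z s - ∑ k, (g k t - g k s) • f k s) (D := Fintype.card ι * (A * G))
    hμ hν (by positivity) h ?_ s t h1 h2 h3
  · refine this.trans (le_of_eq ?_)
    rw [youngConst]; ring
  · clear s t h1 h2 h3
    intro s t h1 h2 h3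
    -- Inserting the midpoint changes the left point sum by a product of an increment of g and an
    -- increment of f, which is where the order lam + β comes from.
    have e : (Z t - Z s - ∑ k, (g k t - g k s) • f k s)
        - (Z ((s + t) / 2) - Z s - ∑ k, (g k ((s + t) / 2) - g k s) • f k s)
        - (Z t - Z ((s + t) / 2) - ∑ k, (g k t - g k ((s + t) / 2)) • f k ((s + t) / 2))
        = ∑ k, (g k t - g k ((s + t) / 2)) • (f k ((s + t) / 2) - f k s) := by
      have : ∀ k, (g k t - g k ((s + t) / 2)) • (f k ((s + t) / 2) - f k s)
          = (g k t - g k ((s + t) / 2)) • f k ((s + t) / 2) + (g k ((s + t) / 2) - g k s) • f k s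
            - (g k t - g k s) • f k s := by
        intro k; module
      simp only [this, Finset.sum_add_distrib, Finset.sum_sub_distrib]
      abel
    rw [e]
    calc ‖∑ k, (g k t - g k ((s + t) / 2)) • (f k ((s + t) / 2) - f k s)‖
        ≤ ∑ k : ι, (A * G) * (t - s) ^ (lam + β) := by
          refine norm_sum_le_of_le _ fun k _ => ?_
          rw [norm_smul]
          have b1 := hg k ((s + t) / 2) t (by linarith) (by linarith) h3
          have b2 := hf k s ((s + t) / 2) h1 (by linarith) (by linarith)
          have c1 : (t - (s + t) / 2) ^ β ≤ (t - s) ^ β :=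
            Real.rpow_le_rpow (by linarith) (by linarith) hβ.le
          have c2 : ((s + t) / 2 - s) ^ lam ≤ (t - s) ^ lam :=
            Real.rpow_le_rpow (by linarith) (by linarith) hlam.le
          have hst : 0 ≤ t - s := by linarith
          have : (t - s) ^ (lam + β) = (t - s) ^ lam * (t - s) ^ β := by
            rcases eq_or_lt_of_le hst with h0 | h0
            · rw [← h0, Real.zero_rpow (by linarith), Real.zero_rpow (by linarith), zero_mul]
            · exact Real.rpow_add h0 _ _
          rw [this]
          calc _ ≤ (G * (t - s) ^ β) * (A * (t - s) ^ lam) := by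
                refine mul_le_mul (b1.trans (by gcongr)) (b2.trans (by gcongr)) (norm_nonneg _)
                  (by positivity)
            _ = _ := by ring
      _ = _ := by simp [Finset.sum_const]; ring

end Young

/-! ### Weyl derivatives and the generalized Stieltjes integral of C¹ functions -/

theorem intervalIntegrable_sub_rpow {p : ℝ} (hp : -1 < p) (c a b : ℝ) :
    IntervalIntegrable (fun y => (c - y) ^ p) volume a b := by
  have h := (intervalIntegral.intervalIntegrable_rpow' (a := c - a) (b := c - b) hp).comp_sub_left c
  simpa using h

theorem integral_sub_rpow {p : ℝ} (hp : -1 < p) (x : ℝ) :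
    ∫ y in (0 : ℝ)..x, (x - y) ^ p = x ^ (p + 1) / (p + 1) := by
  rw [intervalIntegral.integral_comp_sub_left (fun y => y ^ p) x, sub_self, sub_zero,
    integral_rpow (Or.inl hp), Real.zero_rpow (by linarith), sub_zero]

section Marchaud

variable {α lam A x : ℝ} {f : ℝ → ℝ}

/-- Hölder continuity of order lam weakens the singularity of the Marchaud kernel from 1 + α to 1 +
α - lam, which is integrable as soon as α < lam. -/
theorem norm_marchaud_integrand_le
    (hf : ∀ y ∈ Icc 0 x, |f x - f y| ≤ A * (x - y) ^ lam) {y : ℝ}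
    (hy : y ∈ Ioo 0 x) :
    ‖(f x - f y) / (x - y) ^ (1 + α)‖ ≤ A * (x - y) ^ (lam - 1 - α) := by
  have h0 : 0 < x - y := sub_pos.2 hy.2
  rw [norm_div, Real.norm_eq_abs, Real.norm_of_nonneg (Real.rpow_nonneg h0.le _),
    div_le_iff₀ (Real.rpow_pos_of_pos h0 _), mul_assoc, ← Real.rpow_add h0]
  have : lam - 1 - α + (1 + α) = lam := by ring
  rw [this]
  exact hf y ⟨hy.1.le, hy.2.le⟩

theorem intervalIntegrable_marchaud (hfm : Measurable f) (hα : α < lam) (hx : 0 ≤ x)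
    (hf : ∀ y ∈ Icc 0 x, |f x - f y| ≤ A * (x - y) ^ lam) :
    IntervalIntegrable (fun y => (f x - f y) / (x - y) ^ (1 + α)) volume 0 x := by
  have hi := (intervalIntegrable_sub_rpow (p := lam - 1 - α) (by linarith) x 0 x).const_mul A
  rw [intervalIntegrable_iff_integrableOn_Ioo_of_le hx] at hi ⊢
  have hm : Measurable fun y => (f x - f y) / (x - y) ^ (1 + α) :=
      (measurable_const.sub hfm).div ((measurable_const.sub measurable_id).pow_const _)
  refine Integrable.mono' hi hm.aestronglyMeasurable ?_
  exact (ae_restrict_mem measurableSet_Ioo).mono fun y hy => norm_marchaud_integrand_le hf hy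

theorem abs_integral_marchaud_le (hα : α < lam) (hx : 0 ≤ x)
    (hf : ∀ y ∈ Icc 0 x, |f x - f y| ≤ A * (x - y) ^ lam) :
    |∫ y in (0 : ℝ)..x, (f x - f y) / (x - y) ^ (1 + α)| ≤ A * (x ^ (lam - α) / (lam - α)) := by
  have h := intervalIntegral.norm_integral_le_of_norm_le (a := 0) (b := x) (μ := volume) hx
    (f := fun y => (f x - f y) / (x - y) ^ (1 + α))
    (g := fun y => A * (x - y) ^ (lam - 1 - α)) ?_
    ((intervalIntegrable_sub_rpow (p := lam - 1 - α) (by linarith) x 0 x).const_mul A)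
  · rw [intervalIntegral.integral_const_mul, integral_sub_rpow (by linarith)] at h
    have : lam - 1 - α + 1 = lam - α := by ring
    rw [this] at h
    exact h
  · have : ∀ᵐ y ∂(volume : Measure ℝ), y ≠ x := by simp [ae_iff, measure_singleton]
    filter_upwards [this] with y hy hy'
    exact norm_marchaud_integrand_le hf ⟨hy'.1, lt_of_le_of_ne hy'.2 hy⟩

end Marchaud

/-- Reflection y ↦ b - y exchanges the two derivatives, so estimates and limits are only needed for
the left one. -/
theorem weylRight_eq_weylLeft (α b : ℝ) (f : ℝ → ℝ) (x : ℝ) :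
    weylRight α b f x = weylLeft α 0 (fun y => f (b - y)) (b - x) := by
  have h := intervalIntegral.integral_comp_sub_left (a := 0) (b := b - x)
    (fun y => (f x - f y) / (y - x) ^ (1 + α)) b
  simp only [sub_sub_cancel, sub_zero] at h
  have e : ∀ y, b - y - x = b - x - y := fun y => by ring
  simp only [e] at h
  simp only [weylLeft, weylRight, sub_zero, sub_sub_cancel, h]

/-- A continuously differentiable function is Lipschitz on compact intervals. -/
theorem exists_lipschitz_of_continuous_deriv {f f' : ℝ → ℝ} (hf : ∀ x, HasDerivAt f (f' x) x)
    (hf' : Continuous f') (a b : ℝ) :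
    ∃ L, 0 ≤ L ∧ (∀ x ∈ Icc a b, |f' x| ≤ L) ∧
      ∀ x ∈ Icc a b, ∀ y ∈ Icc a b, |f x - f y| ≤ L * |x - y| := by
  obtain ⟨L, hL⟩ := (isCompact_Icc (a := a) (b := b)).exists_bound_of_continuousOn hf'.continuousOn
  refine ⟨max L 0, le_max_right _ _, fun x hx => (hL x hx).trans (le_max_left _ _),
    fun x hx y hy => ?_⟩
  exact (convex_Icc a b).norm_image_sub_le_of_norm_hasDerivWithin_le
    (fun z _ => (hf z).hasDerivWithinAt) (fun z hz => (hL z hz).trans (le_max_left _ _)) hy hx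

/-- Integration by parts in the Marchaud integral, with antiderivative (f x - f y)(x - y)^(-α). Its
limit at y = x is 0 because f is Lipschitz and α < 1; its value at y = 0 replaces the boundary term
f x by f 0. -/
theorem weylLeft_of_hasDerivAt {α : ℝ} (h1 : α < 1) {f f' : ℝ → ℝ}
    (hf : ∀ x, HasDerivAt f (f' x) x) (hf' : Continuous f') {x : ℝ} (hx : 0 < x) :
    weylLeft α 0 f x = (Real.Gamma (1 - α))⁻¹ *
      (f 0 * x ^ (-α) + ∫ y in (0 : ℝ)..x, f' y * (x - y) ^ (-α)) := by
  have hfc : Continuous f := continuous_iff_continuousAt.2 fun z => (hf z).continuousAt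
  obtain ⟨L, hL0, -, hL⟩ := exists_lipschitz_of_continuous_deriv hf hf' 0 x
  have hlip : ∀ y ∈ Icc 0 x, |f x - f y| ≤ L * (x - y) ^ (1 : ℝ) := by
    intro y hy
    have := hL x ⟨hx.le, le_rfl⟩ y hy
    rwa [abs_of_nonneg (sub_nonneg.2 hy.2), ← Real.rpow_one (x - y)] at this
  have i1 := intervalIntegrable_marchaud (α := α) hfc.measurable h1 hx.le hlip
  have i2 : IntervalIntegrable (fun y => f' y * (x - y) ^ (-α)) volume 0 x :=
    (intervalIntegrable_sub_rpow (by linarith) x 0 x).continuousOn_mul hf'.continuousOn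
  have ftc := intervalIntegral.integral_eq_sub_of_hasDerivAt_of_tendsto (a := 0) (b := x)
    (f := fun y => (f x - f y) * (x - y) ^ (-α))
    (f' := fun y => α * ((f x - f y) / (x - y) ^ (1 + α)) - f' y * (x - y) ^ (-α))
    (fa := (f x - f 0) * x ^ (-α)) (fb := 0) hx ?_ ((i1.const_mul α).sub i2) ?_ ?_
  · rw [intervalIntegral.integral_sub (i1.const_mul α) i2,
      intervalIntegral.integral_const_mul] at ftc
    rw [weylLeft, sub_zero, div_eq_mul_inv, ← Real.rpow_neg hx.le]
    congr 1
    linarith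
  · intro y hy
    have hxy : 0 < x - y := sub_pos.2 hy.2
    have d1 : HasDerivAt (fun y => f x - f y) (-f' y) y := (hf y).const_sub _
    have d2 : HasDerivAt (fun y => (x - y) ^ (-α)) (-1 * (-α) * (x - y) ^ (-α - 1)) y :=
      ((hasDerivAt_id y).const_sub x).rpow_const (Or.inl hxy.ne')
    refine (d1.mul d2).congr_deriv ?_
    have : (x - y) ^ (-α - 1) = ((x - y) ^ (1 + α))⁻¹ := by
      rw [← Real.rpow_neg hxy.le]; congr 1; ring
    rw [this]
    ring
  · have : ContinuousAt (fun y => (f x - f y) * (x - y) ^ (-α)) 0 :=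
      ((continuous_const.sub hfc).continuousAt).mul
        ((continuous_const.sub continuous_id).continuousAt.rpow_const (Or.inl (by simpa using hx.ne')))
    have h2 := this.tendsto.mono_left (nhdsWithin_le_nhds (s := Ioi 0))
    simpa using h2
  · have hb : Filter.Tendsto (fun y => L * (x - y) ^ (1 - α)) (nhdsWithin x (Iio x)) (nhds 0) := by
      have : ContinuousAt (fun y => L * (x - y) ^ (1 - α)) x :=
        continuousAt_const.mul ((continuous_const.sub continuous_id).continuousAt.rpow_const
          (Or.inr (by linarith)))
      have h2 := this.tendsto.mono_left (nhdsWithin_le_nhds (s := Iio x))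
      simpa [Real.zero_rpow (by linarith : 1 - α ≠ 0)] using h2
    refine squeeze_zero_norm' ?_ hb
    filter_upwards [Ioo_mem_nhdsLT hx] with y hy
    have hxy : 0 < x - y := sub_pos.2 hy.2
    rw [norm_mul, Real.norm_eq_abs, Real.norm_of_nonneg (Real.rpow_nonneg hxy.le _)]
    calc _ ≤ L * (x - y) ^ (1 : ℝ) * (x - y) ^ (-α) :=
          mul_le_mul_of_nonneg_right (hlip y ⟨hy.1.le, hy.2.le⟩) (Real.rpow_nonneg hxy.le _)
      _ = _ := by rw [mul_assoc, ← Real.rpow_add hxy]; rfl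

/-- The Beta integral B(1-α, α). The exponents add up to one, so the power of z disappears and Γ(1)
= 1 is the only denominator. -/
theorem integral_rpow_mul_sub_rpow {α z : ℝ} (h0 : 0 < α) (h1 : α < 1) (hz : 0 < z) :
    ∫ x in (0 : ℝ)..z, x ^ (-α) * (z - x) ^ (α - 1) = Real.Gamma (1 - α) * Real.Gamma α := by
  have hb := Complex.betaIntegral_scaled ((1 - α : ℝ) : ℂ) (α : ℂ) hz
  have hg := Complex.Gamma_mul_Gamma_eq_betaIntegral (s := ((1 - α : ℝ) : ℂ)) (t := (α : ℂ))
    (by simpa using h1) (by simpa using h0)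
  have e1 : (((1 - α : ℝ) : ℂ) + (α : ℂ)) = 1 := by push_cast; ring
  rw [e1] at hb hg
  rw [sub_self, Complex.cpow_zero, one_mul] at hb
  rw [Complex.Gamma_one, one_mul] at hg
  rw [← hg] at hb
  have e2 : ∫ x in (0 : ℝ)..z, (x : ℂ) ^ (((1 - α : ℝ) : ℂ) - 1) * ((z : ℂ) - x) ^ ((α : ℂ) - 1)
      = ((∫ x in (0 : ℝ)..z, x ^ (-α) * (z - x) ^ (α - 1) : ℝ) : ℂ) := by
    rw [← intervalIntegral.integral_ofReal]
    refine intervalIntegral.integral_congr fun x hx => ?_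
    rw [uIcc_of_le hz.le] at hx
    have hp : ((1 - α : ℝ) : ℂ) - 1 = ((-α : ℝ) : ℂ) := by push_cast; ring
    have hq : (α : ℂ) - 1 = ((α - 1 : ℝ) : ℂ) := by push_cast; ring
    rw [hp, hq, ← Complex.ofReal_sub, ← Complex.ofReal_cpow hx.1,
      ← Complex.ofReal_cpow (sub_nonneg.2 hx.2), ← Complex.ofReal_mul]
  rw [e2, Complex.Gamma_ofReal, Complex.Gamma_ofReal, ← Complex.ofReal_mul] at hb
  exact_mod_cast hb

/-- The power function `u ^ p` cut off to the interval `(0, t]`. -/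
noncomputable def cutPow (t p : ℝ) : ℝ → ℝ := (Ioc 0 t).indicator fun u => u ^ p

theorem integrable_cutPow {t p : ℝ} (ht : 0 ≤ t) (hp : -1 < p) : Integrable (cutPow t p) := by
  rw [cutPow, integrable_indicator_iff measurableSet_Ioc,
    ← intervalIntegrable_iff_integrableOn_Ioc_of_le ht]
  exact intervalIntegral.intervalIntegrable_rpow' hp

/-- The kernels of orders 1 - α and α convolve to a multiple of the Heaviside kernel. The cutoff
makes them integrable on the line, and z - y ≤ t ensures that the convolution does not see it. -/
theorem integral_cutPow_mul_cutPow {α t y z : ℝ} (h0 : 0 < α) (h1 : α < 1) (hz : z - y ≤ t) :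
    ∫ x, cutPow t (-α) (x - y) * cutPow t (α - 1) (z - x)
      = if y < z then Real.Gamma (1 - α) * Real.Gamma α else 0 := by
  have e : ∀ x, cutPow t (-α) (x - y) * cutPow t (α - 1) (z - x)
      = (Ioo 0 (z - y)).indicator (fun u => u ^ (-α) * ((z - y) - u) ^ (α - 1)) (x - y) := by
    intro x
    simp only [cutPow, indicator_apply, mem_Ioc, mem_Ioo]
    by_cases hc : 0 < x - y ∧ x - y < z - y
    · rw [if_pos ⟨hc.1, by linarith⟩, if_pos ⟨by linarith, by linarith⟩, if_pos hc]
      congr 2; ring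
    · rw [if_neg hc]
      by_cases h3 : 0 < x - y
      · rw [if_neg (c := 0 < z - x ∧ _) (fun h4 => hc ⟨h3, by linarith [h4.1]⟩), mul_zero]
      · rw [if_neg (fun h4 => h3 h4.1), zero_mul]
  simp only [e]
  rw [integral_sub_right_eq_self (fun x => (Ioo 0 (z - y)).indicator
    (fun u => u ^ (-α) * ((z - y) - u) ^ (α - 1)) x) y, integral_indicator measurableSet_Ioo]
  split_ifs with hyz
  · rw [← integral_rpow_mul_sub_rpow h0 h1 (sub_pos.2 hyz),
      intervalIntegral.integral_of_le (sub_pos.2 hyz).le, integral_Ioc_eq_integral_Ioo]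
  · rw [Ioo_eq_empty (by linarith), Measure.restrict_empty, integral_zero_measure]

/-- Fractional integrals of orders 1 - α and α compose to the ordinary integral: Fubini brings the
two kernels together. The product of the kernels is jointly integrable as a convolution integrand,
and the bounded φ does no harm. -/
theorem integral_fractional_kernel_swap {α t z : ℝ} {φ : ℝ → ℝ} (h0 : 0 < α) (h1 : α < 1)
    (hz : z ≤ t) (ht : 0 ≤ t) (hφ : Measurable φ) {c : ℝ} (hφb : ∀ y, |φ y| ≤ c)
    (hφ0 : ∀ y, y ≤ 0 → φ y = 0) :
    ∫ x, (∫ y, φ y * cutPow t (-α) (x - y)) * cutPow t (α - 1) (z - x)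
      = Real.Gamma (1 - α) * Real.Gamma α * ∫ y in Iio z, φ y := by
  have i1 := integrable_cutPow (t := t) (p := -α) ht (by linarith)
  have i2 := integrable_cutPow (t := t) (p := α - 1) ht (by linarith)
  have hF := Integrable.convolution_integrand (ContinuousLinearMap.mul ℝ ℝ)
    (i2.comp_sub_left z) i1.comp_neg
  simp only [ContinuousLinearMap.mul_apply', neg_sub] at hF
  have hG : Integrable (fun p : ℝ × ℝ => φ p.1 *
      (cutPow t (α - 1) (z - p.2) * cutPow t (-α) (p.2 - p.1))) (volume.prod volume) :=
    hF.bdd_mul (hφ.comp measurable_fst).aestronglyMeasurable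
      (Filter.Eventually.of_forall fun p => hφb p.1)
  calc ∫ x, (∫ y, φ y * cutPow t (-α) (x - y)) * cutPow t (α - 1) (z - x)
      = ∫ x, ∫ y, φ y * (cutPow t (α - 1) (z - x) * cutPow t (-α) (x - y)) := by
        refine integral_congr_ae (Filter.Eventually.of_forall fun x => ?_)
        simp only
        rw [← integral_mul_const]
        refine integral_congr_ae (Filter.Eventually.of_forall fun y => ?_)
        simp only; ring
    _ = ∫ y, ∫ x, φ y * (cutPow t (α - 1) (z - x) * cutPow t (-α) (x - y)) :=
        (integral_integral_swap hG).symm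
    _ = ∫ y, (Real.Gamma (1 - α) * Real.Gamma α) * (Iio z).indicator φ y := by
        refine integral_congr_ae (Filter.Eventually.of_forall fun y => ?_)
        simp only
        rw [integral_const_mul]
        -- Only y > 0 matters, and then z - y ≤ t, as the convolution of the cut-off kernels
        -- requires.
        rcases le_or_gt y 0 with hy | hy
        · simp [hφ0 y hy, indicator_apply]
        · have := integral_cutPow_mul_cutPow (t := t) (y := y) (z := z) h0 h1 (by linarith)
          simp only [mul_comm (cutPow t (α - 1) _)]
          rw [this]
          by_cases hyz : y < z
          · simp [hyz]; ring
          · simp [hyz]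
    _ = _ := by rw [integral_const_mul, integral_indicator measurableSet_Iio]

/-- For continuously differentiable functions, the generalized Stieltjes integral is an ordinary
integral. -/
theorem genStieltjes_of_hasDerivAt {α : ℝ} (h0 : 0 < α) (h1 : α < 1) {f f' g g' : ℝ → ℝ}
    (hf : ∀ x, HasDerivAt f (f' x) x) (hf' : Continuous f')
    (hg : ∀ x, HasDerivAt g (g' x) x) (hg' : Continuous g') {t : ℝ} (ht : 0 ≤ t) :
    genStieltjes α 0 t f g = ∫ z in (0 : ℝ)..t, f z * g' z := by
  rcases eq_or_lt_of_le ht with rfl | ht0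
  · simp [genStieltjes]
  have hleft : Function.leftLim g t = g t := (hg t).continuousAt.continuousWithinAt.leftLim_eq
  set φ : ℝ → ℝ := (Ioc 0 t).indicator f' with hφ
  set ψ : ℝ → ℝ := (Ioc 0 t).indicator g' with hψ
  obtain ⟨c₁, hc₁⟩ := (isCompact_Icc (a := (0 : ℝ)) (b := t)).exists_bound_of_continuousOn
    hf'.continuousOn
  obtain ⟨c₂, hc₂⟩ := (isCompact_Icc (a := (0 : ℝ)) (b := t)).exists_bound_of_continuousOn
    hg'.continuousOn
  have hφm : Measurable φ := hf'.measurable.indicator measurableSet_Ioc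
  have hψm : Measurable ψ := hg'.measurable.indicator measurableSet_Ioc
  have hφb : ∀ y, |φ y| ≤ max c₁ 0 := by
    intro y
    by_cases hy : y ∈ Ioc 0 t
    · rw [hφ, indicator_of_mem hy]
      exact (hc₁ y ⟨hy.1.le, hy.2⟩).trans (le_max_left _ _)
    · rw [hφ, indicator_of_notMem hy, abs_zero]; exact le_max_right _ _
  have hψb : ∀ y, |ψ y| ≤ max c₂ 0 := by
    intro y
    by_cases hy : y ∈ Ioc 0 t
    · rw [hψ, indicator_of_mem hy]
      exact (hc₂ y ⟨hy.1.le, hy.2⟩).trans (le_max_left _ _)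
    · rw [hψ, indicator_of_notMem hy, abs_zero]; exact le_max_right _ _
  have hφi : Integrable φ := by
    rw [hφ, integrable_indicator_iff measurableSet_Ioc]
    exact hf'.integrableOn_Ioc
  have i1 := integrable_cutPow (t := t) (p := -α) ht (by linarith)
  have i2 := integrable_cutPow (t := t) (p := α - 1) ht (by linarith)
  -- On (0, t) this is Γ(1-α) times the left derivative of f. Written with cut-off kernels on the
  -- whole line, it is accessible to Fubini on ℝ × ℝ.
  set a : ℝ → ℝ := fun x => f 0 * cutPow t (-α) x + ∫ y, φ y * cutPow t (-α) (x - y) with ha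
  have hconv : Integrable fun x => ∫ y, φ y * cutPow t (-α) (x - y) := by
    have := (Integrable.convolution_integrand (ContinuousLinearMap.mul ℝ ℝ) hφi i1).integral_prod_left
    simpa only [ContinuousLinearMap.mul_apply'] using this
  have hai : Integrable a := (i1.const_mul _).add hconv
  -- the left derivative
  have hwl : ∀ x ∈ Ioo 0 t, weylLeft α 0 f x = (Real.Gamma (1 - α))⁻¹ * a x := by
    intro x hx
    rw [weylLeft_of_hasDerivAt h1 hf hf' hx.1, ha]
    simp only
    congr 2
    · rw [cutPow, indicator_of_mem (show x ∈ Ioc 0 t from ⟨hx.1, hx.2.le⟩)]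
    · rw [intervalIntegral.integral_of_le hx.1.le, integral_Ioc_eq_integral_Ioo,
        ← integral_indicator measurableSet_Ioo]
      refine integral_congr_ae (Filter.Eventually.of_forall fun y => ?_)
      simp only [hφ, cutPow, indicator_apply, mem_Ioc, mem_Ioo]
      by_cases hc : 0 < y ∧ y < x
      · rw [if_pos hc, if_pos ⟨hc.1, by linarith [hx.2]⟩, if_pos ⟨by linarith, by linarith [hx.2]⟩]
      · rw [if_neg hc]
        by_cases hy : 0 < y
        · rw [if_neg (c := 0 < x - y ∧ _) (fun h4 => hc ⟨hy, by linarith [h4.1]⟩), mul_zero]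
        · rw [if_neg (fun h4 => hy h4.1), zero_mul]
  -- the right derivative
  have hwr : ∀ x ∈ Ioo 0 t, weylRight (1 - α) t (fun y => g y - Function.leftLim g t) x
      = -(Real.Gamma α)⁻¹ * ∫ z, ψ z * cutPow t (α - 1) (z - x) := by
    intro x hx
    rw [weylRight_eq_weylLeft, hleft]
    rw [weylLeft_of_hasDerivAt (by linarith) (f' := fun y => -g' (t - y))
      (fun y => by
        have := ((hg (t - y)).sub_const (g t)).comp y ((hasDerivAt_id y).const_sub t)
        simpa [Function.comp_def] using this) (by fun_prop) (sub_pos.2 hx.2)]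
    simp only [sub_zero, sub_self, zero_mul, zero_add, sub_sub_cancel, neg_sub]
    rw [neg_mul, ← mul_neg]
    congr 1
    have := intervalIntegral.integral_comp_sub_left (a := 0) (b := t - x)
      (fun z => -g' z * (z - x) ^ (α - 1)) t
    simp only [sub_sub_cancel, sub_zero] at this
    have e : ∀ y, t - x - y = t - y - x := fun y => by ring
    simp only [e]
    rw [this, intervalIntegral.integral_of_le hx.2.le, ← integral_indicator measurableSet_Ioc,
      ← integral_neg]
    refine integral_congr_ae (Filter.Eventually.of_forall fun z => ?_)
    simp only [hψ, cutPow, indicator_apply, mem_Ioc]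
    by_cases hc : x < z ∧ z ≤ t
    · rw [if_pos hc, if_pos ⟨by linarith [hx.1], hc.2⟩,
        if_pos ⟨by linarith, by linarith [hx.1]⟩, neg_mul]
    · rw [if_neg hc]
      by_cases hz : 0 < z ∧ z ≤ t
      · rw [if_neg (c := 0 < z - x ∧ _) (fun h4 => hc ⟨by linarith [h4.1], hz.2⟩), mul_zero, neg_zero]
      · rw [if_neg hz, zero_mul, neg_zero]
  have hG1 := Real.Gamma_pos_of_pos (by linarith : 0 < 1 - α)
  have hG2 := Real.Gamma_pos_of_pos h0
  -- Outside [0, t] the product on the right vanishes by itself: `a` does for x ≤ 0, the other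
  -- factor for x > t. The minus sign in `hwr` cancels the one in `genStieltjes`.
  have step1 : genStieltjes α 0 t f g = (Real.Gamma (1 - α))⁻¹ * (Real.Gamma α)⁻¹ *
      ∫ x, a x * ∫ z, ψ z * cutPow t (α - 1) (z - x) := by
    rw [genStieltjes, intervalIntegral.integral_of_le ht, integral_Ioc_eq_integral_Ioo,
      ← integral_indicator measurableSet_Ioo, ← integral_neg, ← integral_const_mul]
    refine integral_congr_ae ?_
    have hne : ∀ᵐ x ∂(volume : Measure ℝ), x ≠ t := by simp [ae_iff, measure_singleton]
    filter_upwards [hne] with x hxt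
    by_cases hx : x ∈ Ioo 0 t
    · rw [indicator_of_mem hx, hwl x hx, hwr x hx]; ring
    · rw [indicator_of_notMem hx, neg_zero]
      symm
      rcases le_or_gt x 0 with hx0 | hx0
      · have : a x = 0 := by
          simp only [ha, cutPow]
          rw [indicator_of_notMem (fun h => absurd h.1 (not_lt.2 hx0)), mul_zero, zero_add]
          refine integral_eq_zero_of_ae (Filter.Eventually.of_forall fun y => ?_)
          simp only [hφ, indicator_apply, mem_Ioc, Pi.zero_apply]
          by_cases hy : 0 < y
          · rw [if_neg (c := 0 < x - y ∧ _) (fun h4 => by linarith [h4.1]), mul_zero]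
          · rw [if_neg (fun h4 => hy h4.1), zero_mul]
        rw [this, zero_mul, mul_zero]
      · have hxt' : t < x := lt_of_le_of_ne (not_lt.1 fun h => hx ⟨hx0, h⟩) (Ne.symm hxt)
        have : ∫ z, ψ z * cutPow t (α - 1) (z - x) = 0 := by
          refine integral_eq_zero_of_ae (Filter.Eventually.of_forall fun z => ?_)
          simp only [hψ, cutPow, indicator_apply, mem_Ioc, Pi.zero_apply]
          by_cases hz : 0 < z ∧ z ≤ t
          · rw [if_neg (c := 0 < z - x ∧ _) (fun h4 => by linarith [h4.1, hz.2]), mul_zero]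
          · rw [if_neg hz, zero_mul]
        rw [this, mul_zero, mul_zero]
  have hF := (Integrable.convolution_integrand (ContinuousLinearMap.mul ℝ ℝ) hai i2)
  simp only [ContinuousLinearMap.mul_apply'] at hF
  have hF2 : Integrable (fun p : ℝ × ℝ => ψ p.1 * (a p.2 * cutPow t (α - 1) (p.1 - p.2)))
      (volume.prod volume) :=
    hF.bdd_mul (hψm.comp measurable_fst).aestronglyMeasurable
      (Filter.Eventually.of_forall fun p => hψb p.1)
  have step2 : ∫ x, a x * ∫ z, ψ z * cutPow t (α - 1) (z - x)
      = ∫ z, ψ z * ∫ x, a x * cutPow t (α - 1) (z - x) := by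
    calc _ = ∫ x, ∫ z, ψ z * (a x * cutPow t (α - 1) (z - x)) := by
          refine integral_congr_ae (Filter.Eventually.of_forall fun x => ?_)
          simp only
          rw [← integral_const_mul]
          refine integral_congr_ae (Filter.Eventually.of_forall fun z => ?_)
          simp only; ring
      _ = ∫ z, ∫ x, ψ z * (a x * cutPow t (α - 1) (z - x)) := (integral_integral_swap hF2).symm
      _ = _ := by simp only [integral_const_mul]
  -- The second kernel turns the two parts of `a` into f 0 and f z - f 0, up to ΓΓ. This holds for
  -- almost every z, since splitting the integral needs both parts to be integrable in x.
  have step3 : ∀ᵐ z, ψ z * ∫ x, a x * cutPow t (α - 1) (z - x)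
      = Real.Gamma (1 - α) * Real.Gamma α * (Ioc 0 t).indicator (fun z => f z * g' z) z := by
    have j1 := (Integrable.convolution_integrand (ContinuousLinearMap.mul ℝ ℝ)
      (i1.const_mul (f 0)) i2).prod_right_ae
    have j2 := (Integrable.convolution_integrand (ContinuousLinearMap.mul ℝ ℝ)
      hconv i2).prod_right_ae
    simp only [ContinuousLinearMap.mul_apply'] at j1 j2
    filter_upwards [j1, j2] with z hz1 hz2
    by_cases hz : z ∈ Ioc 0 t
    swap
    · simp [hψ, indicator_of_notMem hz]
    rw [indicator_of_mem hz, hψ, indicator_of_mem hz]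
    simp only [ha, add_mul]
    rw [integral_add hz1 hz2,
      integral_fractional_kernel_swap h0 h1 hz.2 ht hφm hφb
        (fun y hy => by simp [hφ, not_lt.2 hy])]
    have e1 := integral_cutPow_mul_cutPow (t := t) (y := 0) (z := z) h0 h1 (by linarith [hz.2])
    simp only [sub_zero, if_pos hz.1] at e1
    simp only [mul_assoc (f 0)]
    rw [integral_const_mul, e1]
    have e2 : ∫ y in Iio z, φ y = f z - f 0 := by
      rw [hφ, setIntegral_indicator measurableSet_Ioc,
        ← intervalIntegral.integral_eq_sub_of_hasDerivAt (fun x _ => hf x)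
          (hf'.intervalIntegrable 0 z), intervalIntegral.integral_of_le hz.1.le,
        integral_Ioc_eq_integral_Ioo]
      congr 2
      ext y
      simp only [mem_inter_iff, mem_Iio, mem_Ioc, mem_Ioo]
      constructor
      · rintro ⟨h3, h4, h5⟩; exact ⟨h4, h3⟩
      · rintro ⟨h3, h4⟩; exact ⟨h4, h3, h4.le.trans hz.2⟩
    rw [e2]
    ring
  rw [step1, step2, integral_congr_ae step3, integral_const_mul,
    integral_indicator measurableSet_Ioc, intervalIntegral.integral_of_le ht]
  field_simp

/-! ### Steklov averages and the passage to Hölder functions -/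

theorem continuous_of_abs_sub_le_rpow {f : ℝ → ℝ} {A lam : ℝ} (hlam : 0 < lam)
    (hf : ∀ x y, |f x - f y| ≤ A * |x - y| ^ lam) : Continuous f := by
  refine continuous_iff_continuousAt.2 fun x => tendsto_iff_norm_sub_tendsto_zero.2 ?_
  refine squeeze_zero (fun _ => norm_nonneg _) (fun y => hf y x) ?_
  have : ContinuousAt (fun y => A * |y - x| ^ lam) x :=
    continuousAt_const.mul ((continuous_abs.comp (continuous_id.sub continuous_const)).continuousAt.rpow_const
      (Or.inr hlam.le))
  have h := this.tendsto
  simpa [Real.zero_rpow hlam.ne'] using h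

/-- The average of `f` over `[x, x + ε]`. -/
noncomputable def steklov (ε : ℝ) (f : ℝ → ℝ) (x : ℝ) : ℝ := ε⁻¹ * ∫ u in (0 : ℝ)..ε, f (x + u)

section Steklov

variable {f : ℝ → ℝ} {ε A lam : ℝ}

theorem hasDerivAt_steklov (hf : Continuous f) (x : ℝ) :
    HasDerivAt (steklov ε f) (ε⁻¹ * (f (x + ε) - f x)) x := by
  have e : steklov ε f
      = fun x => ε⁻¹ * ((∫ u in (0 : ℝ)..(x + ε), f u) - ∫ u in (0 : ℝ)..x, f u) := by
    funext y
    rw [steklov, intervalIntegral.integral_comp_add_left, add_zero,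
      intervalIntegral.integral_interval_sub_left (hf.intervalIntegrable _ _)
        (hf.intervalIntegrable _ _)]
  rw [e]
  have d1 : HasDerivAt (fun x => ∫ u in (0 : ℝ)..(x + ε), f u) (f (x + ε)) x := by
    have := (intervalIntegral.integral_hasDerivAt_right (hf.intervalIntegrable 0 (x + ε))
      (hf.stronglyMeasurableAtFilter _ _) hf.continuousAt).comp x ((hasDerivAt_id x).add_const ε)
    simpa [Function.comp_def] using this
  have d2 := intervalIntegral.integral_hasDerivAt_right (hf.intervalIntegrable 0 x)
      (hf.stronglyMeasurableAtFilter _ _) hf.continuousAt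
  exact (d1.sub d2).const_mul _

/-- The single comparison behind the properties below: g = f gives the Hölder bound with an
unchanged constant, g = 0 the sup bound, and the constant g = f x the convergence. -/
theorem abs_steklov_sub_le (hf : Continuous f) {g : ℝ → ℝ} (hg : Continuous g) (hε : 0 < ε)
    {x y c : ℝ} (h : ∀ u ∈ Icc 0 ε, |f (x + u) - g (y + u)| ≤ c) :
    |steklov ε f x - steklov ε g y| ≤ c := by
  rw [steklov, steklov, ← mul_sub, ← intervalIntegral.integral_sub
    (by apply Continuous.intervalIntegrable; fun_prop)
    (by apply Continuous.intervalIntegrable; fun_prop), abs_mul, abs_of_pos (inv_pos.2 hε),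
    inv_mul_le_iff₀ hε]
  have := intervalIntegral.norm_integral_le_of_norm_le_const (a := 0) (b := ε) (C := c)
    (f := fun u => f (x + u) - g (y + u)) (fun u hu => by
      rw [uIoc_of_le hε.le] at hu
      exact h u ⟨hu.1.le, hu.2⟩)
  rw [sub_zero, abs_of_pos hε, Real.norm_eq_abs] at this
  linarith

theorem steklov_const (hε : 0 < ε) (c x : ℝ) : steklov ε (fun _ => c) x = c := by
  rw [steklov, intervalIntegral.integral_const, sub_zero, smul_eq_mul, inv_mul_cancel_left₀ hε.ne']

theorem abs_steklov_sub_steklov_le (hε : 0 < ε) (hlam : 0 < lam)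
    (hf : ∀ x y, |f x - f y| ≤ A * |x - y| ^ lam) (x y : ℝ) :
    |steklov ε f x - steklov ε f y| ≤ A * |x - y| ^ lam := by
  have hfc := continuous_of_abs_sub_le_rpow hlam hf
  refine abs_steklov_sub_le hfc hfc hε fun u _ => ?_
  have := hf (x + u) (y + u)
  rwa [add_sub_add_right_eq_sub] at this

theorem abs_steklov_le (hf : Continuous f) (hε : 0 < ε) {c : ℝ} (h : ∀ x, |f x| ≤ c) (x : ℝ) :
    |steklov ε f x| ≤ c := by
  have := abs_steklov_sub_le hf (g := fun _ => 0) continuous_const hε (x := x) (y := 0) (c := c)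
    (fun u _ => by simpa using h (x + u))
  rwa [steklov_const hε, sub_zero] at this

theorem tendsto_steklov (hlam : 0 < lam) (hf : ∀ x y, |f x - f y| ≤ A * |x - y| ^ lam) (x : ℝ) :
    Filter.Tendsto (fun n : ℕ => steklov (1 / ((n : ℝ) + 1)) f x) Filter.atTop (nhds (f x)) := by
  have hfc := continuous_of_abs_sub_le_rpow hlam hf
  have hA : 0 ≤ A := by
    have := (abs_nonneg _).trans (hf 1 0)
    simpa using this
  rw [tendsto_iff_norm_sub_tendsto_zero]
  refine squeeze_zero (g := fun n : ℕ => A * (1 / ((n : ℝ) + 1)) ^ lam)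
    (fun _ => norm_nonneg _) (fun n => ?_) ?_
  · have hε : (0 : ℝ) < 1 / ((n : ℝ) + 1) := by positivity
    have := abs_steklov_sub_le hfc (g := fun _ => f x) continuous_const hε (x := x) (y := 0)
      (c := A * (1 / ((n : ℝ) + 1)) ^ lam) (fun u hu => ?_)
    · rwa [steklov_const hε] at this
    · have := hf (x + u) x
      rw [add_sub_cancel_left, abs_of_nonneg hu.1] at this
      exact this.trans (mul_le_mul_of_nonneg_left (Real.rpow_le_rpow hu.1 hu.2 hlam.le) hA)
  · have h1 : ContinuousAt (fun e : ℝ => A * e ^ lam) 0 :=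
      continuousAt_const.mul (continuousAt_id.rpow_const (Or.inr hlam.le))
    have := h1.tendsto.comp (tendsto_one_div_add_atTop_nhds_zero_nat (𝕜 := ℝ))
    simpa [Function.comp_def, Real.zero_rpow hlam.ne'] using this

end Steklov

theorem measurable_weylLeft {f : ℝ → ℝ} (hf : Measurable f) (α : ℝ) :
    Measurable (weylLeft α 0 f) := by
  have hF : Measurable (fun p : ℝ × ℝ => (f p.1 - f p.2) / (p.1 - p.2) ^ (1 + α)) :=
    ((hf.comp measurable_fst).sub (hf.comp measurable_snd)).div
      ((measurable_fst.sub measurable_snd).pow_const _)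
  have h1 : Measurable (fun x => ∫ y in Ioc 0 x, (f x - f y) / (x - y) ^ (1 + α)) := by
    have hs : MeasurableSet {p : ℝ × ℝ | 0 < p.2 ∧ p.2 ≤ p.1} :=
      (measurableSet_lt measurable_const measurable_snd).inter
        (measurableSet_le measurable_snd measurable_fst)
    have := (hF.indicator hs).stronglyMeasurable.integral_prod_right' (ν := volume)
    convert this.measurable using 2 with x
    rw [← integral_indicator measurableSet_Ioc]
    rfl
  have h2 : Measurable (fun x => ∫ y in Ioc x 0, (f x - f y) / (x - y) ^ (1 + α)) := by
    have hs : MeasurableSet {p : ℝ × ℝ | p.1 < p.2 ∧ p.2 ≤ 0} :=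
      (measurableSet_lt measurable_fst measurable_snd).inter
        (measurableSet_le measurable_snd measurable_const)
    have := (hF.indicator hs).stronglyMeasurable.integral_prod_right' (ν := volume)
    convert this.measurable using 2 with x
    rw [← integral_indicator measurableSet_Ioc]
    rfl
  unfold weylLeft
  simp only [intervalIntegral]
  exact measurable_const.mul ((hf.div ((measurable_id.sub_const 0).pow_const _)).add
    (measurable_const.mul (h1.sub h2)))

theorem abs_weylLeft_le {α lam A x : ℝ} {f : ℝ → ℝ} (h0 : 0 < α) (h1 : α < 1) (hα : α < lam)
    (hx : 0 < x) (hf : ∀ x y, |f x - f y| ≤ A * |x - y| ^ lam) :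
    |weylLeft α 0 f x| ≤ (Real.Gamma (1 - α))⁻¹ *
      (|f x| * x ^ (-α) + α * (A * (x ^ (lam - α) / (lam - α)))) := by
  have hG := Real.Gamma_pos_of_pos (by linarith : 0 < 1 - α)
  rw [weylLeft, abs_mul, abs_of_pos (inv_pos.2 hG), sub_zero]
  refine mul_le_mul_of_nonneg_left ((abs_add_le _ _).trans (add_le_add ?_ ?_)) (inv_pos.2 hG).le
  · rw [abs_div, abs_of_pos (Real.rpow_pos_of_pos hx _), Real.rpow_neg hx.le, div_eq_mul_inv]
  · rw [abs_mul, abs_of_pos h0]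
    refine mul_le_mul_of_nonneg_left (abs_integral_marchaud_le hα hx.le fun y hy => ?_) h0.le
    have := hf x y
    rwa [abs_of_nonneg (sub_nonneg.2 hy.2)] at this

theorem tendsto_weylLeft {α lam A x : ℝ} {f : ℝ → ℝ} {F : ℕ → ℝ → ℝ} (hα : α < lam)
    (hx : 0 < x) (hFm : ∀ n, Measurable (F n))
    (hF : ∀ n x y, |F n x - F n y| ≤ A * |x - y| ^ lam)
    (hlim : ∀ x, Filter.Tendsto (fun n => F n x) Filter.atTop (nhds (f x))) :
    Filter.Tendsto (fun n => weylLeft α 0 (F n) x) Filter.atTop (nhds (weylLeft α 0 f x)) := by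
  unfold weylLeft
  refine (((hlim x).div_const _).add (Filter.Tendsto.const_mul _ ?_)).const_mul _
  refine intervalIntegral.tendsto_integral_filter_of_dominated_convergence
    (fun y => A * (x - y) ^ (lam - 1 - α)) (Filter.Eventually.of_forall fun n => ?_)
    (Filter.Eventually.of_forall fun n => ?_)
    ((intervalIntegrable_sub_rpow (by linarith) x 0 x).const_mul A) ?_
  · exact ((measurable_const.sub (hFm n)).div
      ((measurable_const.sub measurable_id).pow_const _)).aestronglyMeasurable
  · have hne : ∀ᵐ y ∂(volume : Measure ℝ), y ≠ x := by simp [ae_iff, measure_singleton]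
    filter_upwards [hne] with y hyx hy
    rw [uIoc_of_le hx.le] at hy
    refine norm_marchaud_integrand_le (fun z hz => ?_) ⟨hy.1, lt_of_le_of_ne hy.2 hyx⟩
    have := hF n x z
    rwa [abs_of_nonneg (sub_nonneg.2 hz.2)] at this
  · exact Filter.Eventually.of_forall fun y _ => ((hlim x).sub (hlim y)).div_const _

/-- Uniform Hölder constants dominate the integrand: the left derivative has at worst the integrable
singularity x^(-α), and the right derivative stays bounded because β > 1 - α. -/
theorem tendsto_genStieltjes {α lam β A G c t : ℝ} {f g : ℝ → ℝ} {F H : ℕ → ℝ → ℝ}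
    (h0 : 0 < α) (h1 : α < 1) (hα : α < lam) (hβ : 1 - α < β) (ht : 0 ≤ t)
    (hF : ∀ n x y, |F n x - F n y| ≤ A * |x - y| ^ lam)
    (hFc : ∀ n x, |F n x| ≤ c)
    (hFlim : ∀ x, Filter.Tendsto (fun n => F n x) Filter.atTop (nhds (f x)))
    (hH : ∀ n x y, |H n x - H n y| ≤ G * |x - y| ^ β)
    (hg : ∀ x y, |g x - g y| ≤ G * |x - y| ^ β)
    (hHlim : ∀ x, Filter.Tendsto (fun n => H n x) Filter.atTop (nhds (g x))) :
    Filter.Tendsto (fun n => genStieltjes α 0 t (F n) (H n)) Filter.atTop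
      (nhds (genStieltjes α 0 t f g)) := by
  have hA0 : 0 ≤ A := by simpa using (abs_nonneg _).trans (hF 0 1 0)
  have hG0 : 0 ≤ G := by simpa using (abs_nonneg _).trans (hg 1 0)
  have hFm : ∀ n, Measurable (F n) := fun n =>
    (continuous_of_abs_sub_le_rpow (by linarith) (hF n)).measurable
  have hHc : ∀ n, Continuous (H n) := fun n => continuous_of_abs_sub_le_rpow (by linarith) (hH n)
  have hgc : Continuous g := continuous_of_abs_sub_le_rpow (by linarith) hg
  have hL : ∀ n, Function.leftLim (H n) t = H n t := fun n =>
    (hHc n).continuousAt.continuousWithinAt.leftLim_eq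
  have hLg : Function.leftLim g t = g t := hgc.continuousAt.continuousWithinAt.leftLim_eq
  unfold genStieltjes
  simp only [hL, hLg, weylRight_eq_weylLeft]
  have hH' : ∀ n x y, |(H n (t - x) - H n t) - (H n (t - y) - H n t)| ≤ G * |x - y| ^ β := by
    intro n x y
    have := hH n (t - x) (t - y)
    rwa [sub_sub_sub_cancel_left, abs_sub_comm y x, ← sub_sub_sub_cancel_right _ _ (H n t)] at this
  set K₁ := (Real.Gamma (1 - α))⁻¹ with hK₁
  set K₂ := (Real.Gamma (1 - (1 - α)))⁻¹ with hK₂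
  have hK₁0 : 0 ≤ K₁ := inv_nonneg.2 (Real.Gamma_pos_of_pos (by linarith)).le
  have hK₂0 : 0 ≤ K₂ := inv_nonneg.2 (Real.Gamma_pos_of_pos (by linarith)).le
  have hc0 : 0 ≤ c := (abs_nonneg _).trans (hFc 0 0)
  -- A uniform bound for the right derivative on (0, t). The reflected driver vanishes at 0, so its
  -- boundary term is at most G (t - x)^(β-(1-α)) and has no singularity.
  set R := K₂ * (G * t ^ (β - (1 - α)) + (1 - α) * (G * (t ^ (β - (1 - α)) / (β - (1 - α)))))
    with hR
  have hR0 : 0 ≤ R := by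
    have := Real.rpow_nonneg ht (β - (1 - α))
    have h4 : 0 ≤ (1 - α) * (G * (t ^ (β - (1 - α)) / (β - (1 - α)))) :=
      mul_nonneg (by linarith) (mul_nonneg hG0 (div_nonneg this (by linarith)))
    positivity
  refine Filter.Tendsto.neg ?_
  refine intervalIntegral.tendsto_integral_filter_of_dominated_convergence
    (fun x => (K₁ * (c * x ^ (-α) + α * (A * (t ^ (lam - α) / (lam - α))))) * R)
    (Filter.Eventually.of_forall fun n => ?_)
    (Filter.Eventually.of_forall fun n => ?_) ?_ ?_
  · have m1 := measurable_weylLeft (hFm n) α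
    have m2 : Measurable fun x => weylLeft (1 - α) 0 (fun y => H n (t - y) - H n t) (t - x) :=
      (measurable_weylLeft (f := fun y => H n (t - y) - H n t)
        ((hHc n).measurable.comp (by fun_prop : Measurable fun y : ℝ => t - y) |>.sub_const _)
        (1 - α)).comp (by fun_prop)
    exact (m1.mul m2).aestronglyMeasurable
  · have hne : ∀ᵐ y ∂(volume : Measure ℝ), y ≠ t := by simp [ae_iff, measure_singleton]
    filter_upwards [hne] with x hxt hx
    rw [uIoc_of_le ht] at hx
    have hxt' : x < t := lt_of_le_of_ne hx.2 hxt
    have b1 := abs_weylLeft_le h0 h1 hα hx.1 (hF n)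
    have b2 := abs_weylLeft_le (by linarith : 0 < 1 - α) (by linarith) hβ (sub_pos.2 hxt') (hH' n)
    rw [norm_mul, Real.norm_eq_abs, Real.norm_eq_abs]
    refine mul_le_mul (b1.trans ?_) (b2.trans ?_) (abs_nonneg _) ?_
    · refine mul_le_mul_of_nonneg_left (add_le_add ?_ ?_) hK₁0
      · exact mul_le_mul_of_nonneg_right (hFc n x) (Real.rpow_nonneg hx.1.le _)
      · have := Real.rpow_le_rpow hx.1.le hx.2 (by linarith : 0 ≤ lam - α)
        have h5 : 0 < lam - α := by linarith
        gcongr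
    · have hpow := Real.rpow_le_rpow (sub_pos.2 hxt').le (by linarith [hx.1] : t - x ≤ t)
        (by linarith : 0 ≤ β - (1 - α))
      refine mul_le_mul_of_nonneg_left (add_le_add ?_ ?_) hK₂0
      · have b3 := hH' n (t - x) 0
        simp only [sub_zero, sub_self] at b3
        rw [abs_of_pos (sub_pos.2 hxt')] at b3
        calc _ ≤ G * (t - x) ^ β * (t - x) ^ (-(1 - α)) :=
              mul_le_mul_of_nonneg_right b3 (Real.rpow_nonneg (sub_pos.2 hxt').le _)
          _ = G * (t - x) ^ (β - (1 - α)) := by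
              rw [mul_assoc, ← Real.rpow_add (sub_pos.2 hxt')]; rfl
          _ ≤ _ := mul_le_mul_of_nonneg_left hpow hG0
      · have h5 : 0 < β - (1 - α) := by linarith
        have h6 : 0 < 1 - α := by linarith
        gcongr
    · have h5 : 0 < lam - α := by linarith
      have := Real.rpow_nonneg ht (lam - α)
      have h7 := Real.rpow_nonneg hx.1.le (-α)
      positivity
  · exact (((((intervalIntegral.intervalIntegrable_rpow' (by linarith)).const_mul c).add
      intervalIntegrable_const).const_mul K₁).mul_const R)
  · have hne : ∀ᵐ y ∂(volume : Measure ℝ), y ≠ t := by simp [ae_iff, measure_singleton]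
    filter_upwards [hne] with x hxt hx
    rw [uIoc_of_le ht] at hx
    refine (tendsto_weylLeft hα hx.1 hFm hF hFlim).mul
      (tendsto_weylLeft hβ (sub_pos.2 (lt_of_le_of_ne hx.2 hxt))
        (fun n => ?_) hH' fun y => (hHlim _).sub (hHlim _))
    exact ((hHc n).measurable.comp (by fun_prop : Measurable fun y : ℝ => t - y)).sub_const _

/-- The constant here involves derivatives and is useless in a limit. Only the order 2 > 1 is
needed, as the qualitative input of Young's inequality. -/
theorem isYoung_integral_of_hasDerivAt {f f' g g' : ℝ → ℝ}
    (hf : ∀ x, HasDerivAt f (f' x) x) (hf' : Continuous f')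
    (hg : ∀ x, HasDerivAt g (g' x) x) (hg' : Continuous g') (a b : ℝ) :
    ∃ C, IsYoung a b C 2 (fun t => ∫ z in (0 : ℝ)..t, f z * g' z)
      (fun _ : Unit => f) (fun _ => g) := by
  obtain ⟨L₁, hL₁0, -, hL₁⟩ := exists_lipschitz_of_continuous_deriv hf hf' a b
  obtain ⟨L₂, hL₂0, hL₂, -⟩ := exists_lipschitz_of_continuous_deriv hg hg' a b
  have hfc : Continuous f := continuous_iff_continuousAt.2 fun z => (hf z).continuousAt
  refine ⟨L₁ * L₂, fun s t h1 h2 h3 => ?_⟩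
  have hi : ∀ u v, IntervalIntegrable (fun z => f z * g' z) volume u v := fun u v =>
    (hfc.mul hg').intervalIntegrable u v
  have hi' : IntervalIntegrable (fun z => g' z * f s) volume s t :=
    (hg'.mul continuous_const).intervalIntegrable s t
  simp only [Finset.univ_unique, Finset.sum_singleton, smul_eq_mul]
  rw [intervalIntegral.integral_interval_sub_left (hi 0 t) (hi 0 s),
    ← intervalIntegral.integral_eq_sub_of_hasDerivAt (fun x _ => hg x)
      (hg'.intervalIntegrable s t), ← intervalIntegral.integral_mul_const,
    ← intervalIntegral.integral_sub (hi s t) hi']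
  have := intervalIntegral.norm_integral_le_of_norm_le_const (a := s) (b := t)
    (C := L₁ * L₂ * (t - s)) (f := fun z => f z * g' z - g' z * f s) (fun z hz => by
      rw [uIoc_of_le h2] at hz
      have b1 := hL₁ z ⟨by linarith [hz.1], hz.2.trans h3⟩ s ⟨h1, h2.trans h3⟩
      have b2 := hL₂ z ⟨by linarith [hz.1], hz.2.trans h3⟩
      rw [abs_of_nonneg (by linarith [hz.1] : 0 ≤ z - s)] at b1
      have e : f z * g' z - g' z * f s = (f z - f s) * g' z := by ring
      rw [e, norm_mul, Real.norm_eq_abs, Real.norm_eq_abs]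
      calc _ ≤ (L₁ * (t - s)) * L₂ := mul_le_mul
            (b1.trans (mul_le_mul_of_nonneg_left (by linarith [hz.2]) hL₁0)) b2 (abs_nonneg _)
            (mul_nonneg hL₁0 (by linarith))
        _ = _ := by ring)
  rw [abs_of_nonneg (by linarith : 0 ≤ t - s)] at this
  refine this.trans (le_of_eq ?_)
  rw [Real.rpow_two]; ring

/-- Additivity in the interval is not visible in the definition, because the right derivative is
based at the upper endpoint. It is evident for the Steklov averages, whose integrals are ordinary
ones. Young's inequality bounds their remainders by A * G uniformly, and the bound passes to the
limit. -/
theorem isYoung_genStieltjes_of_global {α lam β A G c T : ℝ} {f g : ℝ → ℝ}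
    (h0 : 0 < α) (h1 : α < 1) (hα : α < lam) (hβ : 1 - α < β)
    (hf : ∀ x y, |f x - f y| ≤ A * |x - y| ^ lam) (hfc : ∀ x, |f x| ≤ c)
    (hg : ∀ x y, |g x - g y| ≤ G * |x - y| ^ β) :
    IsYoung 0 T (youngConst (lam + β) * (A * G)) (lam + β) (fun t => genStieltjes α 0 t f g)
      (fun _ : Unit => f) (fun _ => g) := by
  intro s t hs hst htT
  have hA0 : 0 ≤ A := by simpa using (abs_nonneg _).trans (hf 1 0)
  have hG0 : 0 ≤ G := by simpa using (abs_nonneg _).trans (hg 1 0)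
  have hlam : 0 < lam := by linarith
  have hβ0 : 0 < β := by linarith
  have hfC := continuous_of_abs_sub_le_rpow hlam hf
  have hgC := continuous_of_abs_sub_le_rpow hβ0 hg
  set e : ℕ → ℝ := fun n => 1 / ((n : ℝ) + 1) with he
  have he0 : ∀ n, 0 < e n := fun n => by positivity
  have hFl := fun x => tendsto_steklov (x := x) hlam hf
  have hHl := fun x => tendsto_steklov (x := x) hβ0 hg
  have hFh := fun n => abs_steklov_sub_steklov_le (he0 n) hlam hf
  have hHh := fun n => abs_steklov_sub_steklov_le (he0 n) hβ0 hg
  have lim : ∀ t, 0 ≤ t → Filter.Tendsto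
      (fun n => genStieltjes α 0 t (steklov (e n) f) (steklov (e n) g)) Filter.atTop
      (nhds (genStieltjes α 0 t f g)) := fun t ht =>
    tendsto_genStieltjes h0 h1 hα hβ ht hFh (fun n => abs_steklov_le hfC (he0 n) hfc) hFl hHh hg hHl
  have bound : ∀ n, ‖genStieltjes α 0 t (steklov (e n) f) (steklov (e n) g)
      - genStieltjes α 0 s (steklov (e n) f) (steklov (e n) g)
      - (steklov (e n) g t - steklov (e n) g s) * steklov (e n) f s‖
      ≤ youngConst (lam + β) * (A * G) * (t - s) ^ (lam + β) := by
    intro n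
    have dF := fun x => hasDerivAt_steklov (ε := e n) hfC x
    have dH := fun x => hasDerivAt_steklov (ε := e n) hgC x
    have cF : Continuous fun x => (e n)⁻¹ * (f (x + e n) - f x) := by fun_prop
    have cH : Continuous fun x => (e n)⁻¹ * (g (x + e n) - g x) := by fun_prop
    obtain ⟨C, hC⟩ := isYoung_integral_of_hasDerivAt dF cF dH cH 0 T
    have := hC.young_inequality (by norm_num) (lam := lam) (β := β) (by linarith) hA0 hG0 hlam hβ0
      (fun _ u v _ huv _ => by
        have := hFh n v u
        rwa [abs_of_nonneg (by linarith : 0 ≤ v - u)] at this)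
      (fun _ u v _ huv _ => by
        have := hHh n v u
        rwa [abs_of_nonneg (by linarith : 0 ≤ v - u)] at this) s t hs hst htT
    simp only [Finset.univ_unique, Finset.sum_singleton, smul_eq_mul, Fintype.card_unit,
      Nat.cast_one, one_mul] at this
    rwa [genStieltjes_of_hasDerivAt h0 h1 dF cF dH cH (hs.trans hst),
      genStieltjes_of_hasDerivAt h0 h1 dF cF dH cH hs]
  have hl := (((lim t (hs.trans hst)).sub (lim s hs)).sub
    (((hHl t).sub (hHl s)).mul (hFl s))).norm
  simp only [Finset.univ_unique, Finset.sum_singleton, smul_eq_mul]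
  exact le_of_tendsto' hl bound

theorem genStieltjes_congr {α t : ℝ} {f g f' g' : ℝ → ℝ} (ht : 0 ≤ t)
    (hf : EqOn f f' (Icc 0 t)) (hg : EqOn g g' (Icc 0 t)) (hgc : ContinuousOn g (Icc 0 t)) :
    genStieltjes α 0 t f g = genStieltjes α 0 t f' g' := by
  rcases eq_or_lt_of_le ht with rfl | ht0
  · simp [genStieltjes]
  -- The left limit at t looks only at values below t, so continuity on [0, t] identifies it for
  -- both drivers.
  have hlim : Filter.Tendsto g (nhdsWithin t (Iio t)) (nhds (g t)) := by
    refine (hgc t ⟨ht, le_rfl⟩).tendsto.mono_left ?_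
    rw [← nhdsWithin_Ioo_eq_nhdsLT ht0]
    exact nhdsWithin_mono _ Ioo_subset_Icc_self
  have hL : Function.leftLim g t = g t := leftLim_eq_of_tendsto hlim
  have hL' : Function.leftLim g' t = g t := by
    refine leftLim_eq_of_tendsto (hlim.congr' ?_)
    filter_upwards [Ioo_mem_nhdsLT ht0] with x hx using hg ⟨hx.1.le, hx.2.le⟩
  unfold genStieltjes
  congr 1
  refine intervalIntegral.integral_congr fun x hx => ?_
  rw [uIcc_of_le ht] at hx
  simp only [weylLeft, weylRight, hL, hL', hf hx, hg hx]
  congr 3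
  · congr 1
    refine intervalIntegral.integral_congr fun y hy => ?_
    rw [uIcc_of_le hx.1] at hy
    simp only [hf ⟨hy.1, hy.2.trans hx.2⟩]
  · congr 1
    refine intervalIntegral.integral_congr fun y hy => ?_
    rw [uIcc_of_le hx.2] at hy
    simp only [hg ⟨hx.1.trans hy.1, hy.2⟩]

theorem HolderBound.continuousOn {E : Type*} [NormedAddCommGroup E] {a b lam A : ℝ} {f : ℝ → E}
    (hlam : 0 < lam) (h : HolderBound a b lam A f) : ContinuousOn f (Icc a b) := by
  intro x hx
  refine tendsto_iff_norm_sub_tendsto_zero.2 ?_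
  refine squeeze_zero' (g := fun y => A * |y - x| ^ lam)
    (Filter.Eventually.of_forall fun _ => norm_nonneg _) ?_ ?_
  · filter_upwards [self_mem_nhdsWithin] with y hy using h.dist_le_of_mem hx hy
  · have : ContinuousAt (fun y => A * |y - x| ^ lam) x :=
      continuousAt_const.mul ((continuous_abs.comp
        (continuous_id.sub continuous_const)).continuousAt.rpow_const (Or.inr hlam.le))
    have h := this.tendsto
    rw [sub_self, abs_zero, Real.zero_rpow hlam.ne', mul_zero] at h
    exact h.mono_left nhdsWithin_le_nhds

/-- The generalized Stieltjes integral of Hölder functions is a Young integral. -/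
theorem isYoung_genStieltjes {α lam β A G T : ℝ} {f g : ℝ → ℝ}
    (h0 : 0 < α) (h1 : α < 1) (hα : α < lam) (hβ : 1 - α < β) (hT : 0 ≤ T)
    (hA : 0 ≤ A) (hG : 0 ≤ G)
    (hf : HolderBound 0 T lam A f) (hg : HolderBound 0 T β G g) :
    IsYoung 0 T (youngConst (lam + β) * (A * G)) (lam + β) (fun t => genStieltjes α 0 t f g)
      (fun _ : Unit => f) (fun _ => g) := by
  -- Composition with the projection onto [0, T], a 1-Lipschitz map, extends both functions to the
  -- line without enlarging their Hölder constants.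
  set p : ℝ → ℝ := fun x => (projIcc 0 T hT x : ℝ) with hp
  have hpm : ∀ x, p x ∈ Icc 0 T := fun x => (projIcc 0 T hT x).2
  have hpe : ∀ x ∈ Icc 0 T, p x = x := fun x hx => by simp [hp, projIcc_of_mem hT hx]
  have hpl : ∀ x y, |p x - p y| ≤ |x - y| := fun x y => abs_projIcc_sub_projIcc hT
  have hlam : 0 < lam := by linarith
  have hβ0 : 0 < β := by linarith
  obtain ⟨c, hc⟩ := (isCompact_Icc (a := (0 : ℝ)) (b := T)).exists_bound_of_continuousOn
    (hf.continuousOn hlam)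
  have key := isYoung_genStieltjes_of_global (f := f ∘ p) (g := g ∘ p) (T := T) h0 h1 hα hβ
    (A := A) (G := G) (c := c)
    (fun x y => (hf.dist_le_of_mem (hpm y) (hpm x)).trans
      (mul_le_mul_of_nonneg_left (Real.rpow_le_rpow (abs_nonneg _) (hpl x y) hlam.le) hA))
    (fun x => hc _ (hpm x))
    (fun x y => (hg.dist_le_of_mem (hpm y) (hpm x)).trans
      (mul_le_mul_of_nonneg_left (Real.rpow_le_rpow (abs_nonneg _) (hpl x y) hβ0.le) hG))
  intro s t hs hst htT
  have := key s t hs hst htT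
  have hgs : ∀ r, 0 ≤ r → r ≤ T → genStieltjes α 0 r (f ∘ p) (g ∘ p) = genStieltjes α 0 r f g := by
    intro r hr hrT
    symm
    refine genStieltjes_congr hr (fun x hx => ?_) (fun x hx => ?_)
      ((hg.continuousOn hβ0).mono (Icc_subset_Icc_right hrT))
    · simp only [Function.comp, hpe x ⟨hx.1, hx.2.trans hrT⟩]
    · simp only [Function.comp, hpe x ⟨hx.1, hx.2.trans hrT⟩]
  simp only [hgs s hs (hst.trans htT), hgs t (hs.trans hst) htT, Function.comp,
    hpe s ⟨hs, hst.trans htT⟩, hpe t ⟨hs.trans hst, htT⟩] at this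
  exact this

/-! ### A priori bounds for linearly controlled Young integrals -/

section LinearGrowth

variable {E ι : Type*} [NormedAddCommGroup E] [NormedSpace ℝ E]

/-- On `[a, b]`, the sup and Hölder norms of the integrands `f k` are controlled linearly by those
of `X`, up to an inhomogeneity `δ`. -/
def LinearGrowth (a b lam P δ Δ : ℝ) (X : ℝ → E) (f : ι → ℝ → E) : Prop :=
  ∀ A S, 0 ≤ A → HolderBound a b lam A X → (∀ t ∈ Icc a b, ‖X t‖ ≤ S) → ∀ k,
    (∀ t ∈ Icc a b, ‖f k t‖ ≤ P * (S + δ)) ∧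
      HolderBound a b lam (P * (A + (S + δ) * Δ ^ (-lam))) (f k)

variable [Fintype ι]

theorem IsYoung.mono {a b a' b' C μ : ℝ} {Z : ℝ → E} {f : ι → ℝ → E} {g : ι → ℝ → ℝ}
    (h : IsYoung a b C μ Z f g) (ha : a ≤ a') (hb : b' ≤ b) : IsYoung a' b' C μ Z f g :=
  fun s t h1 h2 h3 => h s t (ha.trans h1) h2 (h3.trans hb)

/-- A priori bound for linearly controlled Young integrals on short intervals. -/
theorem IsYoung.holderBound_of_linearGrowth {a b lam β P δ Δ κ G C μ A₀ : ℝ} {X : ℝ → E}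
    {f : ι → ℝ → E} {g : ι → ℝ → ℝ} (hΔ : b - a ≤ Δ) (hΔ0 : 0 < Δ)
    (hlam : 0 < lam) (hβ : lam ≤ β) (hν : 1 < lam + β) (hμ : 1 < μ) (hP : 0 ≤ P) (hδ : 0 ≤ δ)
    (hG : 0 ≤ G) (hκ : G * Δ ^ β ≤ κ)
    (hsmall : 2 * (κ * Fintype.card ι * P * (1 + 2 * youngConst (lam + β))) ≤ 1)
    (hX : IsYoung a b C μ X f g) (hg : ∀ k, HolderBound a b β G (g k))
    (hA₀ : 0 ≤ A₀) (hX₀ : HolderBound a b lam A₀ X) (hf : LinearGrowth a b lam P δ Δ X f) :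
    HolderBound a b lam ((‖X a‖ + δ) * Δ ^ (-lam)) X ∧
      ∀ t ∈ Icc a b, ‖X t‖ + δ ≤ 2 * (‖X a‖ + δ) := by
  set c := (‖X a‖ + δ) * Δ ^ (-lam) with hc
  have hc0 : 0 ≤ c := by positivity
  have hβ0 : 0 < β := hlam.trans_le hβ
  have hK := youngConst_nonneg hν
  set K := youngConst (lam + β) with hKdef
  have hcΔ : c * Δ ^ lam = ‖X a‖ + δ := by
    rw [hc, mul_assoc, ← Real.rpow_add hΔ0, neg_add_cancel, Real.rpow_zero, mul_one]
  have hsup : ∀ A, 0 ≤ A → HolderBound a b lam A X → ∀ t ∈ Icc a b, ‖X t‖ ≤ ‖X a‖ + A * Δ ^ lam := by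
    intro A hA hXA t ht
    have h1 := hXA a t le_rfl ht.1 ht.2
    have h2 : (t - a) ^ lam ≤ Δ ^ lam :=
      Real.rpow_le_rpow (sub_nonneg.2 ht.1) (by linarith [ht.2]) hlam.le
    have h3 : ‖X t‖ ≤ ‖X a‖ + ‖X t - X a‖ := norm_le_norm_add_norm_sub' _ _
    have h4 := mul_le_mul_of_nonneg_left h2 hA
    linarith
  -- A self-improvement: with S = ‖X a‖ + AΔ^lam one has S + δ = (c + A)Δ^lam. The left point term
  -- then contributes κmP(c + A) and the remainder 2KκmP(c + A), with m the number of drivers, and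
  -- `hsmall` makes the sum at most (c + A)/2.
  have step : ∀ A, 0 ≤ A → HolderBound a b lam A X → HolderBound a b lam ((c + A) / 2) X := by
    intro A hA hXA s t hs hst ht
    have hgrowth := hf A (‖X a‖ + A * Δ ^ lam) hA hXA (hsup A hA hXA)
    have hS : ‖X a‖ + A * Δ ^ lam + δ = (c + A) * Δ ^ lam := by rw [add_mul, hcΔ]; ring
    have hS' : (‖X a‖ + A * Δ ^ lam + δ) * Δ ^ (-lam) = c + A := by
      rw [hS, mul_assoc, ← Real.rpow_add hΔ0, add_neg_cancel, Real.rpow_zero, mul_one]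
    rw [hS'] at hgrowth
    rw [hS] at hgrowth
    have hAf : 0 ≤ P * (A + (c + A)) := by positivity
    have hy := hX.young_inequality hμ hν hAf hG hlam hβ0 (fun k => (hgrowth k).2) hg s t hs hst ht
    have hts : 0 ≤ t - s := by linarith
    have htsΔ : t - s ≤ Δ := by linarith
    have hpow1 : (t - s) ^ β ≤ Δ ^ (β - lam) * (t - s) ^ lam := by
      rcases eq_or_lt_of_le hts with h0 | h0
      · rw [← h0, Real.zero_rpow hβ0.ne', Real.zero_rpow hlam.ne', mul_zero]
      · rw [show β = (β - lam) + lam by ring, Real.rpow_add h0]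
        simp only [add_sub_cancel_right]
        exact mul_le_mul_of_nonneg_right (Real.rpow_le_rpow hts htsΔ (by linarith))
          (Real.rpow_nonneg hts _)
    have hpow2 : (t - s) ^ (lam + β) ≤ Δ ^ β * (t - s) ^ lam := by
      rcases eq_or_lt_of_le hts with h0 | h0
      · rw [← h0, Real.zero_rpow (by linarith), Real.zero_rpow hlam.ne', mul_zero]
      · rw [add_comm, Real.rpow_add h0]
        exact mul_le_mul_of_nonneg_right (Real.rpow_le_rpow hts htsΔ hβ0.le)
          (Real.rpow_nonneg hts _)
    have hsum : ‖∑ k, (g k t - g k s) • f k s‖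
        ≤ Fintype.card ι * (κ * P * (c + A) * (t - s) ^ lam) := by
      have : ∀ k ∈ Finset.univ, ‖(g k t - g k s) • f k s‖ ≤ κ * P * (c + A) * (t - s) ^ lam := by
        intro k _
        rw [norm_smul]
        have b1 := hg k s t hs hst ht
        have b2 := (hgrowth k).1 s ⟨hs, hst.trans ht⟩
        calc _ ≤ (G * (Δ ^ (β - lam) * (t - s) ^ lam)) * (P * ((c + A) * Δ ^ lam)) :=
              mul_le_mul (b1.trans (mul_le_mul_of_nonneg_left hpow1 hG)) b2 (norm_nonneg _)
                (by positivity)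
          _ = (G * (Δ ^ (β - lam) * Δ ^ lam)) * (P * (c + A) * (t - s) ^ lam) := by ring
          _ = (G * Δ ^ β) * (P * (c + A) * (t - s) ^ lam) := by
              rw [← Real.rpow_add hΔ0, sub_add_cancel]
          _ ≤ κ * (P * (c + A) * (t - s) ^ lam) := by gcongr
          _ = _ := by ring
      refine (norm_sum_le_of_le _ this).trans (le_of_eq ?_)
      simp [Finset.sum_const]
    have hrem : K * (Fintype.card ι * (P * (A + (c + A)) * G)) * (t - s) ^ (lam + β)
        ≤ K * Fintype.card ι * (2 * P * (c + A)) * κ * (t - s) ^ lam := by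
      calc _ ≤ K * (Fintype.card ι * (P * (2 * (c + A)) * G)) * (Δ ^ β * (t - s) ^ lam) := by
            gcongr
            linarith
        _ = K * Fintype.card ι * (2 * P * (c + A)) * (G * Δ ^ β) * (t - s) ^ lam := by ring
        _ ≤ _ := by gcongr
    have htri : ‖X t - X s‖ ≤ ‖X t - X s - ∑ k, (g k t - g k s) • f k s‖
        + ‖∑ k, (g k t - g k s) • f k s‖ := norm_le_norm_sub_add _ _
    calc ‖X t - X s‖ ≤ K * Fintype.card ι * (2 * P * (c + A)) * κ * (t - s) ^ lam
          + Fintype.card ι * (κ * P * (c + A) * (t - s) ^ lam) :=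
          htri.trans (add_le_add (hy.trans hrem) hsum)
      _ = (2 * (κ * Fintype.card ι * P * (1 + 2 * K))) * ((c + A) / 2 * (t - s) ^ lam) := by ring
      _ ≤ 1 * ((c + A) / 2 * (t - s) ^ lam) := by gcongr
      _ = _ := one_mul _
  -- Iterating A ↦ (c + A)/2 from the qualitative constant A₀ converges to c, so A₀ leaves no trace
  -- and no optimal Hölder constant has to be chosen.
  have iter : ∀ n : ℕ, HolderBound a b lam (c + A₀ * (1 / 2) ^ n) X := by
    intro n
    induction n with
    | zero => exact hX₀.mono_const (by simpa using hc0)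
    | succ n ih =>
      refine (step _ (by positivity) ih).mono_const (le_of_eq ?_)
      rw [pow_succ]; ring
  have hmain : HolderBound a b lam c X := by
    intro s t hs hst ht
    have lim : Filter.Tendsto (fun n : ℕ => (c + A₀ * (1 / 2 : ℝ) ^ n) * (t - s) ^ lam) Filter.atTop
        (nhds ((c + A₀ * 0) * (t - s) ^ lam)) :=
      (((tendsto_pow_atTop_nhds_zero_of_lt_one (by norm_num) (by norm_num)).const_mul _).const_add
        _).mul_const _
    rw [mul_zero, add_zero] at lim
    exact ge_of_tendsto' lim fun n => iter n s t hs hst ht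
  refine ⟨hmain, fun t ht => ?_⟩
  have := hsup c hc0 hmain t ht
  linarith

/-- Growth bound for linearly controlled Young integrals. -/
theorem IsYoung.growth_of_linearGrowth {T lam β P δ Δ κ G C μ A₀ : ℝ} {X : ℝ → E}
    {f : ι → ℝ → E} {g : ι → ℝ → ℝ} (hΔ0 : 0 < Δ)
    (hlam : 0 < lam) (hβ : lam ≤ β) (hν : 1 < lam + β) (hμ : 1 < μ) (hP : 0 ≤ P) (hδ : 0 ≤ δ)
    (hG : 0 ≤ G) (hκ : G * Δ ^ β ≤ κ)
    (hsmall : 2 * (κ * Fintype.card ι * P * (1 + 2 * youngConst (lam + β))) ≤ 1)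
    (hX : IsYoung 0 T C μ X f g) (hg : ∀ k, HolderBound 0 T β G (g k))
    (hA₀ : 0 ≤ A₀) (hX₀ : HolderBound 0 T lam A₀ X)
    (hf : ∀ a b, 0 ≤ a → a ≤ b → b ≤ T → b - a ≤ Δ → LinearGrowth a b lam P δ Δ X f) :
    ∀ t ∈ Icc 0 T, ‖X t‖ + δ ≤ 2 ^ (1 + t / Δ) * (‖X 0‖ + δ) := by
  have loc : ∀ a b, 0 ≤ a → a ≤ b → b ≤ T → b - a ≤ Δ → ‖X b‖ + δ ≤ 2 * (‖X a‖ + δ) :=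
    fun a b ha hab hb hd => (IsYoung.holderBound_of_linearGrowth hd hΔ0 hlam hβ hν hμ hP hδ hG
      hκ hsmall (hX.mono ha hb) (fun k => (hg k).mono ha hb) hA₀ (hX₀.mono ha hb)
      (hf a b ha hab hb hd)).2 b ⟨hab, le_rfl⟩
  have grid : ∀ n : ℕ, n * Δ ≤ T → ‖X (n * Δ)‖ + δ ≤ 2 ^ n * (‖X 0‖ + δ) := by
    intro n
    induction n with
    | zero => intro _; simp
    | succ n ih =>
      intro hn
      push_cast at hn ⊢
      have h1 := ih (by linarith)
      have h2 := loc (n * Δ) ((n + 1) * Δ) (by positivity) (by linarith) hn (by linarith)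
      rw [pow_succ]
      linarith
  intro t ht
  -- There are ⌊t/Δ⌋ full steps and one incomplete step; the latter accounts for the summand 1 in
  -- the exponent.
  have hfl : (⌊t / Δ⌋₊ : ℝ) ≤ t / Δ := Nat.floor_le (div_nonneg ht.1 hΔ0.le)
  have hfl2 : t / Δ < ⌊t / Δ⌋₊ + 1 := Nat.lt_floor_add_one _
  have e1 : (⌊t / Δ⌋₊ : ℝ) * Δ ≤ t := by rwa [le_div_iff₀ hΔ0] at hfl
  have e2 : t < (⌊t / Δ⌋₊ + 1) * Δ := by rwa [div_lt_iff₀ hΔ0] at hfl2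
  have h1 := grid _ (e1.trans ht.2)
  have h2 := loc _ t (by positivity) e1 ht.2 (by linarith)
  have h3 : (2 : ℝ) ^ (⌊t / Δ⌋₊) ≤ 2 ^ (t / Δ) := by
    rw [← Real.rpow_natCast]
    exact Real.rpow_le_rpow_of_exponent_le (by norm_num) hfl
  rw [Real.rpow_add (by norm_num), Real.rpow_one]
  have h4 : 0 ≤ ‖X 0‖ + δ := by positivity
  nlinarith [mul_le_mul_of_nonneg_right h3 h4]

end LinearGrowth

/-! ### Regular vector fields and Lipschitz dependence of Young solutions -/

section Fields

variable {E F : Type*} [NormedAddCommGroup E] [NormedSpace ℝ E]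
  [NormedAddCommGroup F] [NormedSpace ℝ F]

/-- Four point estimate for functions with Lipschitz derivative. -/
theorem norm_four_point_le {U : E → F} {DU : E → E →L[ℝ] F} {L₁ L₂ : ℝ}
    (hU : ∀ x, HasFDerivAt U (DU x) x) (h1 : ∀ x, ‖DU x‖ ≤ L₁)
    (h2 : ∀ x y, ‖DU x - DU y‖ ≤ L₂ * ‖x - y‖) (hL₂ : 0 ≤ L₂) (p q r s : E) :
    ‖U p - U q - (U r - U s)‖
      ≤ L₁ * ‖p - q - (r - s)‖ + L₂ * (‖p - r‖ + ‖q - s‖) * ‖r - s‖ := by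
  -- The segments from q to p and from s to r are run through with the same parameter θ. Their
  -- points then differ by a convex combination of p - r and q - s, which the Lipschitz bound on DU
  -- converts into the second term.
  have hd : ∀ θ : ℝ, HasDerivAt (fun θ : ℝ => U (q + θ • (p - q)) - U (s + θ • (r - s)))
      (DU (q + θ • (p - q)) (p - q) - DU (s + θ • (r - s)) (r - s)) θ := by
    intro θ
    have l : ∀ u v : E, HasDerivAt (fun θ : ℝ => u + θ • v) v θ := fun u v => by
      simpa using ((hasDerivAt_id θ).smul_const v).const_add u
    exact ((hU _).comp_hasDerivAt θ (l q (p - q))).sub ((hU _).comp_hasDerivAt θ (l s (r - s)))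
  have hL₁ : 0 ≤ L₁ := (norm_nonneg _).trans (h1 p)
  have bound : ∀ θ ∈ Ico (0 : ℝ) 1,
      ‖DU (q + θ • (p - q)) (p - q) - DU (s + θ • (r - s)) (r - s)‖
      ≤ L₁ * ‖p - q - (r - s)‖ + L₂ * (‖p - r‖ + ‖q - s‖) * ‖r - s‖ := by
    intro θ hθ
    have e : DU (q + θ • (p - q)) (p - q) - DU (s + θ • (r - s)) (r - s)
        = DU (q + θ • (p - q)) (p - q - (r - s))
          + (DU (q + θ • (p - q)) - DU (s + θ • (r - s))) (r - s) := by
      rw [map_sub (DU (q + θ • (p - q))) (p - q), sub_apply]; abel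
    rw [e]
    refine (norm_add_le _ _).trans (add_le_add ?_ ?_)
    · exact (ContinuousLinearMap.le_opNorm _ _).trans
        (mul_le_mul_of_nonneg_right (h1 _) (norm_nonneg _))
    · refine (ContinuousLinearMap.le_opNorm _ _).trans
        (mul_le_mul_of_nonneg_right ((h2 _ _).trans ?_) (norm_nonneg _))
      refine mul_le_mul_of_nonneg_left ?_ hL₂
      have e2 : q + θ • (p - q) - (s + θ • (r - s)) = θ • (p - r) + (1 - θ) • (q - s) := by module
      rw [e2]
      refine (norm_add_le _ _).trans (add_le_add ?_ ?_)
      · rw [norm_smul, Real.norm_of_nonneg hθ.1]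
        exact mul_le_of_le_one_left (norm_nonneg _) hθ.2.le
      · rw [norm_smul, Real.norm_of_nonneg (by linarith [hθ.2])]
        exact mul_le_of_le_one_left (norm_nonneg _) (by linarith [hθ.1])
  have := norm_image_sub_le_of_norm_deriv_le_segment_01'
    (f := fun θ : ℝ => U (q + θ • (p - q)) - U (s + θ • (r - s)))
    (fun θ _ => (hd θ).hasDerivWithinAt) bound
  simp only [one_smul, zero_smul, add_zero, add_sub_cancel] at this
  rwa [sub_sub_sub_comm (U p) (U q)]

end Fields

section Flow

variable {E ι : Type*} [NormedAddCommGroup E] [NormedSpace ℝ E]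

/-- The vector fields `U k` have derivatives `DU k` and are bounded, with bounded and Lipschitz
derivatives. -/
structure RegularFields (U : ι → E → E) (DU : ι → E → E →L[ℝ] E) (M L₁ L₂ : ℝ) : Prop where
  hasFDerivAt : ∀ k x, HasFDerivAt (U k) (DU k x) x
  norm_le : ∀ k x, ‖U k x‖ ≤ M
  norm_deriv_le : ∀ k x, ‖DU k x‖ ≤ L₁
  deriv_lipschitz : ∀ k x y, ‖DU k x - DU k y‖ ≤ L₂ * ‖x - y‖
  nonneg : 0 ≤ M ∧ 0 ≤ L₁ ∧ 0 ≤ L₂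

theorem RegularFields.lipschitz {U : ι → E → E} {DU : ι → E → E →L[ℝ] E} {M L₁ L₂ : ℝ}
    (hU : RegularFields U DU M L₁ L₂) (k : ι) (x y : E) : ‖U k x - U k y‖ ≤ L₁ * ‖x - y‖ :=
  convex_univ.norm_image_sub_le_of_norm_hasFDerivWithin_le
    (fun z _ => (hU.hasFDerivAt k z).hasFDerivWithinAt) (fun z _ => hU.norm_deriv_le k z)
    (mem_univ y) (mem_univ x)

theorem RegularFields.four_point {U : ι → E → E} {DU : ι → E → E →L[ℝ] E} {M L₁ L₂ : ℝ}
    (hU : RegularFields U DU M L₁ L₂) (k : ι) (p q r s : E) :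
    ‖U k p - U k q - (U k r - U k s)‖
      ≤ L₁ * ‖p - q - (r - s)‖ + L₂ * (‖p - r‖ + ‖q - s‖) * ‖r - s‖ :=
  norm_four_point_le (hU.hasFDerivAt k) (hU.norm_deriv_le k) (hU.deriv_lipschitz k) hU.nonneg.2.2
    p q r s

variable [Fintype ι]

theorem IsYoung.sub {a b C C' μ : ℝ} {X Y : ℝ → E} {f h : ι → ℝ → E} {g : ι → ℝ → ℝ}
    (hX : IsYoung a b C μ X f g) (hY : IsYoung a b C' μ Y h g) :
    IsYoung a b (C + C') μ (fun t => X t - Y t) (fun k t => f k t - h k t) g := by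
  intro s t h1 h2 h3
  have e : X t - Y t - (X s - Y s) - ∑ k, (g k t - g k s) • (f k s - h k s)
      = (X t - X s - ∑ k, (g k t - g k s) • f k s) - (Y t - Y s - ∑ k, (g k t - g k s) • h k s) := by
    simp only [smul_sub, Finset.sum_sub_distrib]; abel
  rw [e, add_mul]
  exact (norm_sub_le _ _).trans (add_le_add (hX s t h1 h2 h3) (hY s t h1 h2 h3))

theorem IsYoung.sub_const {a b C μ : ℝ} {X : ℝ → E} {f : ι → ℝ → E} {g : ι → ℝ → ℝ}
    (hX : IsYoung a b C μ X f g) (c : E) : IsYoung a b C μ (fun t => X t - c) f g := by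
  intro s t h1 h2 h3
  simpa using hX s t h1 h2 h3

/-- `φ` is a Hölder solution of `dφ = ∑ U k (φ) d(g k)` on `[0, T]`. -/
def IsYoungSolution (T lam μ : ℝ) (U : ι → E → E) (g : ι → ℝ → ℝ) (φ : ℝ → E) : Prop :=
  (∃ A, 0 ≤ A ∧ HolderBound 0 T lam A φ) ∧ ∃ C, IsYoung 0 T C μ φ (fun k s => U k (φ s)) g

variable {T lam β μ M L₁ L₂ P κ Δ G : ℝ} {U : ι → E → E} {DU : ι → E → E →L[ℝ] E} {g : ι → ℝ → ℝ}

/-- The standing assumptions: Hölder drivers and a step size adapted to them. -/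
structure StepSize (T lam β P κ Δ G : ℝ) (g : ι → ℝ → ℝ) : Prop where
  lam_pos : 0 < lam
  lam_le : lam ≤ β
  one_lt : 1 < lam + β
  P_nonneg : 0 ≤ P
  step_pos : 0 < Δ
  G_nonneg : 0 ≤ G
  le_kappa : G * Δ ^ β ≤ κ
  small : 2 * (κ * Fintype.card ι * P * (1 + 2 * youngConst (lam + β))) ≤ 1
  holder : ∀ k, HolderBound 0 T β G (g k)

/-- The fields are bounded, so φ - φ a has linear growth with inhomogeneity δ = 1. It starts from 0,
hence the bound depends neither on the solution nor on its starting point. -/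
theorem IsYoungSolution.holderBound {φ : ℝ → E} (hφ : IsYoungSolution T lam μ U g φ)
    (hμ : 1 < μ) (hU : RegularFields U DU M L₁ L₂) (hs : StepSize T lam β P κ Δ G g)
    (hM : M ≤ P) (hL : L₁ ≤ P) {a b : ℝ} (ha : 0 ≤ a) (hb : b ≤ T) (hab : b - a ≤ Δ) :
    HolderBound a b lam (Δ ^ (-lam)) φ := by
  obtain ⟨⟨A₀, hA₀, hH⟩, C, hC⟩ := hφ
  have hP := hs.P_nonneg
  have hΔ := hs.step_pos
  have key := IsYoung.holderBound_of_linearGrowth (δ := 1) hab hΔ hs.lam_pos hs.lam_le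
    hs.one_lt hμ hP zero_le_one hs.G_nonneg hs.le_kappa hs.small
    ((hC.mono ha hb).sub_const (φ a)) (fun k => (hs.holder k).mono ha hb) hA₀
    ((hH.mono ha hb).sub_const (φ a)) ?_
  · have := key.1
    simp only [sub_self, norm_zero, zero_add, one_mul] at this
    intro s t h1 h2 h3
    simpa using this s t h1 h2 h3
  · intro A S hA hXA hS k
    have hS0 : ∀ t ∈ Icc a b, 0 ≤ S := fun t ht => (norm_nonneg _).trans (hS t ht)
    constructor
    · intro t ht
      refine (hU.norm_le k _).trans (hM.trans ?_)
      exact le_mul_of_one_le_right hP (by linarith [hS0 t ht])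
    · intro s t h1 h2 h3
      have b1 := hXA s t h1 h2 h3
      rw [sub_sub_sub_cancel_right] at b1
      have hS0' := hS0 s ⟨h1, h2.trans h3⟩
      have hts : 0 ≤ (t - s) ^ lam := Real.rpow_nonneg (by linarith) _
      have hd : 0 ≤ (S + 1) * Δ ^ (-lam) := by positivity
      calc ‖U k (φ t) - U k (φ s)‖ ≤ P * (A * (t - s) ^ lam) :=
            (hU.lipschitz k _ _).trans (mul_le_mul hL b1 (norm_nonneg _) hP)
        _ = P * A * (t - s) ^ lam := by ring
        _ ≤ P * (A + (S + 1) * Δ ^ (-lam)) * (t - s) ^ lam := by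
            gcongr
            linarith

/-- The four point estimate at φ t, ψ t, φ s, ψ s. Its first term is the increment of φ - ψ; its
second is the size of φ - ψ times the local Hölder bounds Δ^(-lam) of the two solutions, whence the
requirement L₁ + 2L₂ ≤ P. -/
theorem IsYoungSolution.linearGrowth_sub {φ ψ : ℝ → E} (hφ : IsYoungSolution T lam μ U g φ)
    (hψ : IsYoungSolution T lam μ U g ψ)
    (hμ : 1 < μ) (hU : RegularFields U DU M L₁ L₂) (hs : StepSize T lam β P κ Δ G g)
    (hM : M ≤ P) (hL : L₁ + 2 * L₂ ≤ P) {a b : ℝ} (ha : 0 ≤ a) (hb : b ≤ T)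
    (hab : b - a ≤ Δ) :
    LinearGrowth a b lam P 0 Δ (fun t => φ t - ψ t) (fun k t => U k (φ t) - U k (ψ t)) := by
  obtain ⟨hM0, hL₁, hL₂⟩ := hU.nonneg
  have hΔ := hs.step_pos
  have hP := hs.P_nonneg
  have h1φ := hφ.holderBound hμ hU hs hM (by linarith) ha hb hab
  have h1ψ := hψ.holderBound hμ hU hs hM (by linarith) ha hb hab
  intro A S hA hXA hS k
  simp only [add_zero]
  constructor
  · intro t ht
    exact (hU.lipschitz k _ _).trans (mul_le_mul (by linarith) (hS t ht) (norm_nonneg _) hP)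
  · intro s t h1 h2 h3
    have hts : 0 ≤ (t - s) ^ lam := Real.rpow_nonneg (by linarith) _
    have hSs := hS s ⟨h1, h2.trans h3⟩
    have hS0 : 0 ≤ S := (norm_nonneg _).trans hSs
    have hd : 0 ≤ Δ ^ (-lam) := by positivity
    calc _ ≤ _ := hU.four_point k (φ t) (ψ t) (φ s) (ψ s)
      _ ≤ L₁ * (A * (t - s) ^ lam)
          + L₂ * (Δ ^ (-lam) * (t - s) ^ lam + Δ ^ (-lam) * (t - s) ^ lam) * S := by
          gcongr
          · exact hXA s t h1 h2 h3
          · exact h1φ s t h1 h2 h3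
          · exact h1ψ s t h1 h2 h3
      _ = (L₁ * A + (2 * L₂) * (S * Δ ^ (-lam))) * (t - s) ^ lam := by ring
      _ ≤ (P * A + P * (S * Δ ^ (-lam))) * (t - s) ^ lam := by
          gcongr <;> linarith
      _ = _ := by ring

/-- Solutions depend on the starting point in a Lipschitz way. -/
theorem IsYoungSolution.norm_sub_le {φ ψ : ℝ → E} (hφ : IsYoungSolution T lam μ U g φ)
    (hψ : IsYoungSolution T lam μ U g ψ)
    (hμ : 1 < μ) (hU : RegularFields U DU M L₁ L₂) (hs : StepSize T lam β P κ Δ G g)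
    (hM : M ≤ P) (hL : L₁ + 2 * L₂ ≤ P) {t : ℝ} (ht : t ∈ Icc 0 T) :
    ‖φ t - ψ t‖ ≤ 2 ^ (1 + t / Δ) * ‖φ 0 - ψ 0‖ := by
  obtain ⟨A, hA, hHφ⟩ := hφ.1
  obtain ⟨B, hB, hHψ⟩ := hψ.1
  obtain ⟨C, hC⟩ := hφ.2
  obtain ⟨C', hC'⟩ := hψ.2
  have := IsYoung.growth_of_linearGrowth (δ := 0) hs.step_pos hs.lam_pos hs.lam_le hs.one_lt hμ
    hs.P_nonneg le_rfl hs.G_nonneg hs.le_kappa hs.small (hC.sub hC') hs.holder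
    (add_nonneg hA hB) (hHφ.sub hHψ)
    (fun a b ha _ hb hd => hφ.linearGrowth_sub hψ hμ hU hs hM hL ha hb hd) t ht
  simpa using this

theorem IsYoungSolution.holderBound_sub {φ ψ : ℝ → E} (hφ : IsYoungSolution T lam μ U g φ)
    (hψ : IsYoungSolution T lam μ U g ψ)
    (hμ : 1 < μ) (hU : RegularFields U DU M L₁ L₂) (hs : StepSize T lam β P κ Δ G g)
    (hM : M ≤ P) (hL : L₁ + 2 * L₂ ≤ P) {a b : ℝ} (ha : 0 ≤ a) (hb : b ≤ T)
    (hab : b - a ≤ Δ) :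
    HolderBound a b lam (‖φ a - ψ a‖ * Δ ^ (-lam)) (fun t => φ t - ψ t) := by
  obtain ⟨A, hA, hHφ⟩ := hφ.1
  obtain ⟨B, hB, hHψ⟩ := hψ.1
  obtain ⟨C, hC⟩ := hφ.2
  obtain ⟨C', hC'⟩ := hψ.2
  have := (IsYoung.holderBound_of_linearGrowth (δ := 0) hab hs.step_pos hs.lam_pos hs.lam_le
    hs.one_lt hμ hs.P_nonneg le_rfl hs.G_nonneg hs.le_kappa hs.small
    ((hC.sub hC').mono ha hb) (fun k => (hs.holder k).mono ha hb)
    (add_nonneg hA hB) ((hHφ.sub hHψ).mono ha hb)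
    (hφ.linearGrowth_sub hψ hμ hU hs hM hL ha hb hab)).1
  simpa using this

end Flow

/-! ### Differentiability from almost additivity -/

/-- An almost additive function with superlinear defect is differentiable at the origin. -/
theorem exists_hasFDerivAt_zero_of_almost_additive {E F : Type*} [NormedAddCommGroup E]
    [NormedSpace ℝ E] [NormedAddCommGroup F] [NormedSpace ℝ F] [CompleteSpace F] {D : E → F}
    {L C ν : ℝ} (hν : 1 < ν) (hC : 0 ≤ C) (hL : ∀ h, ‖D h‖ ≤ L * ‖h‖)
    (hadd : ∀ ρ ≤ 1, ∀ h k, ‖h‖ ≤ ρ → ‖k‖ ≤ ρ → ‖D (h + k) - D h - D k‖ ≤ C * ρ ^ ν) :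
    ∃ A : E →L[ℝ] F, HasFDerivAt D A 0 := by
  have hq1 : (2 : ℝ) ^ (1 - ν) < 1 := Real.rpow_lt_one_of_one_lt_of_neg (by norm_num) (by linarith)
  have hq0 : (0 : ℝ) < 2 ^ (1 - ν) := by positivity
  set q : ℝ := 2 ^ (1 - ν) with hq
  -- rescaled functions
  set S : ℕ → E → F := fun n h => (2 : ℝ) ^ n • D (((2 : ℝ) ^ n)⁻¹ • h) with hS
  have hpow : ∀ n : ℕ, (2 : ℝ) ^ n * (((2 : ℝ) ^ n)⁻¹) ^ ν = q ^ n := by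
    intro n
    rw [hq, ← Real.rpow_natCast, ← Real.rpow_natCast, ← Real.rpow_mul (by norm_num),
      ← Real.rpow_neg (by norm_num), ← Real.rpow_mul (by norm_num), ← Real.rpow_add (by norm_num)]
    congr 1; ring
  -- At scale 2^(-n) the defect is multiplied by 2^n 2^(-nν) = q^n; the restriction ρ ≤ 2^n keeps
  -- the rescaled vectors in the unit ball.
  have hscale : ∀ (n : ℕ) (ρ : ℝ), ρ ≤ (2 : ℝ) ^ n → ∀ h k, ‖h‖ ≤ ρ → ‖k‖ ≤ ρ →
      ‖S n (h + k) - S n h - S n k‖ ≤ C * q ^ n * ρ ^ ν := by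
    intro n ρ hρ h k hh hk
    have hρ0 : 0 ≤ ρ := (norm_nonneg _).trans hh
    have h2 : (0 : ℝ) < 2 ^ n := by positivity
    have e : S n (h + k) - S n h - S n k = (2 : ℝ) ^ n • (D (((2 : ℝ) ^ n)⁻¹ • h
        + ((2 : ℝ) ^ n)⁻¹ • k) - D (((2 : ℝ) ^ n)⁻¹ • h) - D (((2 : ℝ) ^ n)⁻¹ • k)) := by
      simp only [hS, smul_sub, smul_add]
    rw [e, norm_smul, Real.norm_of_nonneg h2.le]
    have nn : ∀ v : E, ‖v‖ ≤ ρ → ‖((2 : ℝ) ^ n)⁻¹ • v‖ ≤ ((2 : ℝ) ^ n)⁻¹ * ρ := by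
      intro v hv
      rw [norm_smul, Real.norm_of_nonneg (inv_pos.2 h2).le]
      exact mul_le_mul_of_nonneg_left hv (inv_pos.2 h2).le
    have := hadd (((2 : ℝ) ^ n)⁻¹ * ρ) (by rwa [inv_mul_le_iff₀ h2, mul_one]) _ _ (nn h hh) (nn k hk)
    rw [Real.mul_rpow (inv_pos.2 h2).le hρ0] at this
    calc _ ≤ (2 : ℝ) ^ n * (C * ((((2 : ℝ) ^ n)⁻¹) ^ ν * ρ ^ ν)) := by gcongr
      _ = C * ((2 : ℝ) ^ n * (((2 : ℝ) ^ n)⁻¹) ^ ν) * ρ ^ ν := by ring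
      _ = _ := by rw [hpow]
  -- The defect at the pair (h/2, h/2) compares consecutive rescalings, so `S n h` is eventually a
  -- geometric Cauchy sequence.
  have hstep : ∀ (n : ℕ) (h : E), ‖h‖ ≤ (2 : ℝ) ^ n →
      ‖S (n + 1) h - S n h‖ ≤ C * ‖h‖ ^ ν * q ^ n := by
    intro n h hh
    have h2 : (0 : ℝ) < 2 ^ n := by positivity
    have hh' : ‖(2 : ℝ)⁻¹ • h‖ ≤ ‖h‖ := by
      rw [norm_smul]; norm_num; linarith [norm_nonneg h]
    have := hscale n ‖h‖ hh _ _ hh' hh'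
    rw [← add_smul] at this
    norm_num at this
    have e : S (n + 1) h - S n h = -(S n h - S n ((1 / 2 : ℝ) • h) - S n ((1 / 2 : ℝ) • h)) := by
      have e1 : S (n + 1) h = (2 : ℝ) • S n ((1 / 2 : ℝ) • h) := by
        simp only [hS, smul_smul, pow_succ]
        congr 1
        · ring
        · congr 2; field_simp
      rw [e1, two_smul]; abel
    rw [e, norm_neg]
    calc _ ≤ _ := this
      _ = _ := by ring
  -- the limit
  have hsmall : ∀ h : E, ∃ N : ℕ, ∀ n ≥ N, ‖h‖ ≤ (2 : ℝ) ^ n := by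
    intro h
    obtain ⟨N, hN⟩ := pow_unbounded_of_one_lt ‖h‖ (by norm_num : (1 : ℝ) < 2)
    exact ⟨N, fun n hn => hN.le.trans (pow_le_pow_right₀ (by norm_num) hn)⟩
  have hlim : ∀ h : E, ∃ a, Filter.Tendsto (fun n => S n h) Filter.atTop (nhds a) := by
    intro h
    obtain ⟨N, hN⟩ := hsmall h
    have hc : CauchySeq fun n => S (n + N) h := by
      refine cauchySeq_of_le_geometric q (C * ‖h‖ ^ ν * q ^ N) hq1 fun n => ?_
      rw [dist_comm, dist_eq_norm, show n + 1 + N = n + N + 1 by ring]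
      refine (hstep (n + N) h (hN _ (by omega))).trans (le_of_eq ?_)
      rw [pow_add]; ring
    obtain ⟨a, ha⟩ := cauchySeq_tendsto_of_complete hc
    exact ⟨a, (Filter.tendsto_add_atTop_iff_nat N).1 ha⟩
  choose A hA using hlim
  have hAadd : ∀ h k, A (h + k) = A h + A k := by
    intro h k
    have l1 : Filter.Tendsto (fun n => S n (h + k) - S n h - S n k) Filter.atTop
        (nhds (A (h + k) - A h - A k)) := ((hA _).sub (hA _)).sub (hA _)
    obtain ⟨N, hN⟩ := pow_unbounded_of_one_lt (max ‖h‖ ‖k‖) (by norm_num : (1 : ℝ) < 2)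
    have l2 : Filter.Tendsto (fun n => S n (h + k) - S n h - S n k) Filter.atTop (nhds 0) := by
      refine squeeze_zero_norm' (a := fun n => C * q ^ n * (max ‖h‖ ‖k‖) ^ ν) ?_ ?_
      · filter_upwards [Filter.eventually_ge_atTop N] with n hn
        exact hscale n _ (hN.le.trans (pow_le_pow_right₀ (by norm_num) hn)) _ _ (le_max_left _ _)
          (le_max_right _ _)
      · have := ((tendsto_pow_atTop_nhds_zero_of_lt_one hq0.le hq1).const_mul C).mul_const
          ((max ‖h‖ ‖k‖) ^ ν)
        simpa using this
    have := tendsto_nhds_unique l1 l2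
    rw [sub_sub, sub_eq_zero] at this
    exact this
  have hAbd : ∀ h, ‖A h‖ ≤ L * ‖h‖ := by
    intro h
    refine le_of_tendsto' (hA h).norm fun n => ?_
    have h2 : (0 : ℝ) < 2 ^ n := by positivity
    simp only [hS]
    rw [norm_smul, Real.norm_of_nonneg h2.le]
    have := hL (((2 : ℝ) ^ n)⁻¹ • h)
    rw [norm_smul, Real.norm_of_nonneg (inv_pos.2 h2).le] at this
    calc _ ≤ (2 : ℝ) ^ n * (L * (((2 : ℝ) ^ n)⁻¹ * ‖h‖)) := by gcongr
      _ = L * ‖h‖ := by field_simp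
  -- The limit is additive and bounded, hence continuous, hence real linear.
  let A₀ : E →+ F := AddMonoidHom.mk' A hAadd
  have hcont : Continuous A₀ :=
    (AddMonoidHomClass.lipschitz_of_bound A₀ L hAbd).continuous
  refine ⟨A₀.toRealLinearMap hcont, ?_⟩
  have happ : ∀ h, (A₀.toRealLinearMap hcont) h = A h := fun h => rfl
  have hD0 : D 0 = 0 := by
    have := hL 0
    simpa using this
  -- In the unit ball the geometric series may be summed from n = 0, where `S 0` is D itself.
  have hmain : ∀ h, ‖h‖ ≤ 1 → ‖D h - A h‖ ≤ C / (1 - q) * ‖h‖ ^ ν := by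
    intro h hh
    have hb : ∀ n, dist (S n h) (S (n + 1) h) ≤ C * ‖h‖ ^ ν * q ^ n := by
      intro n
      rw [dist_comm, dist_eq_norm]
      exact hstep n h (hh.trans (one_le_pow₀ (by norm_num)))
    have := dist_le_of_le_geometric_of_tendsto₀ q _ hq1 hb (hA h)
    rw [dist_eq_norm] at this
    simp only [hS, pow_zero, inv_one, one_smul] at this
    refine this.trans (le_of_eq ?_)
    ring
  rw [hasFDerivAt_iff_isLittleO_nhds_zero]
  simp only [zero_add, hD0, sub_zero, happ]
  rw [Asymptotics.isLittleO_iff]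
  intro c hc
  have hK : 0 ≤ C / (1 - q) := div_nonneg hC (by linarith)
  have ht : Filter.Tendsto (fun h : E => C / (1 - q) * ‖h‖ ^ (ν - 1)) (nhds 0) (nhds 0) := by
    have : ContinuousAt (fun h : E => C / (1 - q) * ‖h‖ ^ (ν - 1)) 0 :=
      continuousAt_const.mul (continuous_norm.continuousAt.rpow_const (Or.inr (by linarith)))
    have h := this.tendsto
    rwa [norm_zero, Real.zero_rpow (by linarith), mul_zero] at h
  filter_upwards [ht.eventually (gt_mem_nhds hc), Metric.closedBall_mem_nhds (0 : E) one_pos]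
    with h h1 h2
  have h3 : ‖h‖ ≤ 1 := by simpa using h2
  refine (hmain h h3).trans ?_
  rcases eq_or_lt_of_le (norm_nonneg h) with h0 | h0
  · rw [← h0, Real.zero_rpow (by linarith)]; simp
  · calc C / (1 - q) * ‖h‖ ^ ν = C / (1 - q) * ‖h‖ ^ (ν - 1) * ‖h‖ := by
          rw [mul_assoc, ← Real.rpow_add_one h0.ne', sub_add_cancel]
      _ ≤ c * ‖h‖ := by gcongr

/-- Interpolation y = y^η y^(1-η). It trades a little time regularity for a power of ρ above 1;
superlinearity in ρ and Hölder continuity in time are needed simultaneously. -/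
theorem le_rpow_mul_rpow_of_le {y C ρ τ lam η : ℝ} (hy : 0 ≤ y) (hC : 0 ≤ C) (hρ : 0 ≤ ρ)
    (hτ : 0 ≤ τ) (hη0 : 0 ≤ η) (hη1 : η ≤ 1) (h1 : y ≤ C * ρ ^ 2)
    (h2 : y ≤ C * ρ * τ ^ lam) : y ≤ C * ρ ^ (1 + η) * τ ^ (lam * (1 - η)) := by
  have hη' : 0 ≤ 1 - η := by linarith
  have hτl := Real.rpow_nonneg hτ lam
  have split : ∀ z : ℝ, 0 ≤ z → z = z ^ η * z ^ (1 - η) := fun z hz => by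
    rw [← Real.rpow_add_of_nonneg hz hη0 hη', add_sub_cancel, Real.rpow_one]
  calc y = y ^ η * y ^ (1 - η) := split y hy
    _ ≤ (C * ρ ^ 2) ^ η * (C * ρ * τ ^ lam) ^ (1 - η) :=
        mul_le_mul (Real.rpow_le_rpow hy h1 hη0) (Real.rpow_le_rpow hy h2 hη')
          (Real.rpow_nonneg hy _) (by positivity)
    _ = (C ^ η * C ^ (1 - η)) * ((ρ ^ 2) ^ η * ρ ^ (1 - η)) * (τ ^ lam) ^ (1 - η) := by
        rw [Real.mul_rpow hC (by positivity), Real.mul_rpow (by positivity) hτl,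
          Real.mul_rpow hC hρ]
        ring
    _ = C * ρ ^ (1 + η) * τ ^ (lam * (1 - η)) := by
        rw [← split C hC, ← Real.rpow_mul hτ, ← Real.rpow_natCast, ← Real.rpow_mul hρ,
          ← Real.rpow_add_of_nonneg hρ (by positivity) hη']
        congr 3
        push_cast; ring

/-! ### Second differences and differentiability of the flow -/

section Flow

variable {E ι : Type*} [NormedAddCommGroup E] [NormedSpace ℝ E]

/-- The fourth vertex p' = q + (r - s) of the parallelogram splits the second difference of U into U
p - U p', controlled linearly by p - p', and a second difference Q over an exact parallelogram. Q is
O(ρ²) in size and O(ρ τ^lam) in its increments over time τ; interpolation makes it an inhomogeneity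
of size ρ^(1+η) at Hölder order lam(1-η). -/
theorem RegularFields.linearGrowth_second_difference {M L₁ L₂ : ℝ} {U : ι → E → E}
    {DU : ι → E → E →L[ℝ] E} (hU : RegularFields U DU M L₁ L₂) {a b lam η H c ρ Δ : ℝ}
    {p q r s : ℝ → E} (hab : b - a ≤ 1) (hlam : 0 < lam) (hη0 : 0 ≤ η) (hη1 : η < 1)
    (hH : 0 ≤ H) (hc : 0 ≤ c) (hρ0 : 0 ≤ ρ) (hρ1 : ρ ≤ 1) (hΔ0 : 0 < Δ) (hΔ1 : Δ ≤ 1)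
    (hp : HolderBound a b lam H p) (hq : HolderBound a b lam H q)
    (hr : HolderBound a b lam H r) (hs : HolderBound a b lam H s)
    (hqs : ∀ t ∈ Icc a b, ‖q t - s t‖ ≤ c * ρ) (hrs : ∀ t ∈ Icc a b, ‖r t - s t‖ ≤ c * ρ)
    (hrsH : HolderBound a b lam (c * ρ * H) (fun t => r t - s t)) :
    LinearGrowth a b (lam * (1 - η))
      (L₁ + 4 * L₂ * H + (4 * L₂ * c ^ 2 + 2 * L₁ * c * H + 6 * L₂ * H * c)) (ρ ^ (1 + η)) Δ
      (fun t => p t - q t - (r t - s t))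
      (fun k t => U k (p t) - U k (q t) - (U k (r t) - U k (s t))) := by
  obtain ⟨-, hL₁, hL₂⟩ := hU.nonneg
  set C₀ := 4 * L₂ * c ^ 2 + 2 * L₁ * c * H + 6 * L₂ * H * c with hC₀
  have hC₀0 : 0 ≤ C₀ := by positivity
  have hδ0 : 0 ≤ ρ ^ (1 + η) := Real.rpow_nonneg hρ0 _
  have hρδ : ρ ^ 2 ≤ ρ ^ (1 + η) := by
    rw [← Real.rpow_two]
    exact Real.rpow_le_rpow_of_exponent_ge' hρ0 hρ1 (by linarith) (by linarith)
  set p' : ℝ → E := fun t => q t + (r t - s t) with hp'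
  have hp'H : HolderBound a b lam (3 * H) p' :=
    (hq.add (hr.sub hs)).mono_const (by linarith)
  have hpp' : ∀ t, p t - p' t = p t - q t - (r t - s t) := fun t => by simp only [hp']; abel
  have hp'q : ∀ t, p' t - q t = r t - s t := fun t => by simp only [hp']; abel
  have hp'r : ∀ t, p' t - r t = q t - s t := fun t => by simp only [hp']; abel
  intro A S hA hXA hS k
  set Q : ℝ → E := fun t => U k (p' t) - U k (q t) - (U k (r t) - U k (s t)) with hQ
  have hsplit : ∀ t, U k (p t) - U k (q t) - (U k (r t) - U k (s t))
      = (U k (p t) - U k (p' t)) + Q t := fun t => by simp only [hQ]; abel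
  -- Since p' - q = r - s, the first order term of the four point estimate vanishes and only a
  -- product of two small differences remains.
  have hQsup : ∀ t ∈ Icc a b, ‖Q t‖ ≤ 2 * L₂ * c ^ 2 * ρ ^ 2 := by
    intro t ht
    have h4 := hU.four_point k (p' t) (q t) (r t) (s t)
    rw [hp'q, sub_self, norm_zero, mul_zero, zero_add, hp'r] at h4
    calc ‖Q t‖ ≤ _ := h4
      _ ≤ L₂ * (c * ρ + c * ρ) * (c * ρ) := by
          gcongr
          · exact hqs t ht
          · exact hqs t ht
          · exact hrs t ht
      _ = _ := by ring
  have hQH : ∀ u t, a ≤ u → u ≤ t → t ≤ b →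
      ‖Q t - Q u‖ ≤ C₀ * ρ ^ (1 + η) * (t - u) ^ (lam * (1 - η)) := by
    intro u t h1 h2 h3
    have hu : u ∈ Icc a b := ⟨h1, h2.trans h3⟩
    have ht : t ∈ Icc a b := ⟨h1.trans h2, h3⟩
    have hτ : 0 ≤ t - u := by linarith
    refine le_rpow_mul_rpow_of_le (norm_nonneg _) hC₀0 hρ0 hτ hη0 hη1.le ?_ ?_
    · have b1 := hQsup t ht
      have b2 := hQsup u hu
      have b3 := norm_sub_le (Q t) (Q u)
      have b4 : 0 ≤ (2 * L₁ * c * H + 6 * L₂ * H * c) * ρ ^ 2 := by positivity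
      rw [hC₀]
      nlinarith
    -- Here the four point estimate compares times t and u along the pairs (p', q) and (r, s). Both
    -- pairs have difference r - s, which supplies one factor ρ in every term.
    · have e : Q t - Q u = (U k (p' t) - U k (q t) - (U k (p' u) - U k (q u)))
          - (U k (r t) - U k (s t) - (U k (r u) - U k (s u))) := by simp only [hQ]; abel
      have f1 := hU.four_point k (p' t) (q t) (p' u) (q u)
      have f2 := hU.four_point k (r t) (s t) (r u) (s u)
      rw [hp'q, hp'q] at f1
      have hx : 0 ≤ (t - u) ^ lam := Real.rpow_nonneg hτ _
      have g1 : ‖r t - s t - (r u - s u)‖ ≤ c * ρ * H * (t - u) ^ lam := hrsH u t h1 h2 h3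
      have g2 := hp'H u t h1 h2 h3
      have g3 := hq u t h1 h2 h3
      have g4 := hr u t h1 h2 h3
      have g5 := hs u t h1 h2 h3
      have g6 := hrs u hu
      rw [e]
      calc _ ≤ _ := norm_sub_le _ _
        _ ≤ (L₁ * (c * ρ * H * (t - u) ^ lam)
              + L₂ * (3 * H * (t - u) ^ lam + H * (t - u) ^ lam) * (c * ρ))
            + (L₁ * (c * ρ * H * (t - u) ^ lam)
              + L₂ * (H * (t - u) ^ lam + H * (t - u) ^ lam) * (c * ρ)) := by
            refine add_le_add (f1.trans ?_) (f2.trans ?_) <;> gcongr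
        _ = (2 * L₁ * c * H + 6 * L₂ * H * c) * ρ * (t - u) ^ lam := by ring
        _ ≤ C₀ * ρ * (t - u) ^ lam := by
            gcongr
            rw [hC₀]
            have : 0 ≤ 4 * L₂ * c ^ 2 := by positivity
            linarith
  constructor
  · intro t ht
    have hSt := hS t ht
    have hS0 : 0 ≤ S := (norm_nonneg _).trans hSt
    simp only
    rw [hsplit]
    have b1 := hU.lipschitz k (p t) (p' t)
    rw [hpp'] at b1
    calc _ ≤ ‖U k (p t) - U k (p' t)‖ + ‖Q t‖ := norm_add_le _ _
      _ ≤ L₁ * S + 2 * L₂ * c ^ 2 * ρ ^ 2 := by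
          refine add_le_add (b1.trans ?_) (hQsup t ht)
          gcongr
      _ ≤ L₁ * S + C₀ * ρ ^ (1 + η) := by
          gcongr
          rw [hC₀]
          have : 0 ≤ 2 * L₂ * c ^ 2 + 2 * L₁ * c * H + 6 * L₂ * H * c := by positivity
          linarith
      _ ≤ _ := by
          have b3 : 0 ≤ L₁ * ρ ^ (1 + η) + C₀ * S + 4 * L₂ * H * (S + ρ ^ (1 + η)) := by positivity
          linarith
  · intro u t h1 h2 h3
    have hu : u ∈ Icc a b := ⟨h1, h2.trans h3⟩
    have hτ : 0 ≤ t - u := by linarith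
    have hSu := hS u hu
    have hS0 : 0 ≤ S := (norm_nonneg _).trans hSu
    have hlam' : 0 < lam * (1 - η) := mul_pos hlam (by linarith)
    have hpow : (t - u) ^ lam ≤ (t - u) ^ (lam * (1 - η)) :=
      Real.rpow_le_rpow_of_exponent_ge' hτ (by linarith) hlam'.le (by nlinarith)
    -- As Δ ≤ 1, this factor can be inserted for free to reach the form demanded by `LinearGrowth`.
    have hΔp : 1 ≤ Δ ^ (-(lam * (1 - η))) :=
      Real.one_le_rpow_of_pos_of_le_one_of_nonpos hΔ0 hΔ1 (by linarith)
    have e : U k (p t) - U k (q t) - (U k (r t) - U k (s t))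
        - (U k (p u) - U k (q u) - (U k (r u) - U k (s u)))
        = (U k (p t) - U k (p' t) - (U k (p u) - U k (p' u))) + (Q t - Q u) := by
      rw [hsplit, hsplit]; abel
    have f1 := hU.four_point k (p t) (p' t) (p u) (p' u)
    rw [hpp', hpp'] at f1
    have g1 := hXA u t h1 h2 h3
    have g2 := hp u t h1 h2 h3
    have g3 := hp'H u t h1 h2 h3
    have g4 := hQH u t h1 h2 h3
    simp only
    rw [e]
    set x := (t - u) ^ (lam * (1 - η)) with hx
    have hx0 : 0 ≤ x := Real.rpow_nonneg hτ _
    set y := (t - u) ^ lam with hy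
    have hy0 : 0 ≤ y := Real.rpow_nonneg hτ _
    set δ := ρ ^ (1 + η) with hδ
    calc _ ≤ _ := norm_add_le _ _
      _ ≤ (L₁ * (A * x) + L₂ * (H * y + 3 * H * y) * S) + C₀ * δ * x := by
          refine add_le_add (f1.trans ?_) g4
          gcongr
      _ = L₁ * (A * x) + 4 * L₂ * H * S * y + C₀ * δ * x := by ring
      _ ≤ L₁ * (A * x) + 4 * L₂ * H * S * x + C₀ * δ * x := by gcongr
      _ = (L₁ * A + 4 * L₂ * H * (S * 1) + C₀ * (δ * 1)) * x := by ring
      _ ≤ (L₁ * A + 4 * L₂ * H * (S * Δ ^ (-(lam * (1 - η))))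
            + C₀ * (δ * Δ ^ (-(lam * (1 - η))))) * x := by gcongr
      _ ≤ _ := by
          refine mul_le_mul_of_nonneg_right ?_ hx0
          set z := Δ ^ (-(lam * (1 - η))) with hz
          have hz0 : 0 ≤ z := by linarith
          have : 0 ≤ L₁ * ((S + δ) * z) + 4 * L₂ * H * (A + δ * z) + C₀ * (A + S * z) := by
            positivity
          linarith

variable [Fintype ι] {T lam β μ M L₁ L₂ P κ Δ G : ℝ} {U : ι → E → E}
  {DU : ι → E → E →L[ℝ] E} {g : ι → ℝ → ℝ}

theorem exists_small_step {lam β m P G : ℝ} (hβ : 0 < β)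
    (hν : 1 < lam + β) (hm : 0 ≤ m) (hP : 0 ≤ P) (Δ₀ : ℝ) (hΔ₀ : 0 < Δ₀) :
    ∃ Δ κ, 0 < Δ ∧ Δ ≤ Δ₀ ∧ G * Δ ^ β ≤ κ ∧
      2 * (κ * m * P * (1 + 2 * youngConst (lam + β))) ≤ 1 := by
  have hK := youngConst_nonneg hν
  set R := 2 * (m * P * (1 + 2 * youngConst (lam + β))) with hR
  have hR0 : 0 ≤ R := by positivity
  have hlim : Filter.Tendsto (fun Δ : ℝ => G * Δ ^ β) (nhdsWithin 0 (Ioi 0)) (nhds 0) := by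
    have : ContinuousAt (fun Δ : ℝ => G * Δ ^ β) 0 :=
      continuousAt_const.mul (continuousAt_id.rpow_const (Or.inr hβ.le))
    have h := this.tendsto
    simp only [Real.zero_rpow hβ.ne', mul_zero] at h
    exact h.mono_left nhdsWithin_le_nhds
  have hpos : 0 < 1 / (R + 1) := by positivity
  obtain ⟨Δ, h1, h2⟩ := ((hlim.eventually (gt_mem_nhds hpos)).and
    (Ioc_mem_nhdsGT hΔ₀)).exists
  refine ⟨Δ, 1 / (R + 1), h2.1, h2.2, h1.le, ?_⟩
  calc 2 * (1 / (R + 1) * m * P * (1 + 2 * youngConst (lam + β))) = R / (R + 1) := by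
        rw [hR]; ring
    _ ≤ 1 := by rw [div_le_one (by positivity)]; linarith

/-- Flows of Young equations along fields with Lipschitz derivatives are differentiable. -/
theorem differentiableAt_flow [CompleteSpace E] {φ : E → ℝ → E}
    (hφ : ∀ x, IsYoungSolution T lam μ U g (φ x)) (hφ0 : ∀ x, φ x 0 = x)
    (hμ : 1 < μ) (hU : RegularFields U DU M L₁ L₂) (hs : StepSize T lam β P κ Δ G g)
    (hM : M ≤ P) (hL : L₁ + 2 * L₂ ≤ P) (hlam1 : lam ≤ 1) (hβ1 : β < 1)
    {t : ℝ} (ht : t ∈ Icc 0 T) (x : E) :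
    DifferentiableAt ℝ (fun x => φ x t) x := by
  have hlam := hs.lam_pos
  have hlamβ := hs.lam_le
  have hν := hs.one_lt
  have hΔ := hs.step_pos
  have hT : 0 ≤ T := ht.1.trans ht.2
  obtain ⟨hM0, hL₁, hL₂⟩ := hU.nonneg
  -- Half of the excess over 1. The loss lam η ≤ η in the exponent then still leaves lam(1-η) + β >
  -- 1.
  set η := (lam + β - 1) / 2 with hη
  have hη0 : 0 < η := by rw [hη]; linarith
  have hη1 : η < 1 := by rw [hη]; linarith
  set lam' := lam * (1 - η) with hlam'
  have hlam'0 : 0 < lam' := mul_pos hlam (by linarith)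
  have hlam'le : lam' ≤ lam := by rw [hlam']; nlinarith
  have hν' : 1 < lam' + β := by rw [hlam']; nlinarith
  set c : ℝ := 2 ^ (1 + T / Δ) with hc
  have hc0 : 0 < c := by positivity
  set H : ℝ := Δ ^ (-lam) with hH
  have hH0 : 0 ≤ H := by positivity
  set P' := L₁ + 4 * L₂ * H + (4 * L₂ * c ^ 2 + 2 * L₁ * c * H + 6 * L₂ * H * c) with hP'
  have hP'0 : 0 ≤ P' := by positivity
  -- The growth constant P' depends on Δ through H and c, so a finer step is needed for the second
  -- difference. It is at most Δ, to keep the local bounds for solutions, and at most 1, to compare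
  -- powers of different exponents.
  obtain ⟨Δ', κ', hΔ'0, hΔ'le, hκ', hsmall'⟩ := exists_small_step (lam := lam') (β := β)
    (m := Fintype.card ι) (P := P') (G := G) (by linarith) hν' (by positivity) hP'0
    (min Δ 1) (lt_min hΔ one_pos)
  have hclose : ∀ y z : E, ∀ u ∈ Icc 0 T, ‖φ y u - φ z u‖ ≤ c * ‖y - z‖ := by
    intro y z u hu
    have := (hφ y).norm_sub_le (hφ z) hμ hU hs hM hL hu
    rw [hφ0, hφ0] at this
    refine this.trans (mul_le_mul_of_nonneg_right ?_ (norm_nonneg _))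
    refine Real.rpow_le_rpow_of_exponent_le (by norm_num) ?_
    have : u / Δ ≤ T / Δ := div_le_div_of_nonneg_right hu.2 hΔ.le
    linarith
  have hsecond : ∀ ρ ≤ 1, ∀ h k : E, ‖h‖ ≤ ρ → ‖k‖ ≤ ρ →
      ‖(φ (x + (h + k)) t - φ x t) - (φ (x + h) t - φ x t) - (φ (x + k) t - φ x t)‖
        ≤ 2 ^ (1 + T / Δ') * ρ ^ (1 + η) := by
    intro ρ hρ1 h k hh hk
    have hρ0 : 0 ≤ ρ := (norm_nonneg _).trans hh
    have hδ0 : 0 ≤ ρ ^ (1 + η) := Real.rpow_nonneg hρ0 _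
    obtain ⟨A₁, hA₁, h1⟩ := (hφ (x + (h + k))).1
    obtain ⟨A₂, hA₂, h2⟩ := (hφ (x + h)).1
    obtain ⟨A₃, hA₃, h3⟩ := (hφ (x + k)).1
    obtain ⟨A₄, hA₄, h4⟩ := (hφ x).1
    obtain ⟨C₁, hC₁⟩ := (hφ (x + (h + k))).2
    obtain ⟨C₂, hC₂⟩ := (hφ (x + h)).2
    obtain ⟨C₃, hC₃⟩ := (hφ (x + k)).2
    obtain ⟨C₄, hC₄⟩ := (hφ x).2
    have key := IsYoung.growth_of_linearGrowth (δ := ρ ^ (1 + η)) hΔ'0 hlam'0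
      (hlam'le.trans hlamβ) hν' hμ hP'0 hδ0 hs.G_nonneg hκ' hsmall'
      ((hC₁.sub hC₂).sub (hC₃.sub hC₄)) hs.holder
      (mul_nonneg (add_nonneg (add_nonneg hA₁ hA₂) (add_nonneg hA₃ hA₄))
        (Real.rpow_nonneg (sub_nonneg.2 hT) _))
      (((h1.sub h2).sub (h3.sub h4)).of_exponent_le
        (add_nonneg (add_nonneg hA₁ hA₂) (add_nonneg hA₃ hA₄)) hlam'le hlam'0) ?_ t ht
    · simp only [hφ0] at key
      -- The second difference vanishes at time 0, so the growth estimate retains only the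
      -- inhomogeneity ρ^(1+η).
      have e0 : x + (h + k) - (x + h) - (x + k - x) = 0 := by abel
      rw [e0, norm_zero, zero_add] at key
      have e1 : (φ (x + (h + k)) t - φ x t) - (φ (x + h) t - φ x t) - (φ (x + k) t - φ x t)
          = φ (x + (h + k)) t - φ (x + h) t - (φ (x + k) t - φ x t) := by abel
      rw [e1]
      have hpow : (2 : ℝ) ^ (1 + t / Δ') ≤ 2 ^ (1 + T / Δ') := by
        refine Real.rpow_le_rpow_of_exponent_le (by norm_num) ?_
        have : t / Δ' ≤ T / Δ' := div_le_div_of_nonneg_right ht.2 hΔ'0.le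
        linarith
      have := mul_le_mul_of_nonneg_right hpow hδ0
      linarith
    · intro a b ha hab hb hd
      have hdΔ : b - a ≤ Δ := hd.trans (hΔ'le.trans (min_le_left _ _))
      have hd1 : b - a ≤ 1 := hd.trans (hΔ'le.trans (min_le_right _ _))
      have hb' : ∀ y, HolderBound a b lam H (φ y) := fun y =>
        (hφ y).holderBound hμ hU hs hM (by linarith) ha hb hdΔ
      have hin : ∀ u ∈ Icc a b, u ∈ Icc 0 T := fun u hu => ⟨ha.trans hu.1, hu.2.trans hb⟩
      have hcρ : ∀ v : E, ‖v‖ ≤ ρ → ∀ u ∈ Icc a b, ‖φ (x + v) u - φ x u‖ ≤ c * ρ := by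
        intro v hv u hu
        refine (hclose _ _ u (hin u hu)).trans ?_
        rw [add_sub_cancel_left]
        exact mul_le_mul_of_nonneg_left hv hc0.le
      refine hU.linearGrowth_second_difference hd1 hlam hη0.le hη1 hH0 hc0.le hρ0 hρ1 hΔ'0
        (hΔ'le.trans (min_le_right _ _)) (hb' _) (hb' _) (hb' _) (hb' _) (hcρ h hh) (hcρ k hk) ?_
      refine ((hφ (x + k)).holderBound_sub (hφ x) hμ hU hs hM hL ha hb hdΔ).mono_const ?_
      exact mul_le_mul_of_nonneg_right (hcρ k hk a ⟨le_rfl, hab⟩) hH0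
  obtain ⟨A, hA⟩ := exists_hasFDerivAt_zero_of_almost_additive
    (D := fun h => φ (x + h) t - φ x t) (L := c) (C := 2 ^ (1 + T / Δ')) (ν := 1 + η)
    (by linarith) (by positivity)
    (fun h => by simpa using hclose (x + h) x t ht) hsecond
  have h1 : HasFDerivAt (fun h => φ (x + h) t) A 0 := by simpa using hA.add_const (φ x t)
  have h2 : DifferentiableAt ℝ (fun h => φ (x + h) t) (x - x) := by
    rw [sub_self]; exact h1.differentiableAt
  have h3 : DifferentiableAt ℝ (fun y : E => y - x) x := by fun_prop
  have h4 := DifferentiableAt.comp (f := fun y : E => y - x) x h2 h3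
  simpa only [Function.comp_def, add_sub_cancel] using h4

end Flow

/-! ### Dimension-free Gaussian moments -/

/-- Second moments of centered Gaussian vectors are controlled by quantiles of the norm. -/
theorem exists_gaussian_sq_moment_bound : ∃ K : ℝ, 0 ≤ K ∧
    ∀ (κ : Type) [Fintype κ] (ν : Measure (κ → ℝ)) [IsGaussian ν],
      (∀ L : StrongDual ℝ (κ → ℝ), ν[L] = 0) → ∀ a : ℝ, 0 < a → 3 / 4 ≤ ν {x | ‖x‖ ≤ a} →
        ∫⁻ x, ENNReal.ofReal (‖x‖ ^ 2) ∂ν ≤ ENNReal.ofReal (K * a ^ 2) := by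
  have hc1 : (2 : ℝ≥0∞)⁻¹ < 3 / 4 := by
    rw [← ENNReal.toReal_lt_toReal (by simp)
      (ENNReal.div_ne_top (by simp) (by simp)), ENNReal.toReal_inv, ENNReal.toReal_div]
    norm_num
  have hc2 : (3 / 4 : ℝ≥0∞) < 1 := by
    rw [← ENNReal.toReal_lt_toReal (ENNReal.div_ne_top (by simp) (by simp)) (by simp),
      ENNReal.toReal_div]
    norm_num
  have hL : 0 < Fernique.logRatio (3 / 4) := Fernique.logRatio_pos hc1 hc2
  -- The constant of Fernique's theorem at level 3/4; it depends neither on the dimension nor on the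
  -- law. Any level strictly between 1/2 and 1 would serve.
  set R : ℝ≥0∞ := .ofReal (Real.exp (Fernique.logRatio (3 / 4)))
    + ∑' n : ℕ, .ofReal (Real.exp (-2⁻¹ *
      Real.log ((3 / 4 : ℝ≥0∞) / (1 - 3 / 4)).toReal * 2 ^ n)) with hR
  have hRtop : R ≠ ⊤ := by
    refine (ENNReal.add_lt_top.mpr ⟨ENNReal.ofReal_lt_top, ?_⟩).ne
    refine Summable.tsum_ofReal_lt_top <|
      Real.summable_exp_nat_mul_of_ge ?_ (fun i ↦ mod_cast (Nat.lt_pow_self (by simp)).le)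
    refine mul_neg_of_neg_of_pos (by simp) (Real.log_pos ?_)
    have h4 : (1 - 3 / 4 : ℝ≥0∞).toReal = 1 / 4 := by
      rw [ENNReal.toReal_sub_of_le hc2.le (by simp), ENNReal.toReal_div]
      norm_num
    rw [ENNReal.toReal_div, h4, ENNReal.toReal_div]
    norm_num
  refine ⟨R.toReal / Fernique.logRatio (3 / 4), by positivity, ?_⟩
  intro κ _ ν _ hν a ha hprob
  have hrot := IsGaussian.map_rotation_eq_self_of_forall_strongDual_eq_zero hν (-(Real.pi / 4))
  have main := lintegral_exp_mul_sq_norm_le_of_map_rotation_eq_self hrot hprob hc1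
  set l := Fernique.logRatio (3 / 4) with hl
  -- The inequality y ≤ exp y extracts the second moment from the exponential one, and scaling by a
  -- produces a².
  have hpt : ∀ x : κ → ℝ, ENNReal.ofReal (‖x‖ ^ 2)
      ≤ ENNReal.ofReal (a ^ 2 / l) * ENNReal.ofReal (Real.exp (l * a⁻¹ ^ 2 * ‖x‖ ^ 2)) := by
    intro x
    rw [← ENNReal.ofReal_mul (by positivity)]
    refine ENNReal.ofReal_le_ofReal ?_
    have := Real.add_one_le_exp (l * a⁻¹ ^ 2 * ‖x‖ ^ 2)
    calc ‖x‖ ^ 2 = a ^ 2 / l * (l * a⁻¹ ^ 2 * ‖x‖ ^ 2) := by field_simp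
      _ ≤ _ := by gcongr; linarith
  calc ∫⁻ x, ENNReal.ofReal (‖x‖ ^ 2) ∂ν
      ≤ ∫⁻ x, ENNReal.ofReal (a ^ 2 / l) *
        ENNReal.ofReal (Real.exp (l * a⁻¹ ^ 2 * ‖x‖ ^ 2)) ∂ν := lintegral_mono hpt
    _ = ENNReal.ofReal (a ^ 2 / l) *
        ∫⁻ x, ENNReal.ofReal (Real.exp (l * a⁻¹ ^ 2 * ‖x‖ ^ 2)) ∂ν :=
        lintegral_const_mul' _ _ ENNReal.ofReal_ne_top
    _ ≤ ENNReal.ofReal (a ^ 2 / l) * R := by gcongr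
    _ = _ := by
        rw [← ENNReal.ofReal_toReal hRtop, ← ENNReal.ofReal_mul (by positivity)]
        congr 1
        rw [ENNReal.toReal_ofReal ENNReal.toReal_nonneg]
        ring

/-! ### Dyadic chaining, Hölder seminorms and the Kolmogorov criterion -/

section Dyadic

/-- A continuous function on `[0, 1]` with small dyadic increments is Hölder. -/
theorem abs_sub_le_of_dyadic_increments {f : ℝ → ℝ} {K β : ℝ} (hβ : 0 < β) (hK : 0 ≤ K)
    (hf : ContinuousOn f (Icc 0 1))
    (hd : ∀ m i : ℕ, i < 2 ^ m → |f ((i + 1) / 2 ^ m) - f (i / 2 ^ m)| ≤ K * ((1 / 2 : ℝ) ^ β) ^ m) :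
    ∃ C, 0 ≤ C ∧ ∀ x ∈ Icc (0 : ℝ) 1, ∀ y ∈ Icc (0 : ℝ) 1, |f x - f y| ≤ C * |x - y| ^ β := by
  set q : ℝ := (1 / 2 : ℝ) ^ β with hq
  have hq0 : 0 < q := by positivity
  have hq1 : q < 1 := Real.rpow_lt_one (by norm_num) (by norm_num) hβ
  have h2 : ∀ m : ℕ, (0 : ℝ) < 2 ^ m := fun m => by positivity
  set d : ℕ → ℝ → ℝ := fun m x => (⌊2 ^ m * x⌋₊ : ℝ) / 2 ^ m with hdd
  have hdle : ∀ m x, 0 ≤ x → d m x ≤ x := by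
    intro m x hx
    simp only [hdd]
    rw [div_le_iff₀ (h2 m)]
    have := Nat.floor_le (mul_nonneg (h2 m).le hx)
    linarith
  have hdge : ∀ m x, x - (1 / 2) ^ m ≤ d m x := by
    intro m x
    simp only [hdd]
    rw [le_div_iff₀ (h2 m), sub_mul, ← mul_pow]
    have := Nat.lt_floor_add_one (2 ^ m * x)
    norm_num
    linarith
  -- Consecutive dyadic approximations from below coincide or are the endpoints of one dyadic
  -- interval of level m + 1.
  have hstep : ∀ x ∈ Icc (0 : ℝ) 1, ∀ m, |f (d m x) - f (d (m + 1) x)| ≤ K * q ^ m := by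
    intro x hx m
    have hx0 : 0 ≤ 2 ^ m * x := mul_nonneg (h2 m).le hx.1
    have hfl1 := Nat.floor_le hx0
    have hfl2 := Nat.lt_floor_add_one (2 ^ m * x)
    have hfl3 := Nat.floor_le (mul_nonneg (h2 (m + 1)).le hx.1)
    have hfl4 := Nat.lt_floor_add_one (2 ^ (m + 1) * x)
    set j := ⌊2 ^ m * x⌋₊ with hj
    set j' := ⌊2 ^ (m + 1) * x⌋₊ with hj'
    have e2 : (2 : ℝ) ^ (m + 1) * x = 2 * (2 ^ m * x) := by ring
    have l1 : 2 * j ≤ j' := by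
      rw [hj', Nat.le_floor_iff (mul_nonneg (h2 (m + 1)).le hx.1), e2]; push_cast; linarith
    have l2 : j' < 2 * j + 2 := by
      rw [e2] at hfl3
      have : (j' : ℝ) < 2 * j + 2 := by linarith
      exact_mod_cast this
    have hdm : d m x = ((2 * j : ℕ) : ℝ) / 2 ^ (m + 1) := by
      simp only [hdd, ← hj]; push_cast; rw [pow_succ]; field_simp
    have hdm' : d (m + 1) x = (j' : ℝ) / 2 ^ (m + 1) := rfl
    rcases (by omega : j' = 2 * j ∨ j' = 2 * j + 1) with h | h
    · rw [hdm, hdm', h, sub_self, abs_zero]; positivity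
    · have hlt : 2 * j < 2 ^ (m + 1) := by
        have : (j' : ℝ) ≤ 2 ^ (m + 1) := hfl3.trans (mul_le_of_le_one_right (h2 _).le hx.2)
        have : j' ≤ 2 ^ (m + 1) := by exact_mod_cast this
        omega
      have := hd (m + 1) (2 * j) hlt
      rw [hdm, hdm', h, abs_sub_comm]
      push_cast at this ⊢
      refine this.trans ?_
      rw [pow_succ]
      have : q ^ m * q ≤ q ^ m := mul_le_of_le_one_right (by positivity) hq1.le
      exact mul_le_mul_of_nonneg_left this hK
  have hmem : ∀ x ∈ Icc (0 : ℝ) 1, ∀ m, d m x ∈ Icc (0 : ℝ) 1 := fun x hx m =>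
    ⟨by simp only [hdd]; positivity, (hdle m x hx.1).trans hx.2⟩
  have hlim : ∀ x ∈ Icc (0 : ℝ) 1, Filter.Tendsto (fun m => f (d m x)) Filter.atTop (nhds (f x)) := by
    intro x hx
    have h1 : Filter.Tendsto (fun m => d m x) Filter.atTop (nhds x) := by
      refine tendsto_of_tendsto_of_tendsto_of_le_of_le (g := fun m : ℕ => x - (1 / 2 : ℝ) ^ m)
        (h := fun _ => x) ?_ tendsto_const_nhds (fun m => hdge m x) (fun m => hdle m x hx.1)
      have := (tendsto_pow_atTop_nhds_zero_of_lt_one (r := (1 / 2 : ℝ)) (by norm_num)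
        (by norm_num)).const_sub x
      simpa using this
    exact (hf x hx).tendsto.comp (tendsto_nhdsWithin_iff.2
      ⟨h1, Filter.Eventually.of_forall fun m => hmem x hx m⟩)
  have htail : ∀ x ∈ Icc (0 : ℝ) 1, ∀ m, |f (d m x) - f x| ≤ K * q ^ m / (1 - q) := by
    intro x hx m
    have := dist_le_of_le_geometric_of_tendsto q K hq1
      (f := fun m => f (d m x)) (fun n => by rw [Real.dist_eq]; exact hstep x hx n) (hlim x hx) m
    rwa [Real.dist_eq] at this
  -- K for the step between the approximations of x and y, K/(1-q) for each tail, and 1/q because |x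
  -- - y| is only known to exceed (1/2)^(m+1).
  set C := (K + 2 * (K / (1 - q))) / q with hC
  have hq1' : 0 < 1 - q := by linarith
  have hC0 : 0 ≤ C := by positivity
  refine ⟨C, hC0, ?_⟩
  have main : ∀ x ∈ Icc (0 : ℝ) 1, ∀ y ∈ Icc (0 : ℝ) 1, x < y → |f x - f y| ≤ C * |x - y| ^ β := by
    intro x hx y hy hxy
    -- The level matched to the distance, (1/2)^(m+1) < y - x ≤ (1/2)^m: the approximations of x and
    -- y at this level are equal or adjacent.
    obtain ⟨m, hm1, hm2⟩ := exists_nat_pow_near_of_lt_one (sub_pos.2 hxy)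
      (by linarith [hx.1, hy.2] : y - x ≤ 1) (by norm_num : (0 : ℝ) < 1 / 2) (by norm_num)
    have hx0 : 0 ≤ 2 ^ m * x := mul_nonneg (h2 m).le hx.1
    have hy0 : 0 ≤ 2 ^ m * y := mul_nonneg (h2 m).le hy.1
    have hfl1 := Nat.floor_le hx0
    have hfl2 := Nat.lt_floor_add_one (2 ^ m * x)
    have hfl3 := Nat.floor_le hy0
    have hfl4 := Nat.lt_floor_add_one (2 ^ m * y)
    have hjj : ⌊2 ^ m * x⌋₊ ≤ ⌊2 ^ m * y⌋₊ :=
      Nat.floor_mono (mul_le_mul_of_nonneg_left hxy.le (h2 m).le)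
    have hdiff : 2 ^ m * y ≤ 2 ^ m * x + 1 := by
      have : 2 ^ m * (y - x) ≤ 2 ^ m * (1 / 2) ^ m := mul_le_mul_of_nonneg_left hm2 (h2 m).le
      rw [← mul_pow] at this
      norm_num at this
      linarith
    have hjj2 : ⌊2 ^ m * y⌋₊ < ⌊2 ^ m * x⌋₊ + 2 := by
      have : (⌊2 ^ m * y⌋₊ : ℝ) < ⌊2 ^ m * x⌋₊ + 2 := by linarith
      exact_mod_cast this
    have hmid : |f (d m x) - f (d m y)| ≤ K * q ^ m := by
      rcases (by omega : ⌊2 ^ m * y⌋₊ = ⌊2 ^ m * x⌋₊ ∨ ⌊2 ^ m * y⌋₊ = ⌊2 ^ m * x⌋₊ + 1) with h | h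
      · simp only [hdd, h, sub_self, abs_zero]; positivity
      · have hlt : ⌊2 ^ m * x⌋₊ < 2 ^ m := by
          have : (⌊2 ^ m * y⌋₊ : ℝ) ≤ 2 ^ m := hfl3.trans (mul_le_of_le_one_right (h2 _).le hy.2)
          have : ⌊2 ^ m * y⌋₊ ≤ 2 ^ m := by exact_mod_cast this
          omega
        have := hd m _ hlt
        simp only [hdd, h]
        rw [abs_sub_comm]
        push_cast
        exact this
    have t1 := htail x hx m
    have t2 := htail y hy m
    have hqm : q ^ m ≤ |x - y| ^ β / q := by
      rw [le_div_iff₀ hq0, ← pow_succ, hq, ← Real.rpow_natCast, ← Real.rpow_mul (by norm_num),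
        mul_comm β, Real.rpow_mul (by norm_num), Real.rpow_natCast]
      refine Real.rpow_le_rpow (by positivity) ?_ hβ.le
      rw [abs_sub_comm, abs_of_pos (sub_pos.2 hxy)]
      exact hm1.le
    have tri : |f x - f y| ≤ |f (d m x) - f x| + |f (d m x) - f (d m y)| + |f (d m y) - f y| := by
      have e : f x - f y = -(f (d m x) - f x) + (f (d m x) - f (d m y)) + (f (d m y) - f y) := by
        ring
      rw [e]
      refine (abs_add_three _ _ _).trans ?_
      rw [abs_neg]
    calc |f x - f y| ≤ K * q ^ m / (1 - q) + K * q ^ m + K * q ^ m / (1 - q) := by linarith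
      _ = (K + 2 * (K / (1 - q))) * q ^ m := by ring
      _ ≤ (K + 2 * (K / (1 - q))) * (|x - y| ^ β / q) := by gcongr
      _ = _ := by rw [hC]; ring
  intro x hx y hy
  rcases lt_trichotomy x y with h | h | h
  · exact main x hx y hy h
  · subst h; simp only [sub_self, abs_zero]; positivity
  · rw [abs_sub_comm, abs_sub_comm x y]; exact main y hy x hx h

end Dyadic

section HolderPath

variable {E : Type*} [MetricSpace E] {lam T : ℝ} {f : ℝ → E}

theorem holderWith_domRestrict_iff {C : ℝ≥0} (hlam : 0 ≤ lam) :
    HolderWith C lam.toNNReal ((Icc 0 T).domRestrict f) ↔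
      ∀ s ∈ Icc 0 T, ∀ t ∈ Icc 0 T, dist (f s) (f t) ≤ C * |s - t| ^ lam := by
  constructor
  · intro h s hs t ht
    have := h.dist_le ⟨s, hs⟩ ⟨t, ht⟩
    rwa [Real.coe_toNNReal _ hlam, Subtype.dist_eq, Real.dist_eq] at this
  · intro h s t
    have := h s s.2 t t.2
    rw [edist_dist, edist_dist, Subtype.dist_eq, Real.dist_eq, Real.coe_toNNReal _ hlam,
      ENNReal.ofReal_rpow_of_nonneg (abs_nonneg _) hlam, ← ENNReal.ofReal_coe_nnreal,
      ← ENNReal.ofReal_mul C.coe_nonneg]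
    exact ENNReal.ofReal_le_ofReal this

theorem isHolderPath_iff (hlam : 0 ≤ lam) : IsHolderPath lam T f ↔
    ∃ C : ℝ, 0 ≤ C ∧ ∀ s ∈ Icc 0 T, ∀ t ∈ Icc 0 T, dist (f s) (f t) ≤ C * |s - t| ^ lam := by
  constructor
  · rintro ⟨C, hC⟩
    exact ⟨C, C.2, (holderWith_domRestrict_iff hlam).1 hC⟩
  · rintro ⟨C, hC0, hC⟩
    exact ⟨⟨C, hC0⟩, (holderWith_domRestrict_iff hlam).2 hC⟩

theorem pathHolderNorm_nonneg : 0 ≤ pathHolderNorm lam T f := NNReal.coe_nonneg _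

theorem IsHolderPath.dist_le (hlam : 0 ≤ lam) (h : IsHolderPath lam T f) :
    ∀ s ∈ Icc 0 T, ∀ t ∈ Icc 0 T, dist (f s) (f t) ≤ pathHolderNorm lam T f * |s - t| ^ lam := by
  rw [pathHolderNorm]
  rw [IsHolderPath] at h
  have h2 := h.holderWith
  rwa [holderWith_domRestrict_iff hlam] at h2

theorem pathHolderNorm_le (hlam : 0 ≤ lam) {C : ℝ} (hC0 : 0 ≤ C)
    (hC : ∀ s ∈ Icc 0 T, ∀ t ∈ Icc 0 T, dist (f s) (f t) ≤ C * |s - t| ^ lam) :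
    pathHolderNorm lam T f ≤ C := by
  have : HolderWith ⟨C, hC0⟩ lam.toNNReal ((Icc 0 T).domRestrict f) :=
    (holderWith_domRestrict_iff hlam).2 hC
  have h2 := this.nnholderNorm_le
  rw [pathHolderNorm]
  exact NNReal.coe_le_coe.2 h2

end HolderPath

theorem IsHolderPath.holderBound {E : Type*} [NormedAddCommGroup E] {lam T : ℝ} {f : ℝ → E}
    (hlam : 0 ≤ lam) (h : IsHolderPath lam T f) :
    HolderBound 0 T lam (pathHolderNorm lam T f) f := by
  intro s t hs hst ht
  have := h.dist_le hlam t ⟨hs.trans hst, ht⟩ s ⟨hs, hst.trans ht⟩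
  rwa [dist_eq_norm, abs_of_nonneg (sub_nonneg.2 hst)] at this

section Kolmogorov

variable {Ω : Type*} [MeasurableSpace Ω] {μ : Measure Ω}

/-- The Kolmogorov-Chentsov criterion for processes with continuous paths. -/
theorem ae_isHolderPath_of_moment_bound {X : ℝ → Ω → ℝ} {T c H β : ℝ} {p : ℕ} (hT : 0 < T)
    (hβ : 0 < β) (hp : 1 + p * β < p * H)
    (hmeas : ∀ t, 0 ≤ t → AEMeasurable (X t) μ)
    (hcont : ∀ᵐ ω ∂μ, ContinuousOn (fun t => X t ω) (Icc 0 T))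
    (hmom : ∀ s t, 0 ≤ s → 0 ≤ t →
      ∫⁻ ω, ENNReal.ofReal (|X t ω - X s ω| ^ p) ∂μ ≤ ENNReal.ofReal (c * |t - s| ^ (p * H))) :
    ∀ᵐ ω ∂μ, IsHolderPath β T (fun t => X t ω) := by
  have hp0 : p ≠ 0 := by rintro rfl; norm_num at hp
  set q : ℝ := (1 / 2 : ℝ) ^ β with hq
  have hq0 : 0 < q := by positivity
  set D : ℕ → ℕ → Ω → ℝ := fun m i ω =>
    |X (T * ((i + 1) / 2 ^ m)) ω - X (T * (i / 2 ^ m)) ω| with hD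
  -- The sum of all normalized dyadic increments to the power p. Its expectation is finite because
  -- the 2^m intervals of level m contribute a multiple of w^m with w = 2^(1+pβ-pH) < 1.
  set Y : Ω → ℝ≥0∞ := fun ω =>
    ∑' m : ℕ, ∑ i ∈ Finset.range (2 ^ m), ENNReal.ofReal ((D m i ω / q ^ m) ^ p) with hY
  have hDm : ∀ m i, AEMeasurable (fun ω => ENNReal.ofReal ((D m i ω / q ^ m) ^ p)) μ := by
    intro m i
    have h1 := hmeas (T * ((i + 1) / 2 ^ m)) (by positivity)
    have h2 := hmeas (T * (i / 2 ^ m)) (by positivity)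
    have h3 : AEMeasurable (fun ω => D m i ω) μ :=
      measurable_norm.comp_aemeasurable (h1.sub h2)
    exact ((h3.div_const _).pow_const _).ennreal_ofReal
  set w : ℝ := 2 ^ (1 + p * β - p * H) with hw
  have hw0 : 0 < w := by positivity
  have hw1 : w < 1 := Real.rpow_lt_one_of_one_lt_of_neg (by norm_num) (by linarith)
  have hYint : ∫⁻ ω, Y ω ∂μ ≠ ⊤ := by
    have hterm : ∀ m i : ℕ, ∫⁻ ω, ENNReal.ofReal ((D m i ω / q ^ m) ^ p) ∂μ
        ≤ ENNReal.ofReal (c * T ^ (p * H) * (w / 2) ^ m) := by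
      intro m i
      have e1 : ∀ ω, ENNReal.ofReal ((D m i ω / q ^ m) ^ p)
          = ENNReal.ofReal ((q ^ m)⁻¹ ^ p) * ENNReal.ofReal (D m i ω ^ p) := by
        intro ω
        rw [← ENNReal.ofReal_mul (by positivity), ← mul_pow, div_eq_inv_mul]
      simp only [e1]
      rw [lintegral_const_mul' _ _ ENNReal.ofReal_ne_top]
      have h1 := hmom (T * (i / 2 ^ m)) (T * ((i + 1) / 2 ^ m)) (by positivity) (by positivity)
      have e2 : T * ((i + 1) / 2 ^ m) - T * (i / 2 ^ m) = T * (1 / 2) ^ m := by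
        rw [one_div, inv_pow]; ring
      rw [e2, abs_of_nonneg (by positivity)] at h1
      calc _ ≤ ENNReal.ofReal ((q ^ m)⁻¹ ^ p)
            * ENNReal.ofReal (c * (T * (1 / 2) ^ m) ^ (p * H)) := by gcongr
        _ = _ := by
            rw [← ENNReal.ofReal_mul (by positivity)]
            congr 1
            rw [Real.mul_rpow hT.le (by positivity)]
            have e3 : (q ^ m)⁻¹ ^ p * ((1 / 2 : ℝ) ^ m) ^ (p * H) = (w / 2) ^ m := by
              have e4 : w / 2 = (2 : ℝ) ^ (p * β - p * H) := by
                rw [hw, show (1 + p * β - p * H : ℝ) = (p * β - p * H) + 1 by ring,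
                  Real.rpow_add_one (by norm_num)]
                ring
              have e5 : q = (2 : ℝ) ^ (-β) := by
                rw [hq, one_div, Real.inv_rpow (by norm_num), Real.rpow_neg (by norm_num)]
              rw [e4, e5, one_div, ← Real.rpow_natCast, ← Real.rpow_natCast, ← Real.rpow_natCast,
                ← Real.rpow_natCast, ← Real.rpow_mul (by norm_num), ← Real.rpow_neg (by norm_num),
                ← Real.rpow_mul (by norm_num), ← Real.rpow_mul (by norm_num),
                ← Real.rpow_neg_one, ← Real.rpow_mul (by norm_num), ← Real.rpow_mul (by norm_num),
                ← Real.rpow_add (by norm_num)]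
              congr 1
              ring
            rw [← e3]; ring
    have hsum : ∫⁻ ω, Y ω ∂μ ≤ ∑' m : ℕ, ENNReal.ofReal (c * T ^ (p * H) * w ^ m) := by
      rw [hY, lintegral_tsum fun m => Finset.aemeasurable_fun_sum _ fun i _ => hDm m i]
      refine ENNReal.tsum_le_tsum fun m => ?_
      rw [lintegral_finsetSum' _ fun i _ => hDm m i]
      refine (Finset.sum_le_sum fun i _ => hterm m i).trans (le_of_eq ?_)
      rw [Finset.sum_const, Finset.card_range, nsmul_eq_mul, ← ENNReal.ofReal_natCast,
        ← ENNReal.ofReal_mul (by positivity)]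
      congr 1
      push_cast
      rw [div_pow]; field_simp
    refine (hsum.trans_lt ?_).ne
    exact Summable.tsum_ofReal_lt_top ((summable_geometric_of_lt_one hw0.le hw1).mul_left _)
  have hYm : AEMeasurable Y μ :=
    AEMeasurable.tsum fun m => Finset.aemeasurable_fun_sum _ fun i _ => hDm m i
  filter_upwards [ae_lt_top' hYm hYint, hcont] with ω hω hcω
  -- A normalized increment z > 1 satisfies z ≤ z^p ≤ Y, so the maximum with 1 bounds all of them.
  set K : ℝ := max 1 (Y ω).toReal with hK
  have hbound : ∀ m i : ℕ, i < 2 ^ m → D m i ω ≤ K * q ^ m := by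
    intro m i hi
    rw [← div_le_iff₀ (by positivity)]
    set z := D m i ω / q ^ m with hz
    have hz0 : 0 ≤ z := div_nonneg (abs_nonneg _) (by positivity)
    by_contra hlt
    push Not at hlt
    have hz1 : 1 ≤ z := (le_max_left _ _).trans hlt.le
    have h1 : ENNReal.ofReal (z ^ p) ≤ Y ω :=
      (Finset.single_le_sum (f := fun i => ENNReal.ofReal ((D m i ω / q ^ m) ^ p))
        (fun _ _ => zero_le) (Finset.mem_range.2 hi)).trans
        (ENNReal.le_tsum (f := fun m => ∑ i ∈ Finset.range (2 ^ m),
          ENNReal.ofReal ((D m i ω / q ^ m) ^ p)) m)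
    rw [ENNReal.ofReal_le_iff_le_toReal hω.ne] at h1
    have h2 : z ≤ z ^ p := le_self_pow₀ hz1 hp0
    linarith [le_max_right 1 (Y ω).toReal]
  obtain ⟨C, hC0, hC⟩ := abs_sub_le_of_dyadic_increments (f := fun x => X (T * x) ω) (K := K)
    (β := β) hβ (zero_le_one.trans (le_max_left _ _))
    (hcω.comp (by fun_prop) fun x hx => ⟨mul_nonneg hT.le hx.1, mul_le_of_le_one_right hT.le hx.2⟩)
    hbound
  rw [isHolderPath_iff hβ.le]
  refine ⟨C * (T⁻¹) ^ β, by positivity, fun s hs t ht => ?_⟩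
  have hd : ∀ u ∈ Icc 0 T, u / T ∈ Icc (0 : ℝ) 1 := fun u hu =>
    ⟨div_nonneg hu.1 hT.le, (div_le_one hT).2 hu.2⟩
  have := hC (s / T) (hd s hs) (t / T) (hd t ht)
  rw [mul_div_cancel₀ _ hT.ne', mul_div_cancel₀ _ hT.ne', ← sub_div, abs_div, abs_of_pos hT,
    div_eq_inv_mul, Real.mul_rpow (by positivity) (abs_nonneg _)] at this
  rw [Real.dist_eq]
  linarith

theorem IsFractionalBrownianMotion.hasLaw_increment {H : ℝ} {B : ℝ → Ω → ℝ}
    (hH : 0 < H) (hB : IsFractionalBrownianMotion H B μ) {s t : ℝ} (hs : 0 ≤ s) (ht : 0 ≤ t) :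
    HasLaw (fun ω => B t ω - B s ω) (gaussianReal 0 (|t - s| ^ (2 * H)).toNNReal) μ := by
  have hP := hB.gaussian.isProbabilityMeasure
  have hg : HasGaussianLaw (fun ω => B t ω - B s ω) μ :=
    hB.gaussian.hasGaussianLaw_fun_sub (s := ⟨t, ht⟩) (t := ⟨s, hs⟩)
  have ht2 : MemLp (B t) 2 μ := (hB.gaussian.hasGaussianLaw_eval ⟨t, ht⟩).memLp_two
  have hs2 : MemLp (B s) 2 μ := (hB.gaussian.hasGaussianLaw_eval ⟨s, hs⟩).memLp_two
  refine ⟨hg.aemeasurable, ?_⟩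
  rw [hg.map_eq_gaussianReal]
  congr 2
  · rw [integral_sub (ht2.integrable (by norm_num)) (hs2.integrable (by norm_num)),
      hB.mean_zero t ht, hB.mean_zero s hs, sub_zero]
  · have hz : (0 : ℝ) ^ (2 * H) = 0 := Real.zero_rpow (by linarith)
    rw [variance_fun_sub ht2 hs2, ← covariance_self ht2.aemeasurable,
      ← covariance_self hs2.aemeasurable, hB.covariance_eq t t ht ht, hB.covariance_eq s s hs hs,
      hB.covariance_eq t s ht hs, sub_self, sub_self, abs_zero, hz, abs_sub_comm s t]
    ring

/-- An increment has the law of |t - s|^H times a standard normal variable, so c is the absolute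
moment of the latter. -/
theorem IsFractionalBrownianMotion.moment_bound {H : ℝ} {B : ℝ → Ω → ℝ}
    (hH : 0 < H) (hB : IsFractionalBrownianMotion H B μ) (p : ℕ) :
    ∃ c : ℝ, 0 ≤ c ∧ ∀ s t, 0 ≤ s → 0 ≤ t →
      ∫⁻ ω, ENNReal.ofReal (|B t ω - B s ω| ^ p) ∂μ ≤ ENNReal.ofReal (c * |t - s| ^ (p * H)) := by
  set c : ℝ≥0∞ := ∫⁻ x, ENNReal.ofReal (|x| ^ p) ∂(gaussianReal 0 1) with hc
  have hctop : c ≠ ⊤ := by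
    have h := (memLp_id_gaussianReal (μ := 0) (v := 1) p).integrable_norm_pow' 
    have h2 := h.lintegral_lt_top
    simp only [id, Real.norm_eq_abs] at h2
    exact h2.ne
  refine ⟨c.toReal, ENNReal.toReal_nonneg, fun s t hs ht => ?_⟩
  have hm : Measurable fun x : ℝ => ENNReal.ofReal (|x| ^ p) :=
    ((measurable_norm (α := ℝ)).pow_const p).ennreal_ofReal
  have hlaw := hB.hasLaw_increment hH hs ht
  set σ := |t - s| ^ H with hσ
  have hσ0 : 0 ≤ σ := Real.rpow_nonneg (abs_nonneg _) _
  have hscale := gaussianReal_map_const_mul (μ := 0) (v := 1) σ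
  rw [mul_zero, mul_one] at hscale
  have hv : (|t - s| ^ (2 * H)).toNNReal = NNReal.mk (σ ^ 2) (sq_nonneg _) := by
    ext
    rw [Real.coe_toNNReal _ (Real.rpow_nonneg (abs_nonneg _) _), NNReal.coe_mk, hσ,
      ← Real.rpow_natCast, ← Real.rpow_mul (abs_nonneg _)]
    congr 1
    push_cast; ring
  rw [hv, ← hscale] at hlaw
  calc ∫⁻ ω, ENNReal.ofReal (|B t ω - B s ω| ^ p) ∂μ
      = ∫⁻ x, ENNReal.ofReal (|x| ^ p) ∂((gaussianReal 0 1).map (σ * ·)) :=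
        hlaw.lintegral_comp hm.aemeasurable
    _ = ∫⁻ x, ENNReal.ofReal (|σ * x| ^ p) ∂(gaussianReal 0 1) :=
        lintegral_map hm (by fun_prop)
    _ = ∫⁻ x, ENNReal.ofReal (σ ^ p) * ENNReal.ofReal (|x| ^ p) ∂(gaussianReal 0 1) := by
        congr 1 with x
        rw [← ENNReal.ofReal_mul (by positivity), abs_mul, abs_of_nonneg hσ0, mul_pow]
    _ = ENNReal.ofReal (σ ^ p) * c := lintegral_const_mul' _ _ ENNReal.ofReal_ne_top
    _ = ENNReal.ofReal (c.toReal * |t - s| ^ (p * H)) := by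
        rw [← ENNReal.ofReal_toReal hctop, ← ENNReal.ofReal_mul (by positivity),
          ENNReal.toReal_ofReal ENNReal.toReal_nonneg, mul_comm, hσ, ← Real.rpow_natCast,
          ← Real.rpow_mul (abs_nonneg _), mul_comm H]
    _ ≤ _ := le_rfl

theorem IsFractionalBrownianMotion.ae_isHolderPath {H β T : ℝ} {B : ℝ → Ω → ℝ}
    (hβ : 0 < β) (hβH : β < H) (hT : 0 < T) (hB : IsFractionalBrownianMotion H B μ) :
    ∀ᵐ ω ∂μ, IsHolderPath β T (fun t => B t ω) := by
  -- Gaussian increments have moments of every order, and p > 1/(H - β) makes Kolmogorov's condition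
  -- hold for the given β < H.
  obtain ⟨p, hp⟩ := exists_nat_gt (1 / (H - β))
  have hp' : 1 + p * β < p * H := by
    rw [div_lt_iff₀ (by linarith)] at hp
    linarith
  obtain ⟨c, -, hmom⟩ := hB.moment_bound (hβ.trans hβH) p
  refine ae_isHolderPath_of_moment_bound hT hβ hp'
    (fun t ht => hB.gaussian.aemeasurable ⟨t, ht⟩) ?_ hmom
  filter_upwards [hB.continuous_paths] with ω hω using hω.mono fun t ht => ht.1

end Kolmogorov

/-! ### The Hölder seminorm as a limit of Gaussian sup norms -/

section HolderQuotients

/-- The Hölder quotients of `f` at pairs among the first `m` points of the sequence `q`. -/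
noncomputable def holderQuotients (β : ℝ) (q : ℕ → ℝ) (m : ℕ) (f : ℝ → ℝ) :
    Fin m × Fin m → ℝ :=
  fun p => |q p.1 - q p.2| ^ (-β) * (f (q p.1) - f (q p.2))

variable {β T : ℝ} {q : ℕ → ℝ} {f : ℝ → ℝ}

theorem monotone_norm_holderQuotients : Monotone fun m => ‖holderQuotients β q m f‖ := by
  intro m m' hmm
  refine (pi_norm_le_iff_of_nonneg (norm_nonneg _)).2 fun p => ?_
  exact norm_le_pi_norm (holderQuotients β q m' f) (Fin.castLE hmm p.1, Fin.castLE hmm p.2)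

theorem norm_holderQuotients_le (hβ : 0 < β) (hq : ∀ i, q i ∈ Icc 0 T)
    (hf : IsHolderPath β T f) (m : ℕ) : ‖holderQuotients β q m f‖ ≤ pathHolderNorm β T f := by
  refine (pi_norm_le_iff_of_nonneg pathHolderNorm_nonneg).2 fun p => ?_
  have h := hf.dist_le hβ.le _ (hq p.1) _ (hq p.2)
  rw [Real.dist_eq] at h
  rw [holderQuotients, Real.norm_eq_abs, abs_mul, abs_of_nonneg (by positivity),
    Real.rpow_neg (abs_nonneg _)]
  exact inv_mul_le_of_le_mul₀ (by positivity) pathHolderNorm_nonneg (by linarith)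

theorem pathHolderNorm_le_of_norm_holderQuotients_le (hβ : 0 < β)
    (hd : Icc 0 T ⊆ closure (range q)) (hq : ∀ i, q i ∈ Icc 0 T) (hf : ContinuousOn f (Icc 0 T))
    {C : ℝ} (hC : ∀ m, ‖holderQuotients β q m f‖ ≤ C) : pathHolderNorm β T f ≤ C := by
  have hC0 : 0 ≤ C := (norm_nonneg _).trans (hC 0)
  have key : ∀ i j, |f (q i) - f (q j)| ≤ C * |q i - q j| ^ β := by
    intro i j
    by_cases hij : q i = q j
    · rw [hij, sub_self, abs_zero]; positivity
    have h0 : 0 < |q i - q j| := abs_pos.2 (sub_ne_zero.2 hij)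
    have h := (norm_le_pi_norm (holderQuotients β q (max i j + 1) f)
      (⟨i, by omega⟩, ⟨j, by omega⟩)).trans (hC _)
    rw [holderQuotients, Real.norm_eq_abs, abs_mul, abs_of_nonneg (by positivity),
      Real.rpow_neg (abs_nonneg _)] at h
    rw [inv_mul_le_iff₀ (by positivity)] at h
    dsimp only at h
    linarith
  refine pathHolderNorm_le hβ.le hC0 fun s hs t ht => ?_
  obtain ⟨u, hu, hus⟩ := mem_closure_iff_seq_limit.1 (hd hs)
  obtain ⟨v, hv, hvt⟩ := mem_closure_iff_seq_limit.1 (hd ht)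
  have hmem : ∀ w : ℕ → ℝ, (∀ n, w n ∈ range q) → ∀ n, w n ∈ Icc 0 T := by
    intro w hw n
    obtain ⟨i, hi⟩ := hw n
    exact hi ▸ hq i
  have h1 := (hf s hs).tendsto.comp (tendsto_nhdsWithin_iff.2
      ⟨hus, Filter.Eventually.of_forall fun n => hmem u hu n⟩)
  have h2 := (hf t ht).tendsto.comp (tendsto_nhdsWithin_iff.2
      ⟨hvt, Filter.Eventually.of_forall fun n => hmem v hv n⟩)
  rw [Real.dist_eq]
  refine le_of_tendsto_of_tendsto' (h1.sub h2).abs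
    ((((hus.sub hvt).abs).rpow_const (Or.inr hβ.le)).const_mul C) fun n => ?_
  obtain ⟨i, hi⟩ := hu n
  obtain ⟨j, hj⟩ := hv n
  simp only [Function.comp, ← hi, ← hj]
  exact key i j

/-- A dense sequence of times determines the seminorm of a continuous path. The limit is monotone
and its terms are norms of finite Gaussian vectors, which transfers measurability, laws and moment
bounds to the seminorm. -/
theorem tendsto_norm_holderQuotients (hβ : 0 < β)
    (hd : Icc 0 T ⊆ closure (range q)) (hq : ∀ i, q i ∈ Icc 0 T) (hf : IsHolderPath β T f) :
    Filter.Tendsto (fun m => ‖holderQuotients β q m f‖) Filter.atTop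
      (nhds (pathHolderNorm β T f)) := by
  have hbdd : BddAbove (range fun m => ‖holderQuotients β q m f‖) :=
    ⟨_, by rintro _ ⟨m, rfl⟩; exact norm_holderQuotients_le hβ hq hf m⟩
  have h := tendsto_atTop_ciSup (monotone_norm_holderQuotients (β := β) (q := q) (f := f)) hbdd
  convert h
  refine le_antisymm ?_ (ciSup_le fun m => norm_holderQuotients_le hβ hq hf m)
  exact pathHolderNorm_le_of_norm_holderQuotients_le hβ hd hq
    ((hf.holderBound hβ.le).continuousOn hβ) fun m => le_ciSup hbdd m

theorem exists_dense_seq_Icc (hT : 0 ≤ T) :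
    ∃ q : ℕ → ℝ, (∀ i, q i ∈ Icc 0 T) ∧ Icc 0 T ⊆ closure (range q) := by
  have : Nonempty (Icc (0 : ℝ) T) := ⟨⟨0, le_rfl, hT⟩⟩
  refine ⟨fun i => TopologicalSpace.denseSeq (Icc (0 : ℝ) T) i, fun i => Subtype.coe_prop _, ?_⟩
  intro t ht
  have h := TopologicalSpace.denseRange_denseSeq (Icc (0 : ℝ) T) ⟨t, ht⟩
  have h2 := image_closure_subset_closure_image continuous_subtype_val (mem_image_of_mem _ h)
  rwa [← range_comp] at h2

end HolderQuotients

/-! ### Law and moments of the Hölder seminorm -/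

section Gaussian

variable {Ω : Type*} [MeasurableSpace Ω] {μ : Measure Ω}

/-- The law of a Gaussian vector is determined by means and covariances. -/
theorem HasGaussianLaw.map_eq_map {ι : Type*} [Fintype ι] {X Y : Ω → ι → ℝ}
    (hX : HasGaussianLaw X μ) (hY : HasGaussianLaw Y μ)
    (hm : ∀ i, ∫ ω, X ω i ∂μ = ∫ ω, Y ω i ∂μ)
    (hc : ∀ i j, cov[fun ω => X ω i, fun ω => X ω j; μ] = cov[fun ω => Y ω i, fun ω => Y ω j; μ]) :
    μ.map X = μ.map Y := by
  -- The Euclidean structure makes the characterization of Gaussian measures by mean and covariance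
  -- form available; the symmetric form is then compared on the diagonal.
  apply (MeasurableEquiv.toLp 2 (_ → ℝ)).map_measurableEquiv_injective
  rw [MeasurableEquiv.coe_toLp, ← PiLp.coe_symm_continuousLinearEquiv 2 ℝ]
  have hX' := hX.isGaussian_map
  have hY' := hY.isGaussian_map
  have hXm := hX.aemeasurable
  have hYm := hY.aemeasurable
  have e : ∀ Z : Ω → ι → ℝ, HasGaussianLaw Z μ →
      ∫ x, id x ∂((μ.map Z).map (PiLp.continuousLinearEquiv 2 ℝ fun _ : ι => ℝ).symm)
        = (PiLp.continuousLinearEquiv 2 ℝ fun _ : ι => ℝ).symm (∫ ω, Z ω ∂μ) := by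
    intro Z hZ
    rw [integral_map (by fun_prop) (by fun_prop), integral_map hZ.aemeasurable (by fun_prop)]
    simp only [id_eq]
    rw [ContinuousLinearEquiv.integral_comp_comm]
  apply IsGaussian.ext
  · rw [e X hX, e Y hY]
    congr 1
    ext i
    rw [eval_integral fun i => (hX.eval i).integrable, eval_integral fun i => (hY.eval i).integrable]
    exact hm i
  · rw [← ContinuousLinearMap.toBilinForm_inj]
    refine LinearMap.BilinForm.ext_of_isSymm isPosSemidef_covarianceBilin.isSymm
      isPosSemidef_covarianceBilin.isSymm fun x ↦ ?_
    simp only [ContinuousLinearMap.toBilinForm_apply]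
    rw [PiLp.coe_symm_continuousLinearEquiv, covarianceBilin_apply_pi, covarianceBilin_apply_pi]
    · congrm ∑ i, ∑ j, _ * ?_
      rw [covariance_map (measurable_pi_apply i).aestronglyMeasurable
        (measurable_pi_apply j).aestronglyMeasurable hXm,
        covariance_map (measurable_pi_apply i).aestronglyMeasurable
        (measurable_pi_apply j).aestronglyMeasurable hYm]
      exact hc i j
    · exact fun i ↦ (hY'.hasGaussianLaw_id.eval i).memLp_two
    · exact fun i ↦ (hX'.hasGaussianLaw_id.eval i).memLp_two

theorem IsFractionalBrownianMotion.hasGaussianLaw_eval_seq {H : ℝ} {B : ℝ → Ω → ℝ}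
    (hB : IsFractionalBrownianMotion H B μ) {q : ℕ → ℝ} (hq : ∀ i, 0 ≤ q i) (m : ℕ) :
    HasGaussianLaw (fun ω (i : Fin m) => B (q i) ω) μ := by
  classical
  -- The sequence q may repeat times, so the vector is obtained linearly from the values at the
  -- finite set of times that occur.
  set I : Finset ℝ≥0 := Finset.univ.image fun i : Fin m => (⟨q i, hq i⟩ : ℝ≥0) with hI
  have hmem : ∀ i : Fin m, (⟨q i, hq i⟩ : ℝ≥0) ∈ I := fun i =>
    Finset.mem_image_of_mem _ (Finset.mem_univ i)
  exact (hB.gaussian.hasGaussianLaw I).map_fun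
    (ContinuousLinearMap.pi fun i : Fin m => ContinuousLinearMap.proj (R := ℝ)
      (φ := fun _ : I => ℝ) ⟨_, hmem i⟩)

/-- `holderQuotients` as a linear function of the values at the points. -/
noncomputable def holderQuotientsCLM (β : ℝ) (q : ℕ → ℝ) (m : ℕ) :
    (Fin m → ℝ) →L[ℝ] (Fin m × Fin m → ℝ) :=
  ContinuousLinearMap.pi fun p => |q p.1 - q p.2| ^ (-β) •
    (ContinuousLinearMap.proj (R := ℝ) (φ := fun _ : Fin m => ℝ) p.1
      - ContinuousLinearMap.proj (R := ℝ) (φ := fun _ : Fin m => ℝ) p.2)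

theorem IsFractionalBrownianMotion.hasGaussianLaw_holderQuotients {H β : ℝ} {B : ℝ → Ω → ℝ}
    (hB : IsFractionalBrownianMotion H B μ) {q : ℕ → ℝ} (hq : ∀ i, 0 ≤ q i) (m : ℕ) :
    HasGaussianLaw (fun ω => holderQuotients β q m (fun t => B t ω)) μ :=
  (hB.hasGaussianLaw_eval_seq hq m).map_fun (holderQuotientsCLM β q m)

theorem IsFractionalBrownianMotion.integral_holderQuotients {H β : ℝ} {B : ℝ → Ω → ℝ}
    (hB : IsFractionalBrownianMotion H B μ) {q : ℕ → ℝ} (hq : ∀ i, 0 ≤ q i) (m : ℕ) :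
    ∫ ω, holderQuotients β q m (fun t => B t ω) ∂μ = 0 := by
  have hg := hB.hasGaussianLaw_eval_seq hq m
  have h := (holderQuotientsCLM β q m).integral_comp_comm hg.integrable
  refine Eq.trans h ?_
  have : ∫ ω, (fun i : Fin m => B (q i) ω) ∂μ = 0 := by
    ext i
    rw [eval_integral fun i => (hg.eval i).integrable]
    exact hB.mean_zero _ (hq i)
  rw [this, map_zero]

theorem IsFractionalBrownianMotion.map_holderQuotients_eq {H β : ℝ} {B B' : ℝ → Ω → ℝ}
    (hB : IsFractionalBrownianMotion H B μ) (hB' : IsFractionalBrownianMotion H B' μ)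
    {q : ℕ → ℝ} (hq : ∀ i, 0 ≤ q i) (m : ℕ) :
    μ.map (fun ω => holderQuotients β q m (fun t => B t ω))
      = μ.map (fun ω => holderQuotients β q m (fun t => B' t ω)) := by
  have h1 := hB.hasGaussianLaw_eval_seq hq m
  have h2 := hB'.hasGaussianLaw_eval_seq hq m
  have h := HasGaussianLaw.map_eq_map h1 h2
    (fun i => by rw [hB.mean_zero _ (hq i), hB'.mean_zero _ (hq i)])
    (fun i j => (hB.covariance_eq _ _ (hq i) (hq j)).trans
      (hB'.covariance_eq _ _ (hq i) (hq j)).symm)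
  have hL : AEMeasurable (holderQuotientsCLM β q m)
      (μ.map (fun ω (i : Fin m) => B (q i) ω)) := by fun_prop
  have hL' : AEMeasurable (holderQuotientsCLM β q m)
      (μ.map (fun ω (i : Fin m) => B' (q i) ω)) := by fun_prop
  have e1 := AEMeasurable.map_map_of_aemeasurable hL h1.aemeasurable
  have e2 := AEMeasurable.map_map_of_aemeasurable hL' h2.aemeasurable
  rw [h, e2] at e1
  exact e1.symm

variable {H β T : ℝ} {B B' : ℝ → Ω → ℝ}

theorem IsFractionalBrownianMotion.aemeasurable_pathHolderNorm (hβ : 0 < β) (hβH : β < H)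
    (hT : 0 < T) (hB : IsFractionalBrownianMotion H B μ) :
    AEMeasurable (fun ω => pathHolderNorm β T fun t => B t ω) μ := by
  obtain ⟨q, hq, hd⟩ := exists_dense_seq_Icc hT.le
  refine aemeasurable_of_tendsto_metrizable_ae Filter.atTop
    (f := fun m ω => ‖holderQuotients β q m (fun t => B t ω)‖)
    (fun m => (hB.hasGaussianLaw_holderQuotients (fun i => (hq i).1) m).aemeasurable.norm) ?_
  filter_upwards [hB.ae_isHolderPath hβ hβH hT] with ω hω
  exact tendsto_norm_holderQuotients hβ hd hq hω

theorem IsFractionalBrownianMotion.tendsto_lintegral_holderQuotients (hβ : 0 < β) (hβH : β < H)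
    (hT : 0 < T) (hB : IsFractionalBrownianMotion H B μ) {q : ℕ → ℝ} (hq : ∀ i, q i ∈ Icc 0 T)
    (hd : Icc 0 T ⊆ closure (range q)) (p : ℕ) :
    Filter.Tendsto
      (fun m => ∫⁻ ω, ENNReal.ofReal (‖holderQuotients β q m (fun t => B t ω)‖ ^ p) ∂μ)
      Filter.atTop
      (nhds (∫⁻ ω, ENNReal.ofReal ((pathHolderNorm β T fun t => B t ω) ^ p) ∂μ)) := by
  refine lintegral_tendsto_of_tendsto_of_monotone (fun m =>
    ((hB.hasGaussianLaw_holderQuotients (fun i => (hq i).1) m).aemeasurable.norm.pow_const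
      p).ennreal_ofReal) (Filter.Eventually.of_forall fun ω m m' hmm => ?_) ?_
  · exact ENNReal.ofReal_le_ofReal
      (pow_le_pow_left₀ (norm_nonneg _) (monotone_norm_holderQuotients hmm) p)
  filter_upwards [hB.ae_isHolderPath hβ hβH hT] with ω hω
  exact ENNReal.tendsto_ofReal ((tendsto_norm_holderQuotients hβ hd hq hω).pow p)

/-- Both expectations are limits along the same times, and the finite vectors of quotients have
equal laws. -/
theorem IsFractionalBrownianMotion.integral_pathHolderNorm_eq (hβ : 0 < β) (hβH : β < H)
    (hT : 0 < T) (hB : IsFractionalBrownianMotion H B μ)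
    (hB' : IsFractionalBrownianMotion H B' μ) :
    ∫ ω, (pathHolderNorm β T fun t => B t ω) ∂μ = ∫ ω, (pathHolderNorm β T fun t => B' t ω) ∂μ := by
  obtain ⟨q, hq, hd⟩ := exists_dense_seq_Icc hT.le
  have hq0 : ∀ i, 0 ≤ q i := fun i => (hq i).1
  rw [integral_eq_lintegral_of_nonneg_ae (.of_forall fun ω => pathHolderNorm_nonneg)
      (hB.aemeasurable_pathHolderNorm hβ hβH hT).aestronglyMeasurable,
    integral_eq_lintegral_of_nonneg_ae (.of_forall fun ω => pathHolderNorm_nonneg)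
      (hB'.aemeasurable_pathHolderNorm hβ hβH hT).aestronglyMeasurable]
  congr 1
  have h1 := hB.tendsto_lintegral_holderQuotients hβ hβH hT hq hd 1
  have h2 := hB'.tendsto_lintegral_holderQuotients hβ hβH hT hq hd 1
  simp only [pow_one] at h1 h2
  refine tendsto_nhds_unique h1 (h2.congr fun m => ?_)
  have hm : Measurable fun x : Fin m × Fin m → ℝ => ENNReal.ofReal ‖x‖ := by fun_prop
  have e1 := lintegral_map' (μ := μ) hm.aemeasurable
    (hB.hasGaussianLaw_holderQuotients (β := β) hq0 m).aemeasurable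
  have e2 := lintegral_map' (μ := μ) hm.aemeasurable
    (hB'.hasGaussianLaw_holderQuotients (β := β) hq0 m).aemeasurable
  rw [← e1, ← e2, hB.map_holderQuotients_eq hB' hq0 m]

theorem exists_pos_measure_le_ge [IsProbabilityMeasure μ] (N : Ω → ℝ) :
    ∃ a, 0 < a ∧ 3 / 4 ≤ μ {ω | N ω ≤ a} := by
  have hmono : Monotone fun n : ℕ => {ω | N ω ≤ n} := fun n m hnm ω hω =>
    le_trans (show N ω ≤ n from hω) (by exact_mod_cast hnm)
  have h := tendsto_measure_iUnion_atTop (μ := μ) hmono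
  have hU : (⋃ n : ℕ, {ω | N ω ≤ n}) = univ := by
    ext ω
    simpa using exists_nat_ge (N ω)
  rw [hU, measure_univ] at h
  have hlt : (3 / 4 : ℝ≥0∞) < 1 := by
    rw [ENNReal.div_lt_iff (by simp) (by simp)]
    norm_num
  obtain ⟨n, hn, hn1⟩ := ((h.eventually (lt_mem_nhds hlt)).and
    (Filter.eventually_ge_atTop 1)).exists
  exact ⟨n, by exact_mod_cast hn1, hn.le⟩

/-- Uniform comparison of the first two moments of the Hölder norm. -/
theorem exists_pathHolderNorm_sq_moment_bound : ∃ K : ℝ, 0 ≤ K ∧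
    ∀ {Ω : Type*} [MeasurableSpace Ω] (μ : Measure Ω) (H β T : ℝ) (B : ℝ → Ω → ℝ),
      0 < β → β < H → 0 < T → IsFractionalBrownianMotion H B μ →
      MemLp (fun ω => pathHolderNorm β T fun t => B t ω) 2 μ ∧
      ∫ ω, (pathHolderNorm β T fun t => B t ω) ^ 2 ∂μ
        ≤ K * (∫ ω, (pathHolderNorm β T fun t => B t ω) ∂μ) ^ 2 := by
  obtain ⟨K, hK0, hK⟩ := exists_gaussian_sq_moment_bound
  refine ⟨K * 16, by positivity, fun {Ω} _ μ H β T B hβ hβH hT hB => ?_⟩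
  have hP := hB.gaussian.isProbabilityMeasure
  obtain ⟨q, hq, hd⟩ := exists_dense_seq_Icc hT.le
  have hq0 : ∀ i, 0 ≤ q i := fun i => (hq i).1
  set N : Ω → ℝ := fun ω => pathHolderNorm β T fun t => B t ω with hN
  have hN0 : ∀ ω, 0 ≤ N ω := fun ω => pathHolderNorm_nonneg
  have hNm : AEMeasurable N μ := hB.aemeasurable_pathHolderNorm hβ hβH hT
  have hhol := hB.ae_isHolderPath hβ hβH hT
  have quant : ∀ a, 0 < a → 3 / 4 ≤ μ {ω | N ω ≤ a} →
      ∫⁻ ω, ENNReal.ofReal (N ω ^ 2) ∂μ ≤ ENNReal.ofReal (K * a ^ 2) := by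
    intro a ha hNa
    refine le_of_tendsto' (hB.tendsto_lintegral_holderQuotients hβ hβH hT hq hd 2) fun m => ?_
    have hg := hB.hasGaussianLaw_holderQuotients (β := β) hq0 m
    have hgm := hg.isGaussian_map
    have hm : Measurable fun x : Fin m × Fin m → ℝ => ENNReal.ofReal (‖x‖ ^ 2) := by fun_prop
    rw [← lintegral_map' (μ := μ) hm.aemeasurable hg.aemeasurable]
    refine hK _ _ (fun L => ?_) a ha ?_
    · rw [integral_map hg.aemeasurable (by fun_prop), L.integral_comp_comm hg.integrable,
        hB.integral_holderQuotients hq0 m, map_zero]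
    · rw [Measure.map_apply_of_aemeasurable hg.aemeasurable
        (measurableSet_le measurable_norm measurable_const)]
      refine hNa.trans (measure_mono_ae ?_)
      filter_upwards [hhol] with ω hω hωa
      exact (norm_holderQuotients_le hβ hq hω m).trans hωa
  -- An arbitrary 3/4-quantile already gives square integrability, hence a finite mean, before
  -- Markov's inequality is available.
  have hmem : MemLp N 2 μ := by
    obtain ⟨a, ha, hNa⟩ := exists_pos_measure_le_ge (μ := μ) N
    rw [memLp_two_iff_integrable_sq hNm.aestronglyMeasurable]
    refine ⟨(hNm.pow_const 2).aestronglyMeasurable, ?_⟩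
    rw [hasFiniteIntegral_iff_ofReal (.of_forall fun ω => sq_nonneg _)]
    exact (quant a ha hNa).trans_lt ENNReal.ofReal_lt_top
  refine ⟨hmem, ?_⟩
  have hint : Integrable N μ := hmem.integrable (by norm_num)
  rcases (integral_nonneg hN0 : 0 ≤ ∫ ω, N ω ∂μ).eq_or_lt with h0 | hpos
  · have hz := (integral_eq_zero_iff_of_nonneg hN0 hint).1 h0.symm
    have : ∫ ω, N ω ^ 2 ∂μ = 0 := by
      rw [integral_eq_zero_of_ae]
      filter_upwards [hz] with ω hω
      rw [hω]; simp
    rw [this]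
    positivity
  -- By Markov's inequality four times the mean is a 3/4-quantile, which explains the factor 16 = 4²
  -- in the constant.
  · set a := 4 * ∫ ω, N ω ∂μ with ha
    have hmark := mul_meas_ge_le_integral_of_nonneg (.of_forall hN0) hint a
    have h14 : μ.real {ω | a ≤ N ω} ≤ 1 / 4 := by
      rw [ha] at hmark ⊢
      have := (le_div_iff₀' (by positivity)).2 hmark
      refine this.trans (le_of_eq ?_)
      field_simp
    have h34 : 3 / 4 ≤ μ {ω | N ω ≤ a} := by
      have h1 : 1 ≤ μ.real {ω | N ω ≤ a} + μ.real {ω | a ≤ N ω} := by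
        rw [← probReal_univ (μ := μ)]
        refine (measureReal_mono (fun ω _ => ?_)).trans (measureReal_union_le _ _)
        exact le_total (N ω) a
      have h2 : (3 / 4 : ℝ) ≤ μ.real {ω | N ω ≤ a} := by linarith
      rw [measureReal_def] at h2
      rw [← ENNReal.ofReal_le_iff_le_toReal (measure_ne_top _ _)] at h2
      refine le_trans (le_of_eq ?_) h2
      rw [ENNReal.ofReal_div_of_pos (by norm_num)]
      norm_num
    have h := quant a (by positivity) h34
    rw [integral_eq_lintegral_of_nonneg_ae (.of_forall fun ω => sq_nonneg _)
      (hNm.pow_const 2).aestronglyMeasurable]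
    refine (ENNReal.toReal_mono ENNReal.ofReal_ne_top h).trans (le_of_eq ?_)
    rw [ENNReal.toReal_ofReal (by positivity), ha]
    ring

end Gaussian

/-! ### From the pathwise hypotheses to Young flows on Euclidean space -/

section EuclideanFields

variable {n d : ℕ}

theorem norm_le_l1Norm (v : EuclideanSpace ℝ (Fin n)) : ‖v‖ ≤ l1Norm v := by
  have h := (EuclideanSpace.basisFun (Fin n) ℝ).sum_repr v
  conv_lhs => rw [← h]
  refine (norm_sum_le _ _).trans (Finset.sum_le_sum fun i _ => ?_)
  rw [norm_smul, (EuclideanSpace.basisFun (Fin n) ℝ).norm_eq_one, mul_one]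
  exact le_rfl

theorem l1Norm_le_mul {v : EuclideanSpace ℝ (Fin n)} {C : ℝ} (h : ∀ i, |v i| ≤ C) :
    l1Norm v ≤ n * C := by
  refine (Finset.sum_le_sum fun i _ => h i).trans (le_of_eq ?_)
  simp

theorem l1Norm_le_mul_norm (v : EuclideanSpace ℝ (Fin n)) : l1Norm v ≤ n * ‖v‖ :=
  l1Norm_le_mul fun i => PiLp.norm_apply_le v i

theorem clm_norm_le_of_entries {A : EuclideanSpace ℝ (Fin n) →L[ℝ] EuclideanSpace ℝ (Fin n)}
    {C : ℝ} (hC : 0 ≤ C) (h : ∀ i j, |A (EuclideanSpace.single j 1) i| ≤ C) :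
    ‖A‖ ≤ n * (n * C) := by
  refine A.opNorm_le_bound (by positivity) fun v => ?_
  have e : A v = ∑ j, v j • A (EuclideanSpace.single j 1) := by
    conv_lhs => rw [← (EuclideanSpace.basisFun (Fin n) ℝ).sum_repr v, map_sum]
    exact Finset.sum_congr rfl fun j _ => by
      rw [map_smul, EuclideanSpace.basisFun_apply, EuclideanSpace.basisFun_repr]
  rw [e]
  refine (norm_sum_le _ _).trans ?_
  calc ∑ j, ‖v j • A (EuclideanSpace.single j 1)‖ ≤ ∑ _j : Fin n, ‖v‖ * (n * C) := by
        refine Finset.sum_le_sum fun j _ => ?_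
        rw [norm_smul]
        exact mul_le_mul (PiLp.norm_apply_le v j)
          ((norm_le_l1Norm _).trans (l1Norm_le_mul fun i => h i j)) (norm_nonneg _) (norm_nonneg _)
    _ = n * (n * C) * ‖v‖ := by simp; ring

/-- Sums over k give constants common to all fields. Absolute values are taken because for n = 0 the
hypotheses impose no sign on the bounds. -/
theorem regularFields_of_fieldBounds
    {U : Fin d → EuclideanSpace ℝ (Fin n) → EuclideanSpace ℝ (Fin n)} {M M₁ M₂ : Fin d → ℝ}
    (hU : ∀ k, FieldBounds (U k) (M k) (M₁ k) (M₂ k)) :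
    RegularFields U (fun k => fderiv ℝ (U k)) (n * ∑ k, |M k|) (n * ∑ k, |M₁ k|)
      (n * (n * ∑ k, |M₂ k|)) := by
  have hsum : ∀ (m : Fin d → ℝ) k, m k ≤ ∑ k, |m k| := fun m k =>
    (le_abs_self _).trans
      (Finset.single_le_sum (f := fun k => |m k|) (fun _ _ => abs_nonneg _) (Finset.mem_univ k))
  have hs0 : ∀ m : Fin d → ℝ, 0 ≤ ∑ k, |m k| := fun m => Finset.sum_nonneg fun _ _ => abs_nonneg _
  refine ⟨fun k x => ((hU k).differentiable x).hasFDerivAt, fun k x => ?_, fun k x => ?_,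
    fun k x y => ?_, ?_⟩
  · exact (norm_le_l1Norm _).trans
      (l1Norm_le_mul fun i => ((hU k).bounded i x).trans (hsum M k))
  · refine norm_fderiv_le_of_lip' ℝ (mul_nonneg (Nat.cast_nonneg n) (hs0 M₁))
      (Filter.Eventually.of_forall fun y => ?_)
    rw [mul_assoc]
    refine (norm_le_l1Norm _).trans (l1Norm_le_mul fun i => ?_)
    exact ((hU k).lipschitz i y x).trans
      (mul_le_mul_of_nonneg_right (hsum M₁ k) (norm_nonneg _))
  · rw [mul_assoc, mul_assoc]
    refine clm_norm_le_of_entries (mul_nonneg (hs0 M₂) (norm_nonneg _)) fun i j => ?_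
    exact ((hU k).lipschitz_deriv i j x y).trans
      (mul_le_mul_of_nonneg_right (hsum M₂ k) (norm_nonneg _))
  · have h1 := hs0 M
    have h2 := hs0 M₁
    have h3 := hs0 M₂
    refine ⟨by positivity, by positivity, by positivity⟩

variable {α β T G M L₁ L₂ P κ : ℝ}
  {U : Fin d → EuclideanSpace ℝ (Fin n) → EuclideanSpace ℝ (Fin n)}
  {DU : Fin d → EuclideanSpace ℝ (Fin n) →
    EuclideanSpace ℝ (Fin n) →L[ℝ] EuclideanSpace ℝ (Fin n)}
  {b : Fin d → ℝ → ℝ} {Φ : ℝ → EuclideanSpace ℝ (Fin n) → EuclideanSpace ℝ (Fin n)}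

theorem IsFlowDrivenBy.apply_zero (hT : 0 ≤ T) (hΦ : IsFlowDrivenBy α T U b Φ)
    (x : EuclideanSpace ℝ (Fin n)) : Φ 0 x = x := by
  ext i
  rw [hΦ.solves x 0 ⟨le_rfl, hT⟩ i]
  simp [genStieltjes]

/-- Along a (1-α)-Hölder path the integrands U k ∘ Φ are again (1-α)-Hölder. The Young estimate
needs this order to exceed α, which is where α < 1/2 enters. -/
theorem IsFlowDrivenBy.isYoungSolution (h0 : 0 < α) (h1 : α < 1 / 2) (hβ : 1 - α < β)
    (hT : 0 ≤ T) (hU : RegularFields U DU M L₁ L₂) (hG : 0 ≤ G)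
    (hb : ∀ k, HolderBound 0 T β G (b k)) (hΦ : IsFlowDrivenBy α T U b Φ)
    (x : EuclideanSpace ℝ (Fin n)) :
    IsYoungSolution T (1 - α) (1 - α + β) U b (fun t => Φ t x) := by
  have hhol := (hΦ.holder x).holderBound (by linarith)
  set A := pathHolderNorm (1 - α) T (fun t => Φ t x) with hA
  have hA0 : 0 ≤ A := pathHolderNorm_nonneg
  refine ⟨⟨A, hA0, hhol⟩, n * (d * (youngConst (1 - α + β) * (L₁ * A * G))), ?_⟩
  have hL₁ := hU.nonneg.2.1
  have hf : ∀ k i, HolderBound 0 T (1 - α) (L₁ * A) (fun s => U k (Φ s x) i) := by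
    intro k i s t hs hst ht
    refine (PiLp.norm_apply_le (U k (Φ t x) - U k (Φ s x)) i).trans ?_
    refine (hU.lipschitz k _ _).trans ?_
    rw [mul_assoc]
    exact mul_le_mul_of_nonneg_left (hhol s t hs hst ht) hL₁
  intro s t hs hst ht
  rw [mul_assoc]
  refine (norm_le_l1Norm _).trans (l1Norm_le_mul fun i => ?_)
  have e : (Φ t x - Φ s x - ∑ k, (b k t - b k s) • U k (Φ s x)) i
      = ∑ k, (genStieltjes α 0 t (fun s => U k (Φ s x) i) (b k)
        - genStieltjes α 0 s (fun s => U k (Φ s x) i) (b k)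
        - (b k t - b k s) * U k (Φ s x) i) := by
    simp only [PiLp.sub_apply, WithLp.ofLp_sum, Finset.sum_apply, PiLp.smul_apply, smul_eq_mul,
      Finset.sum_sub_distrib]
    rw [hΦ.solves x t ⟨hs.trans hst, ht⟩ i, hΦ.solves x s ⟨hs, hst.trans ht⟩ i]
    ring
  rw [e]
  refine (Finset.abs_sum_le_sum_abs _ _).trans ?_
  refine (Finset.sum_le_sum (g := fun _ => youngConst (1 - α + β) * (L₁ * A * G)
    * (t - s) ^ (1 - α + β)) fun k _ => ?_).trans (le_of_eq (by simp; ring))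
  have h := isYoung_genStieltjes h0 (by linarith) (by linarith) hβ hT (by positivity) hG (hf k i)
    (hb k) s t hs hst ht
  simpa using h

/-- Differentiability and exponential growth of the flow, for Hölder continuous drivers. -/
theorem IsFlowDrivenBy.differentiableAt_and_l1Norm_pushForward_le (h0 : 0 < α) (h1 : α < 1 / 2)
    (hβ : 1 - α < β) (hβ1 : β < 1) (hT : 0 < T) (hU : RegularFields U DU M L₁ L₂) (hG : 0 ≤ G)
    (hb : ∀ k, HolderBound 0 T β G (b k)) (hΦ : IsFlowDrivenBy α T U b Φ)
    (hM : M ≤ P) (hL : L₁ + 2 * L₂ ≤ P) (hκ : 0 < κ)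
    (hsmall : 2 * (κ * d * P * (1 + 2 * youngConst (1 - α + β))) ≤ 1)
    (x v : EuclideanSpace ℝ (Fin n)) {r : ℝ} (hr : r ∈ Icc 0 T) :
    DifferentiableAt ℝ (Φ r) x ∧ l1Norm (pushForward Φ x v r)
      ≤ 4 * (n + 1) * l1Norm v * 2 ^ (κ ^ (-(1 / β)) * G ^ (1 / β) * T) := by
  have hβ0 : 0 < β := by linarith
  -- The largest admissible step solves GΔ^β = κ. For G = 0 any step is admissible, and Δ = T gives
  -- the factor 2² = 4, which also covers the factor 2 of the other case.
  obtain ⟨Δ, hΔ, hGΔ, hexp⟩ : ∃ Δ, 0 < Δ ∧ G * Δ ^ β ≤ κ ∧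
      (2 : ℝ) ^ (1 + T / Δ) ≤ 4 * 2 ^ (κ ^ (-(1 / β)) * G ^ (1 / β) * T) := by
    rcases hG.eq_or_lt with rfl | hGpos
    · refine ⟨T, hT, by simpa using hκ.le, ?_⟩
      rw [div_self hT.ne', Real.zero_rpow (by positivity)]
      norm_num
    · refine ⟨(κ / G) ^ (1 / β), by positivity, ?_, ?_⟩
      · rw [← Real.rpow_mul (by positivity), one_div_mul_cancel hβ0.ne', Real.rpow_one,
          mul_div_cancel₀ _ hGpos.ne']
      · have e : T / (κ / G) ^ (1 / β) = κ ^ (-(1 / β)) * G ^ (1 / β) * T := by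
          rw [Real.div_rpow hκ.le hG, Real.rpow_neg hκ.le]
          field_simp
        rw [e, Real.rpow_add (by norm_num), Real.rpow_one]
        gcongr
        norm_num
  have hP : 0 ≤ P := hU.nonneg.1.trans hM
  have hs : StepSize T (1 - α) β P κ Δ G b :=
    ⟨by linarith, hβ.le, by linarith, hP, hΔ, hG, hGΔ, by simpa using hsmall, hb⟩
  have hφ := hΦ.isYoungSolution h0 h1 hβ hT.le hU hG hb
  have hφ0 := hΦ.apply_zero hT.le
  refine ⟨differentiableAt_flow (φ := fun x t => Φ t x) hφ hφ0 (by linarith) hU hs hM hL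
    (by linarith) hβ1 hr x, ?_⟩
  set c : ℝ := 4 * 2 ^ (κ ^ (-(1 / β)) * G ^ (1 / β) * T) with hc
  have hc0 : 0 ≤ c := by positivity
  -- The derivative is bounded by the global Lipschitz constant of the flow.
  have hlip : ‖fderiv ℝ (Φ r) x‖ ≤ c := by
    refine norm_fderiv_le_of_lip' ℝ hc0 (Filter.Eventually.of_forall fun y => ?_)
    have := (hφ y).norm_sub_le (hφ x) (by linarith) hU hs hM hL hr
    rw [hφ0, hφ0] at this
    refine this.trans (mul_le_mul_of_nonneg_right (le_trans ?_ hexp) (norm_nonneg _))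
    refine Real.rpow_le_rpow_of_exponent_le (by norm_num) ?_
    have := div_le_div_of_nonneg_right hr.2 hΔ.le
    linarith
  have hv : 0 ≤ l1Norm v := (norm_nonneg v).trans (norm_le_l1Norm v)
  calc l1Norm (pushForward Φ x v r) ≤ n * ‖pushForward Φ x v r‖ := l1Norm_le_mul_norm _
    _ ≤ n * (c * l1Norm v) := by
        refine mul_le_mul_of_nonneg_left ?_ (Nat.cast_nonneg n)
        exact (ContinuousLinearMap.le_opNorm _ _).trans
          (mul_le_mul hlip (norm_le_l1Norm v) (norm_nonneg _) hc0)
    _ ≤ (n + 1) * (c * l1Norm v) := by gcongr; linarith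
    _ = _ := by rw [hc]; ring

end EuclideanFields

/-! ### Moments of the growth exponent -/

section Moments

variable {Ω : Type*} [MeasurableSpace Ω] {μ : Measure Ω} [IsProbabilityMeasure μ]

theorem integrable_rpow_and_integral_rpow_le {X : Ω → ℝ} {p : ℝ} (hX : Integrable X μ)
    (hX0 : ∀ ω, 0 ≤ X ω) (hp0 : 0 < p) (hp1 : p ≤ 1) :
    Integrable (fun ω => X ω ^ p) μ ∧ ∫ ω, X ω ^ p ∂μ ≤ (∫ ω, X ω ∂μ) ^ p := by
  have hi : Integrable (fun ω => X ω ^ p) μ := by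
    refine ((integrable_const 1).add hX).mono'
      (hX.aemeasurable.pow_const p).aestronglyMeasurable (.of_forall fun ω => ?_)
    rw [Real.norm_of_nonneg (Real.rpow_nonneg (hX0 ω) p), Pi.add_apply]
    rcases le_total (X ω) 1 with h | h
    · exact (Real.rpow_le_one (hX0 ω) h hp0.le).trans (by linarith [hX0 ω])
    · have := Real.rpow_le_rpow_of_exponent_le h hp1
      rw [Real.rpow_one] at this
      linarith
  refine ⟨hi, ?_⟩
  exact (Real.concaveOn_rpow hp0.le hp1).le_map_integral
    (continuousOn_id.rpow_const fun _ _ => Or.inr hp0.le) isClosed_Ici (.of_forall hX0) hX hi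

/-- Since β > 1/2, S^(1/β) = (S²)^(1/(2β)) is a concave function of S². Jensen gives (E S^(1/β))^β ≤
(E S²)^(1/2), and Cauchy-Schwarz over the d summands gives E S² ≤ d² K m². -/
theorem moment_bounds_of_sq_moment_bound {d : ℕ} {N : Fin d → Ω → ℝ} {K m a β : ℝ}
    (hβ : 1 / 2 < β) (hβ1 : β < 1) (ha : 0 ≤ a) (hN0 : ∀ k ω, 0 ≤ N k ω) (hN : ∀ k, MemLp (N k) 2 μ)
    (hm : 0 ≤ m) (hsq : ∀ k, ∫ ω, N k ω ^ 2 ∂μ ≤ K * m ^ 2) :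
    Integrable (fun ω => a * (∑ k, N k ω) ^ (1 / β)) μ ∧
    ∫ ω, (a * (∑ k, N k ω) ^ (1 / β)) ^ β ∂μ ≤ (∫ ω, a * (∑ k, N k ω) ^ (1 / β) ∂μ) ^ β ∧
    (∫ ω, a * (∑ k, N k ω) ^ (1 / β) ∂μ) ^ β ≤ a ^ β * (d * √K) * m := by
  have hβ0 : 0 < β := by linarith
  set S : Ω → ℝ := fun ω => ∑ k, N k ω with hS
  have hS0 : ∀ ω, 0 ≤ S ω := fun ω => Finset.sum_nonneg fun k _ => hN0 k ω
  have hSm : MemLp S 2 μ := memLp_finsetSum _ fun k _ => hN k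
  have hS2 : Integrable (fun ω => S ω ^ 2) μ := hSm.integrable_sq
  have hp0 : 0 < 1 / (2 * β) := by positivity
  have hp1 : 1 / (2 * β) ≤ 1 := by rw [div_le_one (by positivity)]; linarith
  have e : ∀ ω, S ω ^ (1 / β) = (S ω ^ 2) ^ (1 / (2 * β)) := by
    intro ω
    rw [← Real.rpow_natCast, ← Real.rpow_mul (hS0 ω)]
    congr 1
    push_cast; field_simp
  obtain ⟨hi, hle⟩ := integrable_rpow_and_integral_rpow_le hS2 (fun ω => sq_nonneg _) hp0 hp1
  simp only [← e] at hi hle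
  have hCT := hi.const_mul a
  have hCT0 : ∀ ω, 0 ≤ a * S ω ^ (1 / β) := fun ω => mul_nonneg ha (Real.rpow_nonneg (hS0 ω) _)
  refine ⟨hCT, (integrable_rpow_and_integral_rpow_le hCT hCT0 hβ0 hβ1.le).2, ?_⟩
  have hSS : ∫ ω, S ω ^ 2 ∂μ ≤ d * (d * (K * m ^ 2)) := by
    calc ∫ ω, S ω ^ 2 ∂μ ≤ ∫ ω, d * ∑ k, N k ω ^ 2 ∂μ := by
          refine integral_mono hS2
            ((integrable_finsetSum _ fun k _ => (hN k).integrable_sq).const_mul _) fun ω => ?_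
          simpa using sq_sum_le_card_mul_sum_sq (s := Finset.univ) (f := fun k => N k ω)
      _ = d * ∑ k, ∫ ω, N k ω ^ 2 ∂μ := by
          rw [integral_const_mul, integral_finsetSum _ fun k _ => (hN k).integrable_sq]
      _ ≤ d * ∑ _k : Fin d, K * m ^ 2 := by gcongr; exact hsq _
      _ = _ := by simp
  have hI0 : 0 ≤ ∫ ω, S ω ^ (1 / β) ∂μ := integral_nonneg fun ω => Real.rpow_nonneg (hS0 ω) _
  have hI2 : 0 ≤ ∫ ω, S ω ^ 2 ∂μ := integral_nonneg fun ω => sq_nonneg _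
  rw [integral_const_mul, Real.mul_rpow ha hI0, mul_assoc]
  refine mul_le_mul_of_nonneg_left ?_ (Real.rpow_nonneg ha _)
  calc (∫ ω, S ω ^ (1 / β) ∂μ) ^ β ≤ ((∫ ω, S ω ^ 2 ∂μ) ^ (1 / (2 * β))) ^ β := by gcongr
    _ = √(∫ ω, S ω ^ 2 ∂μ) := by
        rw [← Real.rpow_mul hI2, Real.sqrt_eq_rpow]
        congr 1
        field_simp
    _ ≤ √((d * m) ^ 2 * K) := Real.sqrt_le_sqrt (hSS.trans (le_of_eq (by ring)))
    _ = d * √K * m := by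
        rw [Real.sqrt_mul (sq_nonneg _), Real.sqrt_sq (by positivity)]
        ring

end Moments

/-! ### The growth theorem -/

theorem theorem3p1 (n d : ℕ) (α β : ℝ) (M M₁ M₂ : Fin d → ℝ) :
    -- the constants and the function giving the random variable depend only on the data above
    ∃ (c C C₁ : ℝ) (F : (Fin d → ℝ) → ℝ), 0 < c ∧ 0 ≤ C ∧ 0 ≤ C₁ ∧ Measurable F ∧ (∀ h, 0 ≤ F h) ∧
      ∀ (H δ ε : ℝ), 0 < H → H < 1 → 0 < ε → ε < δ → α = 1 - H + δ → β = H - ε →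
        1 - H < α → α < 1 / 2 →
      ∀ (U : Fin d → EuclideanSpace ℝ (Fin n) → EuclideanSpace ℝ (Fin n)),
        (∀ k, FieldBounds (U k) (M k) (M₁ k) (M₂ k)) →
      ∀ {Ω : Type*} [MeasurableSpace Ω] (μ : Measure Ω) [IsProbabilityMeasure μ]
        (B : Fin d → ℝ → Ω → ℝ),
        (∀ k, IsFractionalBrownianMotion H (B k) μ) →
        iIndepFun (fun (k : Fin d) (ω : Ω) (t : ℝ≥0) => B k t ω) μ →
      ∀ (T : ℝ), 0 < T →
      ∀ (Φ : Ω → ℝ → EuclideanSpace ℝ (Fin n) → EuclideanSpace ℝ (Fin n)),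
        (∀ᵐ ω ∂μ, IsFlowDrivenBy α T U (fun k t => B k t ω) (Φ ω)) →
      ∀ (N : Fin d → Ω → ℝ) (CT : Ω → ℝ),
        (N = fun k ω => pathHolderNorm β T (fun t => B k t ω)) →
        (CT = fun ω => F (fun k => N k ω)) →
        -- the Hölder norms are almost surely finite
        (∀ᵐ ω ∂μ, ∀ k, IsHolderPath β T (fun t => B k t ω)) ∧
        -- the growth estimate
        (∀ᵐ ω ∂μ, ∀ x v : EuclideanSpace ℝ (Fin n),
          (∀ r ∈ Icc 0 T, DifferentiableAt ℝ (Φ ω r) x) ∧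
          (⨆ r ∈ Icc 0 T, ENNReal.ofReal ‖pushForward (Φ ω) x v r‖)
            ≤ (⨆ r ∈ Icc 0 T, ENNReal.ofReal (l1Norm (pushForward (Φ ω) x v r))) ∧
          (⨆ r ∈ Icc 0 T, ENNReal.ofReal (l1Norm (pushForward (Φ ω) x v r)))
            ≤ ENNReal.ofReal (c * l1Norm v * 2 ^ (CT ω * T))) ∧
        -- the moment estimate
        (∀ k, Integrable (N k) μ) ∧ Integrable CT μ ∧
        (∀ k, ∫ ω, CT ω ^ β ∂μ ≤ (∫ ω, CT ω ∂μ) ^ β ∧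
          (∫ ω, CT ω ∂μ) ^ β ≤ C * ∫ ω, N k ω ∂μ) ∧
        -- the case of a single driving process
        (d = 1 → ∀ k, ∀ᵐ ω ∂μ, ∀ x v : EuclideanSpace ℝ (Fin n),
          (⨆ r ∈ Icc 0 T, ENNReal.ofReal ‖pushForward (Φ ω) x v r‖)
            ≤ ENNReal.ofReal (c * l1Norm v * 2 ^ (C₁ * T * N k ω ^ (1 / β)))) := by
  -- The constants must be chosen before H, δ and ε. The hypotheses imply these inequalities through
  -- 1 - α = H - δ < H - ε = β; when they fail, any constants do.
  by_cases hfeas : 0 < α ∧ α < 1 / 2 ∧ 1 - α < β ∧ β < 1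
  swap
  · refine ⟨1, 0, 0, fun _ => 0, one_pos, le_rfl, le_rfl, measurable_const, fun _ => le_rfl, ?_⟩
    intro H δ ε hH0 hH1 hε hεδ hα hβ h1 h2
    exact absurd ⟨by linarith, h2, by linarith, by linarith⟩ hfeas
  obtain ⟨h0, h1, hαβ, hβ1⟩ := hfeas
  have hβ0 : 0 < β := by linarith
  obtain ⟨K, hK0, hK⟩ := exists_pathHolderNorm_sq_moment_bound
  set P : ℝ := n * ∑ k, |M k| + (n * ∑ k, |M₁ k| + 2 * (n * (n * ∑ k, |M₂ k|))) with hP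
  have hs0 : ∀ m : Fin d → ℝ, 0 ≤ ∑ k, |m k| := fun m => Finset.sum_nonneg fun _ _ => abs_nonneg _
  have hM := hs0 M
  have hM₁ := hs0 M₁
  have hM₂ := hs0 M₂
  have hP0 : 0 ≤ P := by positivity
  set Q : ℝ := d * P * (1 + 2 * youngConst (1 - α + β)) with hQ
  have hy : 0 ≤ youngConst (1 - α + β) := youngConst_nonneg (by linarith)
  have hQ0 : 0 ≤ Q := by positivity
  -- Chosen so that 2κQ ≤ 1; the summand 1 keeps κ positive and finite when Q = 0.
  set κ : ℝ := 1 / (2 * (Q + 1)) with hκ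
  have hκ0 : 0 < κ := by positivity
  have hsmall : 2 * (κ * d * P * (1 + 2 * youngConst (1 - α + β))) ≤ 1 := by
    have e : 2 * (κ * d * P * (1 + 2 * youngConst (1 - α + β))) = 2 * (κ * Q) := by
      rw [hQ]; ring
    rw [e, hκ, div_mul_eq_mul_div, ← mul_div_assoc, div_le_one (by positivity)]
    linarith
  set a : ℝ := κ ^ (-(1 / β)) with ha
  have ha0 : 0 ≤ a := by positivity
  -- The factor n + 1 instead of n keeps c positive for n = 0, and the absolute values make F
  -- nonnegative on all of its domain.
  refine ⟨4 * (n + 1), a ^ β * (d * √K), a, fun h => a * (∑ k, |h k|) ^ (1 / β), by positivity,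
    by positivity, ha0, ?_, fun h => mul_nonneg ha0 (Real.rpow_nonneg (hs0 h) _), ?_⟩
  · have : Measurable fun h : Fin d → ℝ => ∑ k, |h k| :=
      Finset.measurable_sum _ fun k _ => measurable_norm.comp (measurable_pi_apply k)
    exact (this.pow_const _).const_mul a
  intro H δ ε hH0 hH1 hε hεδ hα hβ h1H _ U hU Ω _ μ _ B hB _ T hT Φ hΦ N CT hN hCT
  have hβH : β < H := by linarith
  have hN0 : ∀ k ω, 0 ≤ N k ω := fun k ω => by rw [hN]; exact pathHolderNorm_nonneg
  have hCT' : CT = fun ω => a * (∑ k, N k ω) ^ (1 / β) := by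
    rw [hCT]
    funext ω
    simp only [abs_of_nonneg (hN0 _ ω)]
  have hhol : ∀ᵐ ω ∂μ, ∀ k, IsHolderPath β T (fun t => B k t ω) :=
    ae_all_iff.2 fun k => (hB k).ae_isHolderPath hβ0 hβH hT
  have hgrowth : ∀ᵐ ω ∂μ, ∀ x v : EuclideanSpace ℝ (Fin n), ∀ r ∈ Icc 0 T,
      DifferentiableAt ℝ (Φ ω r) x ∧ l1Norm (pushForward (Φ ω) x v r)
        ≤ 4 * (n + 1) * l1Norm v * 2 ^ (CT ω * T) := by
    filter_upwards [hhol, hΦ] with ω hω hΦω x v r hr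
    rw [hCT']
    -- The sum of the Hölder norms serves as one Hölder constant for all drivers.
    refine hΦω.differentiableAt_and_l1Norm_pushForward_le h0 h1 hαβ hβ1 hT
      (regularFields_of_fieldBounds hU) (Finset.sum_nonneg fun k _ => hN0 k ω) (fun k => ?_)
      (P := P) (le_add_of_nonneg_right (by positivity))
      (le_add_of_nonneg_left (by positivity)) hκ0 hsmall x v hr
    have hk : HolderBound 0 T β (N k ω) (fun t => B k t ω) := by
      rw [hN]
      exact (hω k).holderBound hβ0.le
    exact hk.mono_const
      (Finset.single_le_sum (f := fun k => N k ω) (fun k _ => hN0 k ω) (Finset.mem_univ k))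
  have hmom : ∀ k, MemLp (N k) 2 μ ∧ ∫ ω, N k ω ^ 2 ∂μ ≤ K * (∫ ω, N k ω ∂μ) ^ 2 := by
    intro k
    rw [hN]
    exact hK μ H β T (B k) hβ0 hβH hT (hB k)
  have hmean : ∀ k l, ∫ ω, N k ω ∂μ = ∫ ω, N l ω ∂μ := by
    intro k l
    rw [hN]
    exact (hB k).integral_pathHolderNorm_eq hβ0 hβH hT (hB l)
  have hbounds : ∀ m, 0 ≤ m → (∀ k, ∫ ω, N k ω ∂μ = m) → _ := fun m hm hk =>
    moment_bounds_of_sq_moment_bound (by linarith : 1 / 2 < β) hβ1 ha0 hN0 (fun k => (hmom k).1)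
      hm (fun k => hk k ▸ (hmom k).2)
  refine ⟨hhol, ?_, fun k => (hmom k).1.integrable (by norm_num), ?_, fun k => ?_, fun hd k => ?_⟩
  · filter_upwards [hgrowth] with ω hω x v
    refine ⟨fun r hr => (hω x v r hr).1, ?_, iSup₂_le fun r hr => ?_⟩
    · exact iSup₂_mono fun r _ => ENNReal.ofReal_le_ofReal (norm_le_l1Norm _)
    · exact ENNReal.ofReal_le_ofReal (hω x v r hr).2
  · rw [hCT']
    -- Without drivers there is no common mean to refer to, but then C_T is constant.
    rcases isEmpty_or_nonempty (Fin d) with hd | ⟨⟨k⟩⟩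
    · simp only [Finset.univ_eq_empty, Finset.sum_empty]
      exact integrable_const _
    · exact (hbounds _ (integral_nonneg (hN0 k)) fun l => hmean l k).1
  · rw [hCT']
    exact (hbounds _ (integral_nonneg (hN0 k)) fun l => hmean l k).2
  · subst hd
    filter_upwards [hgrowth] with ω hω x v
    refine iSup₂_le fun r hr => ENNReal.ofReal_le_ofReal ?_
    refine (norm_le_l1Norm _).trans ((hω x v r hr).2.trans (le_of_eq ?_))
    -- With one driver the sum has a single term, so the exponent is explicit and C₁ = a.
    have e : CT ω * T = a * T * N k ω ^ (1 / β) := by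
      rw [hCT', Subsingleton.elim k 0]
      simp only [Fin.sum_univ_one]
      ring
    rw [e]
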